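/- **Setting.** Let $d\ge 1$, $s\in(0,1/2)$, let $\Omega\subset\mathbb{R}^d$ be a bounded Lipschitz domain (a bounded open set, not necessarily connected, that is locally the region on one side of the graph of a Lipschitz function), $\Omega^c=\mathbb{R}^d\setminus\Omega$, and let $g\in L^\infty(\mathbb{R}^d)$ vanish a.e. outside a bounded set $\Lambda$ whose interior contains $\overline\Omega$. Put $Q_\Omega=(\mathbb{R}^d\times\mathbb{R}^d)\setminus(\Omega^c\times\Omega^c)$, $$F_s(\rho)=\int_0^\rho\frac{\rho-r}{(1+r^2)^{(d+1+2s)/2}}\,dr,\qquad \widetilde G_s(\rho)=\int_0^1(1+\rho^2r^2)^{-(d+1+2s)/2}\,dr,$$ $$I_s[v]=\iint_{Q_\Omega}F_s\Big(\frac{v(x)-v(y)}{|x-y|}\Big)\frac{dx\,dy}{|x-y|^{d+2s-1}},$$ $$a_u(w,v)=\iint_{Q_\Omega}\widetilde G_s\Big(\frac{u(x)-u(y)}{|x-y|}\Big)\frac{(w(x)-w(y))(v(x)-v(y))}{|x-y|^{d+1+2s}}\,dx\,dy.$$ Let $\mathbb{V}^g$ be the set of all $v:\mathbb{R}^d\to\mathbb{R}$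 with $v|_\Omega\in W^{2s}_1(\Omega)$ (that is, $v\in L^1(\Omega)$ and $\iint_{\Omega\times\Omega}\frac{|v(x)-v(y)|}{|x-y|^{d+2s}}\,dx\,dy<\infty$), $v=g$ a.e. in $\Omega^c$, and $\iint_{Q_\Omega}\frac{|v(x)-v(y)|}{|x-y|^{d+2s}}\,dx\,dy<\infty$; $\mathbb{V}^0$ is this set for $g=0$. **Discretization.** Let $\{\mathcal{T}_h\}$ be a family of finite conforming simplicial meshes of $\Lambda$ with closed elements, each of which meshes $\Omega$ exactly ($\overline\Omega$ is a union of elements), indexed by the mesh size $h=\max_{T\in\mathcal{T}_h}\operatorname{diam}T$ (several meshes may have the same $h$). Assume that it is shape-regular: there is a constant $\sigma$ with $\operatorname{diam}T\le\sigma\rho_T$ for every element $T$ of every mesh, where $\rho_T$ is the diameter of the largest ball contained in $T$. Let $\mathbb{V}_h$ be the space of continuous functions on $\Lambda$ that are affine on each $T\in\mathcal{T}_h$, extended by zero to $\mathbb{R}^d$; for a node (vertex) $z$ of the mesh let $\varphi_z\in\mathbb{V}_h$ be its Lagrange basis function and $S_z$ the union of the elements that have $z$ as a vertex. Let $$\Pi_h^cg=\sum_{z\in\Omega^c}(\Pi_h^zg)(z)\,\varphi_z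 ,$$ the sum being over the nodes in $\Omega^c$ (those on $\partial\Omega$ included) and $\Pi_h^zg$ being the $L^2$-projection of $g|_{S_z\cap\Omega^c}$ onto the affine functions on $S_z\cap\Omega^c$. Set $\mathbb{V}_h^g=\{v\in\mathbb{V}_h: v=\Pi_h^cg\text{ on }\Lambda\setminus\Omega\}$, and $\mathbb{V}_h^0=\{v\in\mathbb{V}_h: v=0\text{ on }\Lambda\setminus\Omega\}$. **Theorem (energy consistency).** Let $u\in\mathbb{V}^g$ satisfy $a_u(u,v)=0$ for all $v\in\mathbb{V}^0$, and for each mesh let $u_h\in\mathbb{V}_h^g$ satisfy $a_{u_h}(u_h,v_h)=0$ for all $v_h\in\mathbb{V}_h^0$. Then $I_s[u]$ and all $I_s[u_h]$ are finite, and $$\lim_{h\to0}I_s[u_h]=I_s[u].$$ -/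

import Mathlib

open MeasureTheory Filter Topology Set
open scoped ENNReal RealInnerProductSpace

noncomputable section

namespace NonlocalMinimalGraph

/-- The space `ℝᵈ` with its Euclidean norm. -/
abbrev E (d : ℕ) : Type := EuclideanSpace ℝ (Fin d)

/-- A bounded open set whose boundary is, near each of its points and in suitable orthonormal
coordinates, the graph of a Lipschitz function with the set on exactly one side of the graph.
The unit vector `e` is the vertical direction, `⟪e, y⟫` the vertical coordinate of `y`, and
`φ` is only evaluated at the projection of `y` on the hyperplane orthogonal to `e`.
Connectedness is not required. -/
structure IsBoundedLipschitzDomain {d : ℕ} (Ω : Set (E d)) : Prop where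
  isOpen : IsOpen Ω
  isBounded : Bornology.IsBounded Ω
  lipschitz_boundary : ∀ x ∈ frontier Ω, ∃ e : E d, ‖e‖ = 1 ∧ ∃ (φ : E d → ℝ) (L : NNReal),
    LipschitzWith L φ ∧ ∃ r > 0, ∀ y ∈ Metric.ball x r, y ∈ Ω ↔ φ (y - ⟪e, y⟫ • e) < ⟪e, y⟫

/-! ### The continuous problem -/

/-- `Q_Ω = (ℝᵈ × ℝᵈ) \ (Ωᶜ × Ωᶜ)`. -/
def Q {d : ℕ} (Ω : Set (E d)) : Set (E d × E d) := (Ωᶜ ×ˢ Ωᶜ)ᶜ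

/-- `F_s(ρ) = ∫₀^ρ (ρ - r) (1 + r²)^{-(d+1+2s)/2} dr`. -/
def F (d : ℕ) (s ρ : ℝ) : ℝ :=
  ∫ r in (0 : ℝ)..ρ, (ρ - r) / (1 + r ^ 2) ^ (((d : ℝ) + 1 + 2 * s) / 2)

/-- `G̃_s(ρ) = ∫₀¹ (1 + ρ² r²)^{-(d+1+2s)/2} dr`. -/
def Gtilde (d : ℕ) (s ρ : ℝ) : ℝ :=
  ∫ r in (0 : ℝ)..1, (1 + ρ ^ 2 * r ^ 2) ^ (-(((d : ℝ) + 1 + 2 * s) / 2))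

/-- The energy `I_s[u]`, the integral over `Q_Ω` of the nonnegative function
`F_s((u(x)-u(y))/|x-y|) |x-y|^{-(d+2s-1)}`, as an extended nonnegative real. -/
def energy {d : ℕ} (s : ℝ) (Ω : Set (E d)) (u : E d → ℝ) : ℝ≥0∞ :=
  ∫⁻ p in Q Ω, ENNReal.ofReal
    (F d s ((u p.1 - u p.2) / ‖p.1 - p.2‖) / ‖p.1 - p.2‖ ^ ((d : ℝ) + 2 * s - 1))

/-- `∬_A |v(x)-v(y)| / |x-y|^{d+2s} dx dy`. For `A = Ω × Ω` this is the seminorm of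
`W^{2s}_1(Ω)`, for `A = Q_Ω` it is the seminorm of the space `𝕍^g`. -/
def seminorm {d : ℕ} (s : ℝ) (A : Set (E d × E d)) (v : E d → ℝ) : ℝ≥0∞ :=
  ∫⁻ p in A, ENNReal.ofReal (|v p.1 - v p.2| / ‖p.1 - p.2‖ ^ ((d : ℝ) + 2 * s))

/-- The space `𝕍^g` of the functions `v : ℝᵈ → ℝ` with `v|_Ω ∈ W^{2s}_1(Ω)`, with `v = g`
(almost everywhere) in `Ωᶜ` and with finite seminorm over `Q_Ω`. -/
def V {d : ℕ} (s : ℝ) (Ω : Set (E d)) (g : E d → ℝ) : Set (E d → ℝ) :=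
  {v | IntegrableOn v Ω ∧ seminorm s (Ω ×ˢ Ω) v < ∞ ∧
    (∀ᵐ x ∂(volume : Measure (E d)), x ∉ Ω → v x = g x) ∧ seminorm s (Q Ω) v < ∞}

/-- The form `a_u(w, v)`. -/
def a {d : ℕ} (s : ℝ) (Ω : Set (E d)) (u w v : E d → ℝ) : ℝ :=
  ∫ p in Q Ω, Gtilde d s ((u p.1 - u p.2) / ‖p.1 - p.2‖) *
    ((w p.1 - w p.2) * (v p.1 - v p.2)) / ‖p.1 - p.2‖ ^ ((d : ℝ) + 1 + 2 * s)

/-- `u ∈ 𝕍^g` is a weak solution of the nonlocal minimal graph problem: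
`a_u(u, v) = 0` for all `v ∈ 𝕍^0`. -/
def IsWeakSolution {d : ℕ} (s : ℝ) (Ω : Set (E d)) (g u : E d → ℝ) : Prop :=
  u ∈ V s Ω g ∧ ∀ v ∈ V s Ω 0, a s Ω u u v = 0

/-! ### Meshes -/

/-- A simplicial complex in `ℝᵈ`, as a candidate for a mesh. By definition, two simplices of
the complex meet in a common face (conformity). -/
abbrev Complex (d : ℕ) : Type := Geometry.SimplicialComplex ℝ (E d)

/-- The elements `T` (closed `d`-simplices) of a mesh, given by their `d + 1` vertices. -/
def elements {d : ℕ} (K : Complex d) : Set (Finset (E d)) := {t ∈ K.faces | t.card = d + 1}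

/-- The closed simplex with vertex set `t`. -/
def simplex {d : ℕ} (t : Finset (E d)) : Set (E d) := convexHull ℝ (t : Set (E d))

/-- `K` is a conforming simplicial mesh of `Λ`: it has finitely many elements, each of its
faces is a face of a `d`-dimensional element, and its elements cover exactly `Λ`. -/
structure IsMesh {d : ℕ} (K : Complex d) (Λ : Set (E d)) : Prop where
  finite : K.faces.Finite
  pure : ∀ f ∈ K.faces, ∃ t ∈ elements K, f ⊆ t
  space_eq : K.space = Λ

/-- The mesh `K` exactly meshes `Ω`: the closure of `Ω` is a union of elements of `K`. -/
def MeshesExactly {d : ℕ} (K : Complex d) (Ω : Set (E d)) : Prop :=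
  ∃ S ⊆ elements K, closure Ω = ⋃ t ∈ S, simplex t

/-- `h_T = diam T`. -/
def elementSize {d : ℕ} (t : Finset (E d)) : ℝ := Metric.diam (simplex t)

/-- `ρ_T`, the diameter of the largest ball contained in `T`. -/
def inball {d : ℕ} (t : Finset (E d)) : ℝ :=
  sSup {δ | ∃ (c : E d) (r : ℝ), 0 ≤ r ∧ Metric.closedBall c r ⊆ simplex t ∧ δ = 2 * r}

/-- The mesh size `h = max_T h_T`. -/
def meshSize {d : ℕ} (K : Complex d) : ℝ := sSup (elementSize '' elements K)

/-- The star of the node `z`: the union of the elements that have `z` as a vertex, which is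
the support of the basis function of `z`. -/
def star {d : ℕ} (K : Complex d) (z : E d) : Set (E d) :=
  ⋃ t ∈ {t ∈ elements K | z ∈ t}, simplex t

/-! ### The discrete problem -/

/-- The space `𝕍_h` of the continuous piecewise linear functions on the meshed set, each of
them extended by zero to `ℝᵈ`. -/
def Vh {d : ℕ} (K : Complex d) : Set (E d → ℝ) :=
  {v | ContinuousOn v K.space ∧ (∀ t ∈ elements K, ∃ p : E d →ᵃ[ℝ] ℝ, EqOn v p (simplex t)) ∧
    ∀ x ∉ K.space, v x = 0}

open Classical in
/-- The Lagrange basis function of the node `z`: the function in `𝕍_h` that equals `1` at `z`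
and `0` at all the other nodes. -/
def hat {d : ℕ} (K : Complex d) (z : E d) : E d → ℝ :=
  Classical.epsilon fun φ => φ ∈ Vh K ∧ ∀ z' ∈ K.vertices, φ z' = if z' = z then 1 else 0

open Classical in
/-- On a mesh, the Lagrange basis function of each node exists. -/
theorem exists_hat {d : ℕ} {K : Complex d} {Λ : Set (E d)} (hK : IsMesh K Λ) (z : E d) :
    ∃ φ ∈ Vh K, ∀ z' ∈ K.vertices, φ z' = if z' = z then (1 : ℝ) else 0 := by
  have hq : ∀ t ∈ elements K, ∃ q : E d →ᵃ[ℝ] ℝ, ∀ y ∈ t, q y = if y = z then 1 else 0 := by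
    intro t ht
    by_cases hz : z ∈ t
    · have hind := K.indep ht.1
      have htop : affineSpan ℝ (range ((↑) : t → E d)) = ⊤ := by
        rw [hind.affineSpan_eq_top_iff_card_eq_finrank_add_one]
        simp [ht.2]
      let b : AffineBasis t ℝ (E d) := ⟨(↑), hind, htop⟩
      refine ⟨b.coord ⟨z, hz⟩, fun y hy => ?_⟩
      have := b.coord_apply ⟨z, hz⟩ ⟨y, hy⟩
      have hb : b ⟨y, hy⟩ = y := rfl
      rw [hb] at this
      rw [this]
      simp [eq_comm]
    · refine ⟨0, fun y hy => ?_⟩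
      rw [if_neg (fun h : y = z => hz (h ▸ hy))]
      rfl
  choose! q hq using hq
  have hspace : ∀ x ∈ K.space, ∃ t ∈ elements K, x ∈ simplex t := by
    intro x hx
    obtain ⟨f, hf, hxf⟩ := K.mem_space_iff.1 hx
    obtain ⟨t, ht, hft⟩ := hK.pure f hf
    exact ⟨t, ht, convexHull_mono (by exact_mod_cast hft) hxf⟩
  choose! τ hτ hxτ using hspace
  have hsub : ∀ t ∈ elements K, simplex t ⊆ K.space := fun t ht => K.convexHull_subset_space ht.1
  have hagree : ∀ t ∈ elements K, ∀ t' ∈ elements K, ∀ x ∈ simplex t, x ∈ simplex t' →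
      q t x = q t' x := by
    intro t ht t' ht' x hx hx'
    have h1 := K.inter_subset_convexHull ht.1 ht'.1 ⟨hx, hx'⟩
    have hconv : Convex ℝ ((q t - q t') ⁻¹' {(0 : ℝ)}) := (convex_singleton _).affine_preimage _
    have h2 : (t ∩ t' : Set (E d)) ⊆ (q t - q t') ⁻¹' {(0 : ℝ)} := by
      rintro y ⟨hy, hy'⟩
      simp [hq t ht y hy, hq t' ht' y hy']
    have := convexHull_min h2 hconv h1
    simpa [sub_eq_zero] using this
  let φ : E d → ℝ := fun x => if x ∈ K.space then q (τ x) x else 0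
  have hφ : ∀ t ∈ elements K, EqOn φ (q t) (simplex t) := by
    intro t ht x hx
    have hxs := hsub t ht hx
    simp only [φ, if_pos hxs]
    exact hagree _ (hτ x hxs) _ ht x (hxτ x hxs) hx
  have hunion : K.space = ⋃ t : elements K, simplex t.1 := by
    ext x
    simp only [mem_iUnion, Subtype.exists, exists_prop]
    exact ⟨fun hx => ⟨τ x, hτ x hx, hxτ x hx⟩, fun ⟨t, ht, hx⟩ => hsub t ht hx⟩
  have hfin : (elements K).Finite := hK.finite.subset fun t ht => ht.1
  refine ⟨φ, ⟨?_, fun t ht => ⟨q t, hφ t ht⟩, fun x hx => if_neg hx⟩, fun z' hz' => ?_⟩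
  · rw [hunion]
    have := hfin.to_subtype
    refine (locallyFinite_of_finite _).continuousOn_iUnion (fun t => ?_) (fun t => ?_)
    · exact (t.1.finite_toSet.isCompact_convexHull ℝ).isClosed
    · exact ((q t.1).continuous_of_finiteDimensional.continuousOn).congr (hφ t.1 t.2)
  · obtain ⟨t, ht, hft⟩ := hK.pure _ hz'
    have hz't : z' ∈ t := hft (by simp)
    rw [hφ t ht (subset_convexHull ℝ _ hz't), hq t ht z' hz't]

/-- The affine function `p` is the `L²(S)`-projection of `f` onto `𝒫₁(S)`. -/
def IsL2Proj {d : ℕ} (S : Set (E d)) (f : E d → ℝ) (p : E d →ᵃ[ℝ] ℝ) : Prop :=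
  ∀ q : E d →ᵃ[ℝ] ℝ, ∫ x in S, (f x - p x) * q x = 0

/-- The `L²(S)`-projection of `f` onto `𝒫₁(S)`. -/
def l2Proj {d : ℕ} (S : Set (E d)) (f : E d → ℝ) : E d →ᵃ[ℝ] ℝ :=
  Classical.epsilon (IsL2Proj S f)

/-- The exterior Clément interpolant
`Π_h^c g = ∑_{z ∈ Ωᶜ} (Π_h^z g)(z) φ_z`, the sum being over the nodes in `Ωᶜ` (those on `∂Ω`
included) and `Π_h^z` being the `L²`-projection onto `𝒫₁(S_z ∩ Ωᶜ)`. -/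
def exteriorClement {d : ℕ} (K : Complex d) (Ω : Set (E d)) (g : E d → ℝ) (x : E d) : ℝ :=
  ∑ᶠ z ∈ K.vertices \ Ω, l2Proj (star K z ∩ Ωᶜ) g z * hat K z x

/-- The space `𝕍_h^g` of the functions in `𝕍_h` that equal `Π_h^c g` in `Λ \ Ω`. -/
def Vhg {d : ℕ} (K : Complex d) (Ω : Set (E d)) (g : E d → ℝ) : Set (E d → ℝ) :=
  {v ∈ Vh K | ∀ x ∈ K.space \ Ω, v x = exteriorClement K Ω g x}

/-- `w ∈ 𝕍_h^g` is a solution of the discrete problem: `a_w(w, v) = 0` for all `v ∈ 𝕍_h^0`. -/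
def IsDiscreteSolution {d : ℕ} (s : ℝ) (K : Complex d) (Ω : Set (E d)) (g w : E d → ℝ) : Prop :=
  w ∈ Vhg K Ω g ∧ ∀ v ∈ Vhg K Ω 0, a s Ω w w v = 0

end NonlocalMinimalGraph

end

/-! The density `F` is convex and its derivative `W` is bounded. Convexity turns both Euler-Lagrange
equations into minimality: in the integrated tangent-line inequality the linear term is the form `a`
tested with the difference of two competitors, hence zero (`energy_le_of_a_eq_zero`). Boundedness of
`W` makes the energy Lipschitz for the seminorm over Q_Ω (`energy_le_add`). So neither compactness
nor convergence of u_h to u is needed, only one good competitor in each class.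

For the upper bound, write u = u₀ + 1_{Ωᶜ} g, approximate u₀ by a Lipschitz φ supported inside Ω,
and compare u_h with the Lagrange interpolant of φ plus Π_h^c g. For the lower bound, compare u with
u_h + 1_{Ωᶜ}(g - Π_h^c g), which carries the exact exterior data. It remains to show that the
seminorms of the errors tend to zero.

This is one dominated-convergence argument (`tendsto_seminorm_zero_of_dominated`). Let δ be the
distance to Ωᶜ. If |v(x) - v(y)| ≤ N min(1, |x-y|/δ(x)) for x in Ω, then integrating over y against
|x-y|^{-d-2s} gives a multiple of δ(x)^{-2s}, which is integrable over Ω because 2s < 1. In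
particular, bounded jumps across ∂Ω have finite seminorm. Thus uniform bounds of this form and
convergence almost everywhere suffice. For Π_h^c g, the L¹-L^∞ stability of the local projections
gives a uniform bound; an element on which it does not vanish has a vertex outside Ω, so shape
regularity gives the slope bound N/δ up to a constant; Lebesgue points give convergence almost
everywhere.

For the density of such φ, the weight |u₀| δ^{-2s} is integrable because u₀ vanishes on Ωᶜ, which is
thick near Ω. This allows a cut-off, followed by mollification. The geometry of Ω is read off from a
single mesh; its Lipschitz boundary enters only through the inclusion of the interior of the closure
of Ω in Ω. -/

namespace NonlocalMinimalGraph

/-! ### The energy density -/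

/-- The derivative `W = F_s'` of the energy density. -/
noncomputable def W (d : ℕ) (s ρ : ℝ) : ℝ :=
  ∫ r in (0 : ℝ)..ρ, (1 + r ^ 2) ^ (-(((d : ℝ) + 1 + 2 * s) / 2))

theorem continuous_weight (q : ℝ) : Continuous fun r : ℝ => (1 + r ^ 2) ^ q :=
  Continuous.rpow_const (by fun_prop) fun r => Or.inl (by positivity)

theorem continuous_W (d : ℕ) (s : ℝ) : Continuous (W d s) :=
  intervalIntegral.continuous_primitive
    (fun _ _ => (continuous_weight _).intervalIntegrable _ _) 0

theorem F_eq (d : ℕ) (s ρ : ℝ) :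
    F d s ρ = ∫ r in (0 : ℝ)..ρ, (ρ - r) * (1 + r ^ 2) ^ (-(((d : ℝ) + 1 + 2 * s) / 2)) := by
  unfold F
  congr 1
  ext r
  rw [Real.rpow_neg (by positivity), div_eq_mul_inv]

/-- The Taylor remainder is ∫_a^b (b - r) w(r) dr with w > 0, which is nonnegative whatever the
order of a and b. This is the convexity behind minimality. -/
theorem W_mul_add_le_F (d : ℕ) (s a b : ℝ) : F d s a + W d s a * (b - a) ≤ F d s b := by
  have hc := continuous_weight (-(((d : ℝ) + 1 + 2 * s) / 2))
  rw [F_eq, F_eq, W]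
  set w : ℝ → ℝ := fun r => (1 + r ^ 2) ^ (-(((d : ℝ) + 1 + 2 * s) / 2)) with hw
  have hi : ∀ c x y : ℝ, IntervalIntegrable (fun r => (c - r) * w r) volume x y := fun c x y =>
    ((continuous_const.sub continuous_id).mul hc).intervalIntegrable _ _
  have hi' : ∀ x y : ℝ, IntervalIntegrable w volume x y := fun x y => hc.intervalIntegrable _ _
  have hpos : ∀ r, 0 ≤ w r := fun r => by positivity
  have h1 : ∫ r in (0 : ℝ)..b, (b - r) * w r =
      (∫ r in (0 : ℝ)..a, (b - r) * w r) + ∫ r in a..b, (b - r) * w r :=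
    (intervalIntegral.integral_add_adjacent_intervals (hi _ _ _) (hi _ _ _)).symm
  have h2 : ∫ r in (0 : ℝ)..a, (b - r) * w r =
      (∫ r in (0 : ℝ)..a, (a - r) * w r) + (∫ r in (0 : ℝ)..a, w r) * (b - a) := by
    rw [← intervalIntegral.integral_mul_const, ← intervalIntegral.integral_add (hi _ _ _)
      ((hi' _ _).mul_const _)]
    congr 1
    ext r
    ring
  have h3 : 0 ≤ ∫ r in a..b, (b - r) * w r := by
    rcases le_total a b with h | h
    · exact intervalIntegral.integral_nonneg h fun r hr =>
        mul_nonneg (by linarith [hr.2]) (hpos r)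
    · rw [intervalIntegral.integral_symm, ← intervalIntegral.integral_neg]
      refine intervalIntegral.integral_nonneg h fun r hr => ?_
      nlinarith [hr.1, hpos r]
  linarith

/-- The exponent (d+1+2s)/2 is at least 1, so `W` is dominated by the arctangent, and π/2 < 2. -/
theorem abs_W_le {d : ℕ} (hd : 1 ≤ d) {s : ℝ} (hs : 0 < s) (ρ : ℝ) : |W d s ρ| ≤ 2 := by
  have hd' : (1 : ℝ) ≤ d := by exact_mod_cast hd
  have h1 : |W d s ρ| ≤ |∫ r in (0 : ℝ)..ρ, 1 / (1 + r ^ 2)| := by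
    rw [W, ← Real.norm_eq_abs]
    refine intervalIntegral.norm_integral_le_abs_of_norm_le (ae_of_all _ fun r => ?_) ?_
    · rw [Real.norm_of_nonneg (by positivity), one_div, ← Real.rpow_neg_one]
      exact Real.rpow_le_rpow_of_exponent_le (by nlinarith [sq_nonneg r]) (by linarith)
    · refine Continuous.intervalIntegrable ?_ _ _
      exact continuous_const.div (by fun_prop) fun r => by positivity
  rw [integral_one_div_one_add_sq, Real.arctan_zero, sub_zero] at h1
  have h2 := Real.arctan_lt_pi_div_two ρ
  have h3 := Real.neg_pi_div_two_lt_arctan ρ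
  have h4 := Real.pi_lt_four
  exact h1.trans (abs_le.2 ⟨by linarith, by linarith⟩)

theorem F_zero (d : ℕ) (s : ℝ) : F d s 0 = 0 := by simp [F]

theorem F_nonneg (d : ℕ) (s ρ : ℝ) : 0 ≤ F d s ρ := by
  have := W_mul_add_le_F d s 0 ρ
  simpa [F_zero, W] using this

theorem F_sub_le {d : ℕ} (hd : 1 ≤ d) {s : ℝ} (hs : 0 < s) (a b : ℝ) :
    F d s a - F d s b ≤ 2 * |a - b| := by
  have h1 := W_mul_add_le_F d s a b
  have h2 : W d s a * (a - b) ≤ 2 * |a - b| := (le_abs_self _).trans (by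
    rw [abs_mul]; exact mul_le_mul_of_nonneg_right (abs_W_le hd hs a) (abs_nonneg _))
  linarith [mul_sub (W d s a) b a, mul_sub (W d s a) a b]

theorem continuous_F {d : ℕ} (hd : 1 ≤ d) {s : ℝ} (hs : 0 < s) : Continuous (F d s) := by
  refine LipschitzWith.continuous (K := 2) (LipschitzWith.of_dist_le_mul fun a b => ?_)
  rw [Real.dist_eq, Real.dist_eq, abs_le]
  have h1 := F_sub_le hd hs a b
  have h2 := F_sub_le hd hs b a
  rw [abs_sub_comm b a] at h2
  push_cast
  exact ⟨by linarith, h1⟩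

/-- Substitution t = ρr. It rewrites a_u(u, v) with the bounded factor `W` in front of the
difference quotient of v. -/
theorem Gtilde_mul_self (d : ℕ) (s ρ : ℝ) : Gtilde d s ρ * ρ = W d s ρ := by
  have := intervalIntegral.mul_integral_comp_mul_left (a := 0) (b := 1) (c := ρ)
    (f := fun t : ℝ => (1 + t ^ 2) ^ (-(((d : ℝ) + 1 + 2 * s) / 2)))
  simp only [mul_zero, mul_one, mul_pow] at this
  rw [mul_comm, Gtilde, W, this]

/-! ### The seminorm -/

section seminorm
variable {d : ℕ} {s : ℝ} {A : Set (E d × E d)} {v w : E d → ℝ}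

theorem aemeasurable_fst (hv : AEMeasurable v) : AEMeasurable (fun p : E d × E d => v p.1) :=
  hv.comp_quasiMeasurePreserving Measure.quasiMeasurePreserving_fst

theorem aemeasurable_snd (hv : AEMeasurable v) : AEMeasurable (fun p : E d × E d => v p.2) :=
  hv.comp_quasiMeasurePreserving Measure.quasiMeasurePreserving_snd

theorem ae_fst {P : E d → Prop} (h : ∀ᵐ x, P x) : ∀ᵐ p : E d × E d, P p.1 :=
  Measure.quasiMeasurePreserving_fst.ae h

theorem ae_snd {P : E d → Prop} (h : ∀ᵐ x, P x) : ∀ᵐ p : E d × E d, P p.2 :=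
  Measure.quasiMeasurePreserving_snd.ae h

theorem measurable_norm_sub_rpow (q : ℝ) :
    Measurable fun p : E d × E d => ‖p.1 - p.2‖ ^ q := by fun_prop

theorem aemeasurable_quotient (hv : AEMeasurable v) (q : ℝ) :
    AEMeasurable fun p : E d × E d => (v p.1 - v p.2) / ‖p.1 - p.2‖ ^ q :=
  ((aemeasurable_fst hv).sub (aemeasurable_snd hv)).div (measurable_norm_sub_rpow q).aemeasurable

theorem aemeasurable_seminorm_integrand (hv : AEMeasurable v) :
    AEMeasurable fun p : E d × E d =>
      ENNReal.ofReal (|v p.1 - v p.2| / ‖p.1 - p.2‖ ^ ((d : ℝ) + 2 * s)) := by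
  refine AEMeasurable.ennreal_ofReal (AEMeasurable.div ?_ (by fun_prop))
  exact continuous_abs.measurable.comp_aemeasurable
    ((aemeasurable_fst hv).sub (aemeasurable_snd hv))

theorem seminorm_congr_ae (h : v =ᵐ[volume] w) : seminorm s A v = seminorm s A w := by
  refine lintegral_congr_ae (ae_restrict_of_ae ?_)
  filter_upwards [ae_fst h, ae_snd h] with p h1 h2
  rw [h1, h2]

theorem seminorm_mono {B : Set (E d × E d)} (h : A ⊆ B) : seminorm s A v ≤ seminorm s B v :=
  lintegral_mono_set h

theorem seminorm_add_le (hv : AEMeasurable v) :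
    seminorm s A (v + w) ≤ seminorm s A v + seminorm s A w := by
  unfold seminorm
  rw [← lintegral_add_left' (aemeasurable_seminorm_integrand hv).restrict]
  refine lintegral_mono fun p => ?_
  rw [← ENNReal.ofReal_add (by positivity) (by positivity), ← add_div]
  refine ENNReal.ofReal_le_ofReal ?_
  gcongr
  calc |(v + w) p.1 - (v + w) p.2| = |(v p.1 - v p.2) + (w p.1 - w p.2)| := by
        simp only [Pi.add_apply]; congr 1; ring
    _ ≤ _ := abs_add_le _ _

theorem seminorm_neg : seminorm s A (-v) = seminorm s A v := by
  unfold seminorm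
  congr 1
  ext p
  rw [Pi.neg_apply, Pi.neg_apply, neg_sub_neg, abs_sub_comm]

theorem seminorm_sub_le (hv : AEMeasurable v) :
    seminorm s A (v - w) ≤ seminorm s A v + seminorm s A w := by
  rw [sub_eq_add_neg]
  exact (seminorm_add_le hv).trans (by rw [seminorm_neg])

end seminorm

/-! ### The energy -/

section energy
variable {d : ℕ} {s : ℝ} {Ω : Set (E d)} {u v w : E d → ℝ}

/-- Since d + 2s ≠ 0 this also holds at t = 0, so pointwise estimates need not exclude the diagonal.
-/
theorem rpow_split (hd : 1 ≤ d) (hs : 0 < s) {t : ℝ} (ht : 0 ≤ t) :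
    t ^ ((d : ℝ) + 2 * s) = t * t ^ ((d : ℝ) + 2 * s - 1) := by
  have hd' : (1 : ℝ) ≤ d := by exact_mod_cast hd
  rw [← Real.rpow_one_add' ht (by linarith)]
  congr 1
  ring

theorem F_quotient_le (hd : 1 ≤ d) (hs : 0 < s) (v w : E d → ℝ) (p : E d × E d) :
    F d s ((v p.1 - v p.2) / ‖p.1 - p.2‖) / ‖p.1 - p.2‖ ^ ((d : ℝ) + 2 * s - 1) ≤
      F d s ((w p.1 - w p.2) / ‖p.1 - p.2‖) / ‖p.1 - p.2‖ ^ ((d : ℝ) + 2 * s - 1) +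
        2 * (|(v - w) p.1 - (v - w) p.2| / ‖p.1 - p.2‖ ^ ((d : ℝ) + 2 * s)) := by
  set t := ‖p.1 - p.2‖ with ht
  have ht0 : 0 ≤ t := norm_nonneg _
  have h1 := F_sub_le hd hs ((v p.1 - v p.2) / t) ((w p.1 - w p.2) / t)
  rw [rpow_split hd hs ht0, ← div_div, ← mul_div_assoc, ← add_div]
  gcongr
  have h2 : |(v p.1 - v p.2) / t - (w p.1 - w p.2) / t| =
      |(v - w) p.1 - (v - w) p.2| / t := by
    rw [← sub_div, abs_div, abs_of_nonneg ht0]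
    congr 2
    simp only [Pi.sub_apply]
    ring
  rw [h2] at h1
  linarith

theorem aemeasurable_energy_integrand (hd : 1 ≤ d) (hs : 0 < s) (hv : AEMeasurable v) :
    AEMeasurable fun p : E d × E d =>
      F d s ((v p.1 - v p.2) / ‖p.1 - p.2‖) / ‖p.1 - p.2‖ ^ ((d : ℝ) + 2 * s - 1) := by
  refine AEMeasurable.div ?_ (by fun_prop)
  refine (continuous_F hd hs).measurable.comp_aemeasurable ?_
  simpa using aemeasurable_quotient hv 1

/-- The factor 2 is the Lipschitz constant of `F`. This stability reduces convergence of energies to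
convergence of seminorms. -/
theorem energy_le_add (hd : 1 ≤ d) (hs : 0 < s) (hw : AEMeasurable w) :
    energy s Ω v ≤ energy s Ω w + 2 * seminorm s (Q Ω) (v - w) := by
  unfold energy seminorm
  rw [← lintegral_const_mul' _ _ (by simp),
    ← lintegral_add_left' (aemeasurable_energy_integrand hd hs hw).ennreal_ofReal.restrict]
  refine lintegral_mono fun p => ?_
  refine (ENNReal.ofReal_le_ofReal (F_quotient_le hd hs v w p)).trans ?_
  refine ENNReal.ofReal_add_le.trans ?_
  rw [ENNReal.ofReal_mul (by norm_num)]
  simp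

theorem energy_zero : energy s Ω (0 : E d → ℝ) = 0 := by
  simp [energy, F_zero]

theorem energy_lt_top (hd : 1 ≤ d) (hs : 0 < s) (hv : seminorm s (Q Ω) v < ∞) :
    energy s Ω v < ∞ := by
  refine (energy_le_add (w := 0) hd hs aemeasurable_const).trans_lt ?_
  rw [energy_zero, sub_zero, zero_add]
  exact ENNReal.mul_lt_top (by simp) hv

theorem integrable_energy_integrand (hd : 1 ≤ d) (hs : 0 < s) (hv : AEMeasurable v)
    (h : energy s Ω v < ∞) : IntegrableOn (fun p : E d × E d =>
      F d s ((v p.1 - v p.2) / ‖p.1 - p.2‖) / ‖p.1 - p.2‖ ^ ((d : ℝ) + 2 * s - 1)) (Q Ω) := by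
  refine ⟨(aemeasurable_energy_integrand hd hs hv).aestronglyMeasurable.restrict, ?_⟩
  rw [hasFiniteIntegral_iff_ofReal (Eventually.of_forall fun p =>
    div_nonneg (F_nonneg _ _ _) (by positivity))]
  exact h

theorem a_integrand_eq (hd : 1 ≤ d) (hs : 0 < s) (u v : E d → ℝ) (p : E d × E d) :
    Gtilde d s ((u p.1 - u p.2) / ‖p.1 - p.2‖) * ((u p.1 - u p.2) * (v p.1 - v p.2)) /
        ‖p.1 - p.2‖ ^ ((d : ℝ) + 1 + 2 * s) =
      W d s ((u p.1 - u p.2) / ‖p.1 - p.2‖) *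
        ((v p.1 - v p.2) / ‖p.1 - p.2‖ ^ ((d : ℝ) + 2 * s)) := by
  set t := ‖p.1 - p.2‖ with ht
  have ht0 : 0 ≤ t := norm_nonneg _
  have h1 : t ^ ((d : ℝ) + 1 + 2 * s) = t * t ^ ((d : ℝ) + 2 * s) := by
    rw [← Real.rpow_one_add' ht0 (by positivity)]
    congr 1
    ring
  rw [h1, ← Gtilde_mul_self]
  simp only [div_eq_mul_inv, mul_inv]
  ring

/-- Integrate the tangent-line inequality of the convex density at u; the linear term is the
vanishing form. Only one test direction is required, so the lemma serves both the continuous and the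
discrete problem. -/
theorem energy_le_of_a_eq_zero (hd : 1 ≤ d) (hs : 0 < s) (hu : AEMeasurable u)
    (hw : AEMeasurable w) (hNu : seminorm s (Q Ω) u < ∞) (hN : seminorm s (Q Ω) (w - u) < ∞)
    (h : a s Ω u u (w - u) = 0) : energy s Ω u ≤ energy s Ω w := by
  have hNw : seminorm s (Q Ω) w < ∞ := by
    have : w = u + (w - u) := by abel
    rw [this]
    exact (seminorm_add_le hu).trans_lt (ENNReal.add_lt_top.2 ⟨hNu, hN⟩)
  have iu := integrable_energy_integrand hd hs hu (energy_lt_top hd hs hNu)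
  have iw := integrable_energy_integrand hd hs hw (energy_lt_top hd hs hNw)
  have iT : IntegrableOn (fun p : E d × E d => W d s ((u p.1 - u p.2) / ‖p.1 - p.2‖) *
      (((w - u) p.1 - (w - u) p.2) / ‖p.1 - p.2‖ ^ ((d : ℝ) + 2 * s))) (Q Ω) := by
    -- The linear term is integrable because `W` is bounded and the other factor has the finite
    -- seminorm of w - u as its L¹ norm.
    refine Integrable.bdd_mul (c := 2) ?_ ?_ (Eventually.of_forall fun p => abs_W_le hd hs _)
    · refine ⟨(aemeasurable_quotient (hw.sub hu) _).aestronglyMeasurable.restrict, ?_⟩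
      rw [hasFiniteIntegral_iff_norm]
      refine lt_of_eq_of_lt (lintegral_congr fun p => ?_) hN
      rw [Real.norm_eq_abs, abs_div, abs_of_nonneg (Real.rpow_nonneg (norm_nonneg _) _)]
    · refine ((continuous_W d s).measurable.comp_aemeasurable ?_).aestronglyMeasurable.restrict
      simpa using aemeasurable_quotient hu 1
  have hT : ∫ p in Q Ω, W d s ((u p.1 - u p.2) / ‖p.1 - p.2‖) *
      (((w - u) p.1 - (w - u) p.2) / ‖p.1 - p.2‖ ^ ((d : ℝ) + 2 * s)) = 0 := by
    rw [← h, a]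
    exact integral_congr_ae (Eventually.of_forall fun p => (a_integrand_eq hd hs u (w - u) p).symm)
  have nn : ∀ v : E d → ℝ, ∀ p : E d × E d, 0 ≤ F d s ((v p.1 - v p.2) / ‖p.1 - p.2‖) /
      ‖p.1 - p.2‖ ^ ((d : ℝ) + 2 * s - 1) := fun v p => div_nonneg (F_nonneg _ _ _) (by positivity)
  unfold energy
  rw [← ofReal_integral_eq_lintegral_ofReal iu (Eventually.of_forall (nn u)),
    ← ofReal_integral_eq_lintegral_ofReal iw (Eventually.of_forall (nn w))]
  refine ENNReal.ofReal_le_ofReal ?_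
  have key := integral_mono (iu.add iT) iw fun p => by
    simp only [Pi.add_apply]
    have ht0 : 0 ≤ ‖p.1 - p.2‖ := norm_nonneg _
    set t := ‖p.1 - p.2‖ with ht
    have := W_mul_add_le_F d s ((u p.1 - u p.2) / t) ((w p.1 - w p.2) / t)
    rw [rpow_split hd hs ht0, ← div_div, ← mul_div_assoc, ← add_div]
    refine div_le_div_of_nonneg_right (le_trans (le_of_eq ?_) this) (by positivity)
    rw [← sub_div]
    simp only [Pi.sub_apply]
    congr 3
    ring
  rw [integral_add' iu iT, hT, add_zero] at key
  exact key

end energy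


/-! ### Integrals of truncated kernels -/

section kernel
variable {d : ℕ} {s : ℝ} {Ω : Set (E d)}

/-- The distance to the complement of `Ω`. -/
noncomputable def depth (Ω : Set (E d)) (x : E d) : ℝ := Metric.infDist x Ωᶜ

theorem depth_nonneg (x : E d) : 0 ≤ depth Ω x := Metric.infDist_nonneg

@[fun_prop]
theorem continuous_depth : Continuous (depth Ω) := Metric.continuous_infDist_pt _

theorem depth_le_norm_sub (x : E d) {y : E d} (hy : y ∉ Ω) : depth Ω x ≤ ‖x - y‖ := by
  rw [← dist_eq_norm]; exact Metric.infDist_le_dist_of_mem hy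

theorem depth_eq_zero {x : E d} (hx : x ∉ Ω) : depth Ω x = 0 := Metric.infDist_zero_of_mem hx

theorem compl_nonempty (hd : 1 ≤ d) (hb : Bornology.IsBounded Ω) : (Ωᶜ).Nonempty := by
  have : Nontrivial (E d) := by
    have : Nonempty (Fin d) := ⟨⟨0, hd⟩⟩
    infer_instance
  by_contra h
  rw [not_nonempty_iff_eq_empty, compl_empty_iff] at h
  rw [h] at hb
  exact NormedSpace.unbounded_univ ℝ (E d) hb

theorem depth_pos (hd : 1 ≤ d) (hb : Bornology.IsBounded Ω) (ho : IsOpen Ω) {x : E d}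
    (hx : x ∈ Ω) : 0 < depth Ω x :=
  (ho.isClosed_compl.notMem_iff_infDist_pos (compl_nonempty hd hb)).1 (by simpa using hx)

theorem mem_of_norm_lt_depth {x y : E d} (h : ‖x - y‖ < depth Ω x) : y ∈ Ω := by
  by_contra hy
  exact absurd (depth_le_norm_sub x hy) (not_le.2 h)

theorem abs_depth_sub_le (x y : E d) : |depth Ω x - depth Ω y| ≤ ‖x - y‖ := by
  have := (Metric.lipschitz_infDist_pt Ωᶜ).dist_le_mul x y
  rwa [NNReal.coe_one, one_mul, Real.dist_eq, dist_eq_norm] at this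

theorem exists_depth_le (hd : 1 ≤ d) (hb : Bornology.IsBounded Ω) :
    ∃ D, 1 ≤ D ∧ ∀ x ∈ Ω, depth Ω x ≤ D := by
  obtain ⟨y, hy⟩ := compl_nonempty hd hb
  obtain ⟨R, hR⟩ := hb.subset_closedBall y
  refine ⟨max 1 R, le_max_left _ _, fun x hx => (depth_le_norm_sub x hy).trans ?_⟩
  rw [← dist_eq_norm]
  exact (hR hx).trans (le_max_right _ _)

/-- The kernel `min(1, |z|) / |z|^{d+2s}`, integrable for `0 < 2s < 1`. -/
noncomputable def cutKernel (d : ℕ) (s : ℝ) (z : E d) : ℝ :=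
  min 1 ‖z‖ / ‖z‖ ^ ((d : ℝ) + 2 * s)

/-- In polar coordinates the integrand is t^{-2s} near 0, integrable because 2s < 1, and t^{-1-2s}
at infinity, integrable because s > 0. -/
theorem lintegral_cutKernel_lt_top (hd : 1 ≤ d) (hs₀ : 0 < s) (hs₁ : s < 1 / 2) :
    ∫⁻ z : E d, ENNReal.ofReal (cutKernel d s z) < ∞ := by
  have : Nontrivial (E d) := by
    have : Nonempty (Fin d) := ⟨⟨0, hd⟩⟩
    infer_instance
  have h : Integrable (fun z : E d => cutKernel d s z) := by
    refine (integrable_fun_norm_addHaar volume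
      (f := fun t : ℝ => min 1 t / t ^ ((d : ℝ) + 2 * s))).2 ?_
    rw [finrank_euclideanSpace_fin, ← Ioc_union_Ioi_eq_Ioi zero_le_one]
    have hpow : ∀ t : ℝ, 0 < t → t ^ (d - 1) = t ^ ((d : ℝ) - 1) := fun t ht => by
      rw [← Real.rpow_natCast, Nat.cast_sub hd, Nat.cast_one]
    refine IntegrableOn.union ?_ ?_
    · have h1 : IntegrableOn (fun t : ℝ => t ^ (-(2 * s))) (Ioc 0 1) := by
        rw [← intervalIntegrable_iff_integrableOn_Ioc_of_le zero_le_one]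
        exact intervalIntegral.intervalIntegrable_rpow' (by linarith)
      refine h1.congr_fun (fun t ht => ?_) measurableSet_Ioc
      simp only [smul_eq_mul]
      rw [min_eq_right ht.2, hpow t ht.1, mul_div_assoc', ← Real.rpow_add_one ht.1.ne',
        ← Real.rpow_sub ht.1]
      congr 1
      ring
    · have h1 : IntegrableOn (fun t : ℝ => t ^ (-1 - 2 * s)) (Ioi 1) :=
        integrableOn_Ioi_rpow_of_lt (by linarith) one_pos
      refine h1.congr_fun (fun t ht => ?_) measurableSet_Ioi
      have ht0 : (0 : ℝ) < t := one_pos.trans ht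
      simp only [smul_eq_mul]
      rw [min_eq_left (le_of_lt ht), hpow t ht0, mul_one_div, ← Real.rpow_sub ht0]
      congr 1
      ring
  have := h.hasFiniteIntegral
  rwa [hasFiniteIntegral_iff_ofReal (Eventually.of_forall fun z => ?_)] at this
  unfold cutKernel
  positivity

theorem lintegral_comp_smul (f : E d → ℝ≥0∞) {r : ℝ} (hr : 0 < r) :
    ∫⁻ z, f z = ENNReal.ofReal (r ^ d) * ∫⁻ z, f (r • z) := by
  have h := Measure.map_addHaar_smul (volume : Measure (E d)) hr.ne'
  have h2 : ∫⁻ z, f (r • z) = ∫⁻ z, f z ∂(Measure.map (r • ·) volume) :=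
    ((Homeomorph.smulOfNeZero r hr.ne').measurableEmbedding.lintegral_map f).symm
  rw [h2, h, lintegral_smul_measure, finrank_euclideanSpace_fin, smul_eq_mul, ← mul_assoc,
    abs_of_pos (by positivity), ← ENNReal.ofReal_mul (by positivity),
    mul_inv_cancel₀ (by positivity), ENNReal.ofReal_one, one_mul]

/-- Scaling by δ contributes δ^d from the volume and δ^{-d-2s} from the kernel. This is the origin
of the weight dist(x, Ωᶜ)^{-2s}. -/
theorem lintegral_scaled_cutKernel (x : E d) {δ : ℝ} (hδ : 0 < δ) :
    ∫⁻ y : E d, ENNReal.ofReal (min 1 (‖x - y‖ / δ) / ‖x - y‖ ^ ((d : ℝ) + 2 * s)) =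
      ENNReal.ofReal (δ ^ (-(2 * s))) * ∫⁻ z : E d, ENNReal.ofReal (cutKernel d s z) := by
  rw [lintegral_sub_left_eq_self
    (fun z : E d => ENNReal.ofReal (min 1 (‖z‖ / δ) / ‖z‖ ^ ((d : ℝ) + 2 * s))) x,
    lintegral_comp_smul _ hδ]
  have h : ∀ z : E d, ENNReal.ofReal (min 1 (‖δ • z‖ / δ) / ‖δ • z‖ ^ ((d : ℝ) + 2 * s)) =
      ENNReal.ofReal (δ ^ (-((d : ℝ) + 2 * s))) * ENNReal.ofReal (cutKernel d s z) := by
    intro z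
    rw [← ENNReal.ofReal_mul (by positivity), norm_smul, Real.norm_of_nonneg hδ.le,
      mul_div_cancel_left₀ _ hδ.ne', Real.mul_rpow hδ.le (norm_nonneg _), Real.rpow_neg hδ.le,
      cutKernel]
    congr 1
    field_simp
  simp_rw [h]
  rw [lintegral_const_mul' _ _ (by simp), ← mul_assoc, ← ENNReal.ofReal_mul (by positivity),
    ← Real.rpow_natCast, ← Real.rpow_add hδ]
  congr 3
  ring

end kernel

/-! ### Dominated convergence for the seminorm -/

section dominated
variable {d : ℕ} {s : ℝ} {Ω : Set (E d)}

/-- Q_Ω is covered by Ω × ℝᵈ and its mirror image, on which the symmetric integrand has the same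
integral. Later estimates may therefore assume that the first point is in Ω. -/
theorem seminorm_Q_le (v : E d → ℝ) :
    seminorm s (Q Ω) v ≤ 2 * seminorm s (Ω ×ˢ univ) v := by
  have h1 : Q Ω ⊆ Ω ×ˢ univ ∪ univ ×ˢ Ω := by
    rintro ⟨x, y⟩ h
    simp only [Q, mem_compl_iff, mem_prod, mem_union, mem_univ, and_true, true_and] at h ⊢
    tauto
  have h2 : seminorm s (univ ×ˢ Ω) v = seminorm s (Ω ×ˢ univ) v := by
    unfold seminorm
    have := (Measure.measurePreserving_swap (μ := (volume : Measure (E d)))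
      (ν := (volume : Measure (E d)))).setLIntegral_comp_preimage_emb
      MeasurableEquiv.prodComm.measurableEmbedding (fun p : E d × E d =>
        ENNReal.ofReal (|v p.1 - v p.2| / ‖p.1 - p.2‖ ^ ((d : ℝ) + 2 * s))) (Ω ×ˢ univ)
    rw [preimage_swap_prod] at this
    rw [Measure.volume_eq_prod, ← this]
    congr 1
    ext p
    rw [Prod.fst_swap, Prod.snd_swap, abs_sub_comm, norm_sub_rev]
  calc seminorm s (Q Ω) v ≤ seminorm s (Ω ×ˢ univ ∪ univ ×ˢ Ω) v := seminorm_mono h1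
    _ ≤ seminorm s (Ω ×ˢ univ) v + seminorm s (univ ×ˢ Ω) v := lintegral_union_le _ _ _
    _ = _ := by rw [h2, two_mul]

theorem prod_univ_subset_Q : Ω ×ˢ (univ : Set (E d)) ⊆ Q Ω := by
  rintro ⟨x, y⟩ h
  simp only [Q, mem_compl_iff, mem_prod, mem_univ, and_true] at h ⊢
  tauto

theorem measurable_scaled_cutKernel (w : E d → ℝ) (hw : AEMeasurable w) :
    AEMeasurable fun p : E d × E d => ENNReal.ofReal
      (w p.1 * (min 1 (‖p.1 - p.2‖ / depth Ω p.1) / ‖p.1 - p.2‖ ^ ((d : ℝ) + 2 * s))) := by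
  refine AEMeasurable.ennreal_ofReal ((aemeasurable_fst hw).mul ?_)
  have h : Measurable fun p : E d × E d => depth Ω p.1 :=
    continuous_depth.measurable.comp measurable_fst
  have h' : Measurable fun p : E d × E d => ‖p.1 - p.2‖ := by fun_prop
  exact ((measurable_const.min (h'.div h)).div (measurable_norm_sub_rpow _)).aemeasurable

theorem lintegral_weighted_cutKernel_lt_top (hd : 1 ≤ d) (hs₀ : 0 < s) (hs₁ : s < 1 / 2)
    (hb : Bornology.IsBounded Ω) (ho : IsOpen Ω) {w : E d → ℝ} (hw : AEMeasurable w)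
    (hw0 : ∀ x, 0 ≤ w x)
    (hwi : ∫⁻ x in Ω, ENNReal.ofReal (w x * depth Ω x ^ (-(2 * s))) < ∞) :
    ∫⁻ p in Ω ×ˢ univ, ENNReal.ofReal (w p.1 * (min 1 (‖p.1 - p.2‖ / depth Ω p.1) /
      ‖p.1 - p.2‖ ^ ((d : ℝ) + 2 * s))) ∂(volume : Measure (E d × E d)) < ∞ := by
  rw [Measure.volume_eq_prod, setLIntegral_prod _ (by
    rw [← Measure.volume_eq_prod]; exact (measurable_scaled_cutKernel w hw).restrict)]
  have h : ∀ x ∈ Ω, ∫⁻ y in univ, ENNReal.ofReal (w x * (min 1 (‖x - y‖ / depth Ω x) /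
      ‖x - y‖ ^ ((d : ℝ) + 2 * s))) = ENNReal.ofReal (w x * depth Ω x ^ (-(2 * s))) *
        ∫⁻ z : E d, ENNReal.ofReal (cutKernel d s z) := by
    intro x hx
    rw [setLIntegral_univ, ENNReal.ofReal_mul (hw0 x), mul_assoc,
      ← lintegral_scaled_cutKernel x (depth_pos hd hb ho hx),
      ← lintegral_const_mul' _ _ (by simp)]
    simp_rw [ENNReal.ofReal_mul (hw0 x)]
  rw [setLIntegral_congr_fun ho.measurableSet h,
    lintegral_mul_const' _ _ (lintegral_cutKernel_lt_top hd hs₀ hs₁).ne]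
  exact ENNReal.mul_lt_top hwi (lintegral_cutKernel_lt_top hd hs₀ hs₁)

/-- The dominating function `(|U(x)-U(y)| + w(x) min(1, |x-y|/dist(x,Ωᶜ))) / |x-y|^{d+2s}`. -/
noncomputable def dominant (s : ℝ) (Ω : Set (E d)) (U w : E d → ℝ) (p : E d × E d) : ℝ≥0∞ :=
  ENNReal.ofReal (|U p.1 - U p.2| / ‖p.1 - p.2‖ ^ ((d : ℝ) + 2 * s)) +
    ENNReal.ofReal (w p.1 * (min 1 (‖p.1 - p.2‖ / depth Ω p.1) /
      ‖p.1 - p.2‖ ^ ((d : ℝ) + 2 * s)))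

theorem lintegral_dominant_lt_top (hd : 1 ≤ d) (hs₀ : 0 < s) (hs₁ : s < 1 / 2)
    (hb : Bornology.IsBounded Ω) (ho : IsOpen Ω) {U w : E d → ℝ} (hUm : AEMeasurable U)
    (hU : seminorm s (Ω ×ˢ univ) U < ∞) (hw : AEMeasurable w)
    (hw0 : ∀ x, 0 ≤ w x)
    (hwi : ∫⁻ x in Ω, ENNReal.ofReal (w x * depth Ω x ^ (-(2 * s))) < ∞) :
    ∫⁻ p in Ω ×ˢ univ, dominant s Ω U w p < ∞ := by
  unfold dominant
  rw [lintegral_add_left' (aemeasurable_seminorm_integrand hUm).restrict]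
  exact ENNReal.add_lt_top.2
    ⟨hU, lintegral_weighted_cutKernel_lt_top hd hs₀ hs₁ hb ho hw hw0 hwi⟩

theorem le_dominant {U w v : E d → ℝ} {p : E d × E d} (hw0 : ∀ x, 0 ≤ w x)
    (h : |v p.1 - v p.2| ≤
      |U p.1 - U p.2| + w p.1 * min 1 (‖p.1 - p.2‖ / depth Ω p.1)) :
    ENNReal.ofReal (|v p.1 - v p.2| / ‖p.1 - p.2‖ ^ ((d : ℝ) + 2 * s)) ≤ dominant s Ω U w p := by
  have h0 : 0 ≤ min 1 (‖p.1 - p.2‖ / depth Ω p.1) :=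
    le_min zero_le_one (div_nonneg (norm_nonneg _) (depth_nonneg _))
  rw [dominant, ← ENNReal.ofReal_add (by positivity)
    (mul_nonneg (hw0 _) (by positivity)), mul_div_assoc', ← add_div]
  exact ENNReal.ofReal_le_ofReal (div_le_div_of_nonneg_right h (by positivity))

theorem seminorm_lt_top_of_dominated (hd : 1 ≤ d) (hs₀ : 0 < s) (hs₁ : s < 1 / 2)
    (hb : Bornology.IsBounded Ω) (ho : IsOpen Ω) {U w : E d → ℝ} (hUm : AEMeasurable U)
    (hU : seminorm s (Ω ×ˢ univ) U < ∞) (hw : AEMeasurable w)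
    (hw0 : ∀ x, 0 ≤ w x)
    (hwi : ∫⁻ x in Ω, ENNReal.ofReal (w x * depth Ω x ^ (-(2 * s))) < ∞) {v : E d → ℝ}
    (hv : ∀ᵐ p : E d × E d, p.1 ∈ Ω → |v p.1 - v p.2| ≤
      |U p.1 - U p.2| + w p.1 * min 1 (‖p.1 - p.2‖ / depth Ω p.1)) :
    seminorm s (Q Ω) v < ∞ := by
  refine (seminorm_Q_le v).trans_lt (ENNReal.mul_lt_top (by simp) ?_)
  refine lt_of_le_of_lt ?_ (lintegral_dominant_lt_top hd hs₀ hs₁ hb ho hUm hU hw hw0 hwi)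
  refine setLIntegral_mono_ae' (ho.measurableSet.prod MeasurableSet.univ) ?_
  filter_upwards [hv] with p hp hpΩ
  exact le_dominant hw0 (hp hpΩ.1)

/-- The dominating function has a part from a fixed function U of finite seminorm and a part
weighted by w. The cut-off argument uses both; for mesh functions U = 0 and w is constant. Dominated
convergence along a general filter needs it to be countably generated. -/
theorem tendsto_seminorm_zero_of_dominated (hd : 1 ≤ d) (hs₀ : 0 < s) (hs₁ : s < 1 / 2)
    (hb : Bornology.IsBounded Ω) (ho : IsOpen Ω) {U w : E d → ℝ} (hUm : AEMeasurable U)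
    (hU : seminorm s (Ω ×ˢ univ) U < ∞) (hw : AEMeasurable w)
    (hw0 : ∀ x, 0 ≤ w x)
    (hwi : ∫⁻ x in Ω, ENNReal.ofReal (w x * depth Ω x ^ (-(2 * s))) < ∞) {ι : Type*}
    {l : Filter ι} [l.IsCountablyGenerated] {v : ι → E d → ℝ}
    (hvm : ∀ᶠ i in l, AEMeasurable (v i))
    (hv : ∀ᶠ i in l, ∀ᵐ p : E d × E d, p.1 ∈ Ω → |v i p.1 - v i p.2| ≤
      |U p.1 - U p.2| + w p.1 * min 1 (‖p.1 - p.2‖ / depth Ω p.1))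
    (hlim : ∀ᵐ x, Tendsto (fun i => v i x) l (𝓝 0)) :
    Tendsto (fun i => seminorm s (Q Ω) (v i)) l (𝓝 0) := by
  have h1 : Tendsto (fun i => seminorm s (Ω ×ˢ univ) (v i)) l
      (𝓝 (∫⁻ p in Ω ×ˢ (univ : Set (E d)), (0 : ℝ≥0∞))) := by
    unfold seminorm
    refine tendsto_lintegral_filter_of_dominated_convergence' (dominant s Ω U w) ?_ ?_
      (lintegral_dominant_lt_top hd hs₀ hs₁ hb ho hUm hU hw hw0 hwi).ne ?_
    · filter_upwards [hvm] with i hi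
      exact (aemeasurable_seminorm_integrand hi).restrict
    · filter_upwards [hv] with i hi
      rw [ae_restrict_iff' (ho.measurableSet.prod MeasurableSet.univ)]
      filter_upwards [hi] with p hp hpΩ
      exact le_dominant hw0 (hp hpΩ.1)
    · refine ae_restrict_of_ae ?_
      filter_upwards [ae_fst hlim, ae_snd hlim] with p h1 h2
      have := ((h1.sub h2).abs.div_const (‖p.1 - p.2‖ ^ ((d : ℝ) + 2 * s)))
      have := ENNReal.tendsto_ofReal this
      simpa using this
  rw [lintegral_zero] at h1
  have h2 : Tendsto (fun i => 2 * seminorm s (Ω ×ˢ univ) (v i)) l (𝓝 0) := by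
    simpa using ENNReal.Tendsto.const_mul h1 (Or.inr (by simp : (2 : ℝ≥0∞) ≠ ∞))
  exact tendsto_of_tendsto_of_tendsto_of_le_of_le tendsto_const_nhds h2 (fun _ => bot_le)
    fun i => seminorm_Q_le _

end dominated


/-! ### Geometry of meshes -/

section mesh
variable {d : ℕ} {K : Complex d} {Ω Λ : Set (E d)}

/-- A bounded Lipschitz domain is the interior of its closure. -/
theorem IsBoundedLipschitzDomain.interior_closure_subset (hΩ : IsBoundedLipschitzDomain Ω) :
    interior (closure Ω) ⊆ Ω := by
  intro x hx
  by_contra hxΩ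
  have hfr : x ∈ frontier Ω :=
    ⟨interior_subset hx, fun h => hxΩ (interior_subset h)⟩
  obtain ⟨e, he, φ, L, hφ, r, hr, hgraph⟩ := hΩ.lipschitz_boundary x hfr
  have hx' : ⟪e, x⟫ ≤ φ (x - ⟪e, x⟫ • e) :=
    not_lt.1 fun h => hxΩ ((hgraph x (Metric.mem_ball_self hr)).2 h)
  -- Moving down from x keeps the projection and lowers the vertical coordinate, so the points
  -- reached are strictly below the graph. This is an open condition that excludes Ω nearby,
  -- although they are still in the closure of Ω.
  have hcont : Tendsto (fun τ : ℝ => x - τ • e) (𝓝[>] 0) (𝓝 x) := by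
    have : Continuous fun τ : ℝ => x - τ • e := by fun_prop
    simpa using (this.tendsto 0).mono_left nhdsWithin_le_nhds
  have h1 := hcont.eventually (isOpen_interior.mem_nhds hx)
  have h2 := hcont.eventually (Metric.ball_mem_nhds x hr)
  obtain ⟨τ, hτ1, hτ2, hτ⟩ := (h1.and (h2.and self_mem_nhdsWithin)).exists
  have hτ : 0 < τ := hτ
  set y := x - τ • e with hy
  have hey : ⟪e, y⟫ = ⟪e, x⟫ - τ := by
    rw [hy, inner_sub_right, inner_smul_right, real_inner_self_eq_norm_sq, he]
    simp
  have hproj : y - ⟪e, y⟫ • e = x - ⟪e, x⟫ • e := by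
    rw [hey, hy, sub_smul]; abel
  have hycl : y ∈ closure Ω := interior_subset hτ1
  have hopen : ∀ᶠ z in 𝓝 y, ⟪e, z⟫ < φ (z - ⟪e, z⟫ • e) := by
    have hc1 : Continuous fun z : E d => ⟪e, z⟫ := by fun_prop
    have hc2 : Continuous fun z : E d => φ (z - ⟪e, z⟫ • e) := hφ.continuous.comp (by fun_prop)
    refine hc1.continuousAt.eventually_lt hc2.continuousAt ?_
    rw [hproj, hey]
    linarith
  rw [mem_closure_iff_frequently] at hycl
  obtain ⟨z, hz, hz1, hz2⟩ := (hycl.and_eventually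
    (hopen.and (Metric.isOpen_ball.mem_nhds hτ2))).exists
  exact absurd ((hgraph z hz2).1 hz) (not_lt.2 hz1.le)

theorem convex_simplex (t : Finset (E d)) : Convex ℝ (simplex t) := convex_convexHull _ _

theorem isCompact_simplex (t : Finset (E d)) : IsCompact (simplex t) :=
  t.finite_toSet.isCompact_convexHull ℝ

theorem subset_simplex (t : Finset (E d)) : (t : Set (E d)) ⊆ simplex t := subset_convexHull _ _

theorem exists_affineBasis {t : Finset (E d)} (ht : t ∈ elements K) :
    ∃ b : AffineBasis t ℝ (E d), simplex t = convexHull ℝ (range b) := by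
  have hind := K.indep ht.1
  have htop : affineSpan ℝ (range ((↑) : t → E d)) = ⊤ := by
    rw [hind.affineSpan_eq_top_iff_card_eq_finrank_add_one]
    simp [ht.2]
  refine ⟨⟨(↑), hind, htop⟩, ?_⟩
  rw [simplex]
  congr 1
  exact (Subtype.range_coe (s := (t : Set (E d)))).symm

theorem affineSpan_element {t : Finset (E d)} (ht : t ∈ elements K) :
    affineSpan ℝ (t : Set (E d)) = ⊤ := by
  have hind := K.indep ht.1
  have htop : affineSpan ℝ (range ((↑) : t → E d)) = ⊤ := by
    rw [hind.affineSpan_eq_top_iff_card_eq_finrank_add_one]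
    simp [ht.2]
  rwa [show range ((↑) : t → E d) = t from Subtype.range_coe (s := (t : Set (E d)))] at htop

theorem interior_simplex_nonempty {t : Finset (E d)} (ht : t ∈ elements K) :
    (interior (simplex t)).Nonempty :=
  interior_convexHull_nonempty_iff_affineSpan_eq_top.2 (affineSpan_element ht)

theorem closure_interior_simplex {t : Finset (E d)} (ht : t ∈ elements K) :
    closure (interior (simplex t)) = simplex t := by
  rw [(convex_simplex t).closure_interior_eq_closure_of_nonempty_interior
    (interior_simplex_nonempty ht), (isCompact_simplex t).isClosed.closure_eq]

theorem volume_simplex_pos {t : Finset (E d)} (ht : t ∈ elements K) : 0 < volume (simplex t) :=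
  (isOpen_interior.measure_pos _ (interior_simplex_nonempty ht)).trans_le
    (measure_mono interior_subset)

theorem volume_frontier_simplex (t : Finset (E d)) : volume (frontier (simplex t)) = 0 :=
  (convex_simplex t).addHaar_frontier _

/-- Two distinct elements meet in the hull of their common vertices. Some vertex of the first is not
shared and, by affine independence, is outside the affine span of the shared ones; so that span is a
proper subspace. -/
theorem volume_inter_simplex {t t' : Finset (E d)} (ht : t ∈ elements K) (ht' : t' ∈ elements K)
    (hne : t ≠ t') : volume (simplex t ∩ simplex t') = 0 := by
  have hsub : ¬ (t : Set (E d)) ⊆ t' := fun h =>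
    hne (Finset.eq_of_subset_of_card_le (by exact_mod_cast h) (by rw [ht.2, ht'.2]))
  obtain ⟨z, hz, hz'⟩ := not_subset.1 hsub
  have h1 : z ∉ affineSpan ℝ ((t : Set (E d)) ∩ t') := by
    intro h
    have hi := (K.indep ht.1).mem_affineSpan_iff ⟨z, hz⟩ (Subtype.val ⁻¹' (t' : Set (E d)))
    have e : (Subtype.val '' (Subtype.val ⁻¹' (t' : Set (E d)) : Set t)) =
        (t : Set (E d)) ∩ t' := by
      ext y
      simp [and_comm]
    rw [e] at hi
    exact hz' (hi.1 h)
  refine measure_mono_null ((K.inter_subset_convexHull ht.1 ht'.1).trans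
    (convexHull_subset_affineSpan _)) (Measure.addHaar_affineSubspace _ _ fun h => h1 ?_)
  rw [h]
  exact AffineSubspace.mem_top _ _ _

theorem IsMesh.finite_elements (hK : IsMesh K Λ) : (elements K).Finite :=
  hK.finite.subset fun _ ht => ht.1

theorem IsMesh.exists_element (hK : IsMesh K Λ) {x : E d} (hx : x ∈ Λ) :
    ∃ t ∈ elements K, x ∈ simplex t := by
  rw [← hK.space_eq] at hx
  obtain ⟨f, hf, hxf⟩ := K.mem_space_iff.1 hx
  obtain ⟨t, ht, hft⟩ := hK.pure f hf
  exact ⟨t, ht, convexHull_mono (by exact_mod_cast hft) hxf⟩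

theorem IsMesh.simplex_subset (hK : IsMesh K Λ) {t : Finset (E d)} (ht : t ∈ elements K) :
    simplex t ⊆ Λ := by
  rw [← hK.space_eq]
  exact K.convexHull_subset_space ht.1

theorem IsMesh.eq_iUnion (hK : IsMesh K Λ) : Λ = ⋃ t ∈ elements K, simplex t := by
  ext x
  simp only [mem_iUnion, exists_prop]
  exact ⟨fun hx => hK.exists_element hx, fun ⟨t, ht, hx⟩ => hK.simplex_subset ht hx⟩

theorem IsMesh.isCompact (hK : IsMesh K Λ) : IsCompact Λ := by
  rw [hK.eq_iUnion]
  exact hK.finite_elements.isCompact_biUnion fun t _ => isCompact_simplex t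

theorem IsMesh.finite_vertices (hK : IsMesh K Λ) : K.vertices.Finite := by
  rw [K.vertices_eq]
  exact hK.finite.biUnion fun t _ => t.finite_toSet

theorem mem_vertices_of_mem {t : Finset (E d)} (ht : t ∈ elements K) {z : E d} (hz : z ∈ t) :
    z ∈ K.vertices := by
  rw [K.vertices_eq]
  exact mem_biUnion ht.1 hz

/-- The finitely many closed elements that miss z stay away from a neighbourhood of z, while the
elements still cover that neighbourhood. -/
theorem IsMesh.eventually_common_element (hK : IsMesh K Λ) {z : E d} (hz : z ∈ interior Λ) :
    ∀ᶠ y in 𝓝 z, ∃ t ∈ elements K, z ∈ simplex t ∧ y ∈ simplex t := by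
  have h1 : ∀ᶠ y in 𝓝 z, ∀ t ∈ elements K, z ∉ simplex t → y ∉ simplex t := by
    rw [eventually_all_finite hK.finite_elements]
    intro t _
    by_cases h : z ∈ simplex t
    · simp [h]
    · filter_upwards [(isCompact_simplex t).isClosed.isOpen_compl.mem_nhds h] with y hy _ using hy
  filter_upwards [h1, mem_interior_iff_mem_nhds.1 hz] with y hy hyΛ
  obtain ⟨t, ht, hyt⟩ := hK.exists_element hyΛ
  exact ⟨t, ht, by by_contra h; exact hy t ht h hyt, hyt⟩

/-- If the mesh meshes the open set `Ω` exactly, each element is either inside or outside. -/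
theorem IsMesh.element_inside_or_outside (hK : IsMesh K Λ) (hKΩ : MeshesExactly K Ω)
    (ho : IsOpen Ω) {t : Finset (E d)} (ht : t ∈ elements K) :
    simplex t ⊆ closure Ω ∨ simplex t ⊆ Ωᶜ := by
  obtain ⟨S, hS, hSΩ⟩ := hKΩ
  by_cases htS : t ∈ S
  · left
    rw [hSΩ]
    exact subset_biUnion_of_mem (u := fun t => simplex t) htS
  right
  -- Points of Ω lie in elements of S, all different from t and so overlapping t in a null set. An
  -- open null set is empty.
  have hnull : volume (interior (simplex t) ∩ Ω) = 0 := by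
    have hsub : interior (simplex t) ∩ Ω ⊆ ⋃ t' ∈ S, simplex t ∩ simplex t' := by
      rintro x ⟨hxt, hxΩ⟩
      have := subset_closure hxΩ
      rw [hSΩ] at this
      simp only [mem_iUnion, exists_prop, mem_inter_iff] at this ⊢
      obtain ⟨t', ht', hx'⟩ := this
      exact ⟨t', ht', interior_subset hxt, hx'⟩
    refine measure_mono_null hsub
      ((measure_biUnion_null_iff (hK.finite_elements.subset hS).countable).2 fun t' ht' => ?_)
    exact volume_inter_simplex ht (hS ht') fun h => htS (h ▸ ht')
  have hempty : interior (simplex t) ∩ Ω = ∅ :=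
    (isOpen_interior.inter ho).eq_empty_of_measure_zero hnull
  rw [← closure_interior_simplex ht]
  exact ho.isClosed_compl.closure_subset_iff.2 fun x hx hxΩ => by
    have : x ∈ interior (simplex t) ∩ Ω := ⟨hx, hxΩ⟩
    rw [hempty] at this
    exact this

/-- If every element containing x were inside the closure of Ω, so would be a whole neighbourhood of
x, and x would belong to Ω by regularity. -/
theorem IsMesh.exists_exterior_element (hK : IsMesh K Λ) (hKΩ : MeshesExactly K Ω)
    (ho : IsOpen Ω) (hreg : interior (closure Ω) ⊆ Ω) (hΩΛ : closure Ω ⊆ interior Λ) {x : E d}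
    (hx : x ∈ Λ) (hxΩ : x ∉ Ω) : ∃ t ∈ elements K, x ∈ simplex t ∧ simplex t ⊆ Ωᶜ := by
  by_cases hcl : x ∈ closure Ω
  · by_contra! h
    refine hxΩ (hreg (mem_interior_iff_mem_nhds.2 ?_))
    filter_upwards [hK.eventually_common_element (hΩΛ hcl)] with y ⟨t, ht, hxt, hyt⟩
    exact (hK.element_inside_or_outside hKΩ ho ht).resolve_right (h t ht hxt) hyt
  · obtain ⟨t, ht, hxt⟩ := hK.exists_element hx
    exact ⟨t, ht, hxt,
      (hK.element_inside_or_outside hKΩ ho ht).resolve_left fun h => hcl (h hxt)⟩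

/-- A boundary point lies in an element outside Ω but not in its interior, where points of Ω would
appear. Hence ∂Ω is covered by finitely many boundaries of convex sets, which are null. -/
theorem IsMesh.volume_frontier (hK : IsMesh K Λ) (hKΩ : MeshesExactly K Ω)
    (ho : IsOpen Ω) (hreg : interior (closure Ω) ⊆ Ω) (hΩΛ : closure Ω ⊆ interior Λ) :
    volume (frontier Ω) = 0 := by
  refine measure_mono_null (t := ⋃ t ∈ elements K, frontier (simplex t)) (fun x hx => ?_)
    ((measure_biUnion_null_iff hK.finite_elements.countable).2
      fun t _ => volume_frontier_simplex t)
  have hxcl : x ∈ closure Ω := frontier_subset_closure hx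
  have hxΩ : x ∉ Ω := by rw [ho.frontier_eq] at hx; exact hx.2
  obtain ⟨t, ht, hxt, htΩ⟩ := hK.exists_exterior_element hKΩ ho hreg hΩΛ
    (interior_subset (hΩΛ hxcl)) hxΩ
  refine mem_biUnion ht ⟨subset_closure hxt, fun hint => ?_⟩
  obtain ⟨y, hy, hyΩ⟩ := mem_closure_iff.1 hxcl _ isOpen_interior hint
  exact htΩ (interior_subset hy) hyΩ

theorem exists_pos_forall_le_of_finite {α : Type*} {S : Set α} (hS : S.Finite) {f : α → ℝ}
    (hf : ∀ x ∈ S, 0 < f x) : ∃ m > 0, ∀ x ∈ S, m ≤ f x := by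
  rcases S.eq_empty_or_nonempty with rfl | hne
  · exact ⟨1, one_pos, by simp⟩
  · obtain ⟨x, hx, hmin⟩ := S.exists_min_image f hS hne
    exact ⟨f x, hf x hx, hmin⟩

theorem exists_ge_one_forall_le_of_finite {α : Type*} {S : Set α} (hS : S.Finite) (f : α → ℝ) :
    ∃ M, 1 ≤ M ∧ ∀ x ∈ S, f x ≤ M := by
  obtain ⟨M, hM⟩ := (hS.image f).bddAbove
  exact ⟨max 1 M, le_max_left _ _,
    fun x hx => (hM (mem_image_of_mem f hx)).trans (le_max_right _ _)⟩

theorem norm_sub_le_elementSize {t : Finset (E d)} {x y : E d} (hx : x ∈ simplex t)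
    (hy : y ∈ simplex t) : ‖x - y‖ ≤ elementSize t := by
  rw [← dist_eq_norm]
  exact Metric.dist_le_diam_of_mem (isCompact_simplex t).isBounded hx hy

theorem IsMesh.elementSize_le_meshSize (hK : IsMesh K Λ) {t : Finset (E d)}
    (ht : t ∈ elements K) : elementSize t ≤ meshSize K :=
  le_csSup (hK.finite_elements.image _).bddAbove (mem_image_of_mem _ ht)

theorem elementSize_pos (hd : 1 ≤ d) {t : Finset (E d)} (ht : t ∈ elements K) :
    0 < elementSize t := by
  obtain ⟨x, hx, y, hy, hxy⟩ := Finset.one_lt_card.1 (by rw [ht.2]; omega : 1 < t.card)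
  exact (norm_pos_iff.2 (sub_ne_zero.2 hxy)).trans_le
    (norm_sub_le_elementSize (subset_simplex t hx) (subset_simplex t hy))

/-- Shape regularity in terms of an inscribed ball. -/
def IsShapeRegular (κ : ℝ) (K : Complex d) : Prop :=
  ∀ t ∈ elements K, ∃ (c : E d) (r : ℝ), 0 < r ∧ Metric.closedBall c r ⊆ simplex t ∧
    elementSize t ≤ κ * r

theorem exists_isShapeRegular (hd : 1 ≤ d) {ι : Type*} {mesh : ι → Complex d}
    (hshape : ∃ σ : ℝ, ∀ i, ∀ t ∈ elements (mesh i), elementSize t ≤ σ * inball t) :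
    ∃ κ, 1 ≤ κ ∧ ∀ i, IsShapeRegular κ (mesh i) := by
  obtain ⟨σ, hσ⟩ := hshape
  refine ⟨max 1 (4 * σ), le_max_left _ _, fun i t ht => ?_⟩
  have h0 := elementSize_pos hd ht
  have h1 := hσ i t ht
  have hin0 : 0 ≤ inball t := by
    refine Real.sSup_nonneg ?_
    rintro δ ⟨c, r, hr, -, rfl⟩
    positivity
  have hin : 0 < inball t := by
    rcases hin0.eq_or_lt with h | h
    · rw [← h, mul_zero] at h1; linarith
    · exact h
  have hσ0 : 0 < σ := pos_of_mul_pos_left (h0.trans_le h1) hin0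
  have hne : {δ | ∃ (c : E d) (r : ℝ), 0 ≤ r ∧ Metric.closedBall c r ⊆ simplex t ∧
      δ = 2 * r}.Nonempty := by
    by_contra h
    rw [not_nonempty_iff_eq_empty] at h
    rw [inball, h, Real.sSup_empty] at hin
    exact lt_irrefl _ hin
  -- Attainment of the supremum is avoided: a ball with more than half the maximal diameter has r >
  -- ρ_T / 4, whence the constant 4σ.
  obtain ⟨δ, ⟨c, r, hr, hsub, rfl⟩, hlt⟩ := exists_lt_of_lt_csSup hne
    (show inball t / 2 < sSup _ from half_lt_self hin)
  refine ⟨c, r, by linarith, hsub, h1.trans ?_⟩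
  calc σ * inball t ≤ σ * (4 * r) := by gcongr; linarith
    _ = 4 * σ * r := by ring
    _ ≤ _ := by gcongr; exact le_max_right _ _

/-! ### Piecewise affine functions -/

/-- Comparing p at the antipodal points c ± v, with |v| = r, cancels both p(c) and a and bounds the
linear part on vectors of length r. -/
theorem abs_affine_sub_le (p : E d →ᵃ[ℝ] ℝ) {c : E d} {r M a : ℝ} (hr : 0 < r)
    (h : ∀ x ∈ Metric.closedBall c r, |p x - a| ≤ M) (x y : E d) :
    |p x - p y| ≤ M / r * ‖x - y‖ := by
  rcases eq_or_ne x y with rfl | hxy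
  · simp
  have hn : 0 < ‖x - y‖ := norm_pos_iff.2 (sub_ne_zero.2 hxy)
  have hlin : ∀ z w : E d, p (z + w) = p z + p.linear w := fun z w => by
    rw [add_comm z w, ← vadd_eq_add, p.map_vadd, vadd_eq_add, add_comm]
  set v := (r / ‖x - y‖) • (x - y) with hv
  have hvn : ‖v‖ = r := by
    rw [hv, norm_smul, Real.norm_of_nonneg (by positivity), div_mul_cancel₀ _ hn.ne']
  have h1 := h (c + v) (by simp [hvn])
  have h2 := h (c - v) (by simp [hvn])
  rw [hlin] at h1
  rw [sub_eq_add_neg c v, hlin, map_neg] at h2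
  have h3 : |p.linear v| ≤ M := by
    rw [abs_le] at *
    constructor <;> linarith
  have h4 : p x - p y = ‖x - y‖ / r * p.linear v := by
    have : p x = p y + p.linear (x - y) := by rw [← hlin]; congr 1; abel
    rw [this, hv, map_smul, smul_eq_mul]
    field_simp
    ring
  rw [h4, abs_mul, abs_of_nonneg (by positivity)]
  calc ‖x - y‖ / r * |p.linear v| ≤ ‖x - y‖ / r * M := by gcongr
    _ = _ := by ring

variable {v w : E d → ℝ}

/-- On an element the values are convex combinations of the nodal values, so every interval
containing the latter contains the former. -/
theorem Vh_abs_sub_le (hv : v ∈ Vh K) {t : Finset (E d)} (ht : t ∈ elements K) {a M : ℝ}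
    (h : ∀ z ∈ t, |v z - a| ≤ M) {x : E d} (hx : x ∈ simplex t) : |v x - a| ≤ M := by
  obtain ⟨p, hp⟩ := hv.2.1 t ht
  have hconv : Convex ℝ (p ⁻¹' (Icc (a - M) (a + M))) := (convex_Icc _ _).affine_preimage _
  have hsub : (t : Set (E d)) ⊆ p ⁻¹' (Icc (a - M) (a + M)) := fun z hz => by
    have := h z hz
    rw [hp (subset_simplex t hz), abs_le] at this
    exact ⟨by linarith, by linarith⟩
  have := convexHull_min hsub hconv hx
  rw [hp hx, abs_le]
  exact ⟨by linarith [this.1], by linarith [this.2]⟩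

theorem Vh_lipschitz (hv : v ∈ Vh K) {t : Finset (E d)} (ht : t ∈ elements K) {c : E d}
    {a M r : ℝ} (hr : 0 < r) (hball : Metric.closedBall c r ⊆ simplex t)
    (h : ∀ z ∈ t, |v z - a| ≤ M) {x y : E d} (hx : x ∈ simplex t) (hy : y ∈ simplex t) :
    |v x - v y| ≤ M / r * ‖x - y‖ := by
  obtain ⟨p, hp⟩ := hv.2.1 t ht
  rw [hp hx, hp hy]
  refine abs_affine_sub_le p (c := c) hr (a := a) (fun z hz => ?_) x y
  rw [← hp (hball hz)]
  exact Vh_abs_sub_le hv ht h (hball hz)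

theorem Vh_zero : (0 : E d → ℝ) ∈ Vh K :=
  ⟨continuousOn_const, fun _ _ => ⟨0, fun _ _ => rfl⟩, fun _ _ => rfl⟩

theorem Vh_add (hv : v ∈ Vh K) (hw : w ∈ Vh K) : v + w ∈ Vh K := by
  refine ⟨hv.1.add hw.1, fun t ht => ?_, fun x hx => by simp [hv.2.2 x hx, hw.2.2 x hx]⟩
  obtain ⟨p, hp⟩ := hv.2.1 t ht
  obtain ⟨q, hq⟩ := hw.2.1 t ht
  exact ⟨p + q, fun x hx => by simp [hp hx, hq hx]⟩

theorem Vh_smul (a : ℝ) (hv : v ∈ Vh K) : a • v ∈ Vh K := by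
  refine ⟨hv.1.const_smul a, fun t ht => ?_, fun x hx => by simp [hv.2.2 x hx]⟩
  obtain ⟨p, hp⟩ := hv.2.1 t ht
  exact ⟨a • p, fun x hx => by simp [hp hx]⟩

theorem Vh_sub (hv : v ∈ Vh K) (hw : w ∈ Vh K) : v - w ∈ Vh K := by
  have := Vh_add hv (Vh_smul (-1) hw)
  rwa [neg_one_smul, ← sub_eq_add_neg] at this

theorem IsMesh.measurable_Vh (hK : IsMesh K Λ) (hv : v ∈ Vh K) : Measurable v := by
  have hm : MeasurableSet K.space := by
    rw [hK.space_eq]; exact hK.isCompact.measurableSet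
  refine measurable_of_restrict_of_restrict_compl hm hv.1.domRestrict.measurable ?_
  have : K.spaceᶜ.domRestrict v = fun _ => 0 := by
    ext x; exact hv.2.2 x x.2
  rw [this]
  exact measurable_const

theorem IsMesh.exists_bound_Vh (hK : IsMesh K Λ) (hv : v ∈ Vh K) : ∃ M, 0 ≤ M ∧ ∀ x, |v x| ≤ M := by
  obtain ⟨M, hM1, hM⟩ := exists_ge_one_forall_le_of_finite hK.finite_vertices fun z => |v z|
  refine ⟨M, by linarith, fun x => ?_⟩
  by_cases hx : x ∈ Λ
  · obtain ⟨t, ht, hxt⟩ := hK.exists_element hx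
    have := Vh_abs_sub_le hv ht (a := 0) (M := M)
      (fun z hz => by rw [sub_zero]; exact hM z (mem_vertices_of_mem ht hz)) hxt
    rwa [sub_zero] at this
  · rw [hv.2.2 x (by rwa [hK.space_eq]), abs_zero]
    linarith

/-- A mean value inequality on the segment, with one-sided slopes in place of derivatives. It joins
the element-wise Lipschitz bounds when a segment crosses several elements. -/
theorem abs_sub_le_of_locally {f : E d → ℝ} {L : ℝ} {x y : E d}
    (h : ∀ z ∈ segment ℝ x y, ∀ᶠ y' in 𝓝 z, |f y' - f z| ≤ L * ‖y' - z‖) :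
    |f y - f x| ≤ L * ‖y - x‖ := by
  set γ : ℝ → E d := fun t => x + t • (y - x) with hγ
  have hγc : Continuous γ := by fun_prop
  have hseg : ∀ t ∈ Icc (0 : ℝ) 1, γ t ∈ segment ℝ x y := fun t ht => by
    rw [segment_eq_image']; exact ⟨t, ht, rfl⟩
  have hloc : ∀ t ∈ Icc (0 : ℝ) 1, ∀ᶠ t' in 𝓝 t,
      |f (γ t') - f (γ t)| ≤ L * ‖y - x‖ * |t' - t| := by
    intro t ht
    filter_upwards [hγc.continuousAt.eventually (h _ (hseg t ht))] with t' ht'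
    refine ht'.trans (le_of_eq ?_)
    have : γ t' - γ t = (t' - t) • (y - x) := by simp only [hγ, sub_smul]; abel
    rw [this, norm_smul, Real.norm_eq_abs]
    ring
  have hcont : ContinuousOn (fun t => |f (γ t) - f x|) (Icc 0 1) := by
    intro t ht
    refine ContinuousAt.continuousWithinAt (ContinuousAt.abs (ContinuousAt.sub ?_ continuousAt_const))
    rw [ContinuousAt, tendsto_iff_norm_sub_tendsto_zero]
    refine squeeze_zero' (Eventually.of_forall fun _ => norm_nonneg _) (hloc t ht) ?_
    have : Continuous fun t' : ℝ => L * ‖y - x‖ * |t' - t| := by fun_prop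
    simpa using this.tendsto t
  have key := image_le_of_liminf_slope_right_le_deriv_boundary (f := fun t => |f (γ t) - f x|)
    (a := 0) (b := 1) hcont (B := fun t => L * ‖y - x‖ * t) (B' := fun _ => L * ‖y - x‖)
    (by simp [hγ]) (by fun_prop)
    (fun t _ => by simpa using ((hasDerivAt_id t).const_mul (L * ‖y - x‖)).hasDerivWithinAt)
    (fun t ht r hr => by
      refine Eventually.frequently ?_
      filter_upwards [nhdsWithin_le_nhds (hloc t ⟨ht.1, ht.2.le⟩), self_mem_nhdsWithin] with t' h1 h2
      have h2 : 0 < t' - t := sub_pos.2 h2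
      rw [slope_def_field, div_lt_iff₀ h2]
      rw [abs_of_pos h2] at h1
      have h3 := abs_sub_abs_le_abs_sub (f (γ t') - f x) (f (γ t) - f x)
      rw [sub_sub_sub_cancel_right] at h3
      nlinarith)
    (right_mem_Icc.2 zero_le_one)
  simpa [hγ] using key

theorem segment_subset_ball {x y : E d} {ρ : ℝ} (h : ‖x - y‖ < ρ) :
    segment ℝ x y ⊆ Metric.ball x ρ :=
  (convex_ball x ρ).segment_subset
    (Metric.mem_ball_self ((norm_nonneg _).trans_lt h))
    (by rwa [Metric.mem_ball, dist_comm, dist_eq_norm])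

/-- A function in `𝕍_h` satisfies a Lipschitz estimate around each point of `int Λ` with the
constant of the elements that contain this point. -/
theorem IsMesh.eventually_Vh_lipschitz (hK : IsMesh K Λ) {z : E d} (hz : z ∈ interior Λ)
    {L : ℝ} (hL : ∀ t ∈ elements K, z ∈ simplex t → ∀ y ∈ simplex t,
      |v y - v z| ≤ L * ‖y - z‖) : ∀ᶠ y in 𝓝 z, |v y - v z| ≤ L * ‖y - z‖ := by
  filter_upwards [hK.eventually_common_element hz] with y ⟨t, ht, hzt, hyt⟩
  exact hL t ht hzt y hyt

end mesh


/-! ### Negative powers of the distance to the complement -/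

section depth
variable {d : ℕ} {s : ℝ} {K : Complex d} {Ω Λ : Set (E d)}

theorem lintegral_abs_rpow_lt_top (hs₁ : s < 1 / 2) :
    ∫⁻ t in Icc (-1 : ℝ) 1, ENNReal.ofReal (|t| ^ (-(2 * s))) < ∞ := by
  have h1 : IntegrableOn (fun t : ℝ => t ^ (-(2 * s))) (Ioc 0 1) := by
    rw [← intervalIntegrable_iff_integrableOn_Ioc_of_le zero_le_one]
    exact intervalIntegral.intervalIntegrable_rpow' (by linarith)
  have h2 : ∫⁻ t in Ioc (0 : ℝ) 1, ENNReal.ofReal (|t| ^ (-(2 * s))) < ∞ := by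
    have := h1.hasFiniteIntegral
    rw [hasFiniteIntegral_iff_norm] at this
    refine lt_of_le_of_lt (setLIntegral_mono' measurableSet_Ioc fun t ht => ?_) this
    rw [abs_of_pos ht.1]
    exact ENNReal.ofReal_le_ofReal (le_abs_self _)
  have h3 : ∫⁻ t in Ico (-1 : ℝ) 0, ENNReal.ofReal (|t| ^ (-(2 * s))) < ∞ := by
    have := (Measure.measurePreserving_neg (volume : Measure ℝ)).setLIntegral_comp_preimage_emb
      (MeasurableEquiv.neg ℝ).measurableEmbedding
      (fun t : ℝ => ENNReal.ofReal (|t| ^ (-(2 * s)))) (Ioc (0 : ℝ) 1)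
    rw [← this] at h2
    simpa using h2
  have hsub : Icc (-1 : ℝ) 1 ⊆ (Ico (-1 : ℝ) 0 ∪ Ioc (0 : ℝ) 1) ∪ {0} := by
    intro t ht
    rcases lt_trichotomy t 0 with h | h | h
    · exact Or.inl (Or.inl ⟨ht.1, h⟩)
    · exact Or.inr h
    · exact Or.inl (Or.inr ⟨h, ht.2⟩)
  refine (lintegral_mono_set hsub).trans_lt ((lintegral_union_le _ _ _).trans_lt
    (ENNReal.add_lt_top.2 ⟨(lintegral_union_le _ _ _).trans_lt (ENNReal.add_lt_top.2 ⟨h3, h2⟩), ?_⟩))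
  rw [setLIntegral_measure_zero _ _ (by simp)]
  simp

/-- The power is at most 1 outside [-1, 1] and integrable inside, and neither contribution depends
on the translation. -/
theorem exists_bound_lintegral_translate (hs₀ : 0 < s) (hs₁ : s < 1 / 2) :
    ∃ C : ℝ≥0∞, C < ∞ ∧
      ∀ a : ℝ, ∫⁻ t in Icc (0 : ℝ) 1, ENNReal.ofReal (|a + t| ^ (-(2 * s))) ≤ C := by
  set g : ℝ → ℝ≥0∞ := fun t => ENNReal.ofReal (|t| ^ (-(2 * s))) with hg
  refine ⟨1 + ∫⁻ t in Icc (-1 : ℝ) 1, g t,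
    ENNReal.add_lt_top.2 ⟨by simp, lintegral_abs_rpow_lt_top hs₁⟩, fun a => ?_⟩
  have hle : ∀ t, g t ≤ 1 + (Icc (-1 : ℝ) 1).indicator g t := by
    intro t
    by_cases ht : t ∈ Icc (-1 : ℝ) 1
    · rw [indicator_of_mem ht]; exact le_add_self
    · rw [indicator_of_notMem ht, add_zero, hg, ← ENNReal.ofReal_one]
      refine ENNReal.ofReal_le_ofReal (Real.rpow_le_one_of_one_le_of_nonpos ?_ (by linarith))
      by_contra! h
      exact ht (abs_le.1 h.le)
  calc ∫⁻ t in Icc (0 : ℝ) 1, g (a + t)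
      ≤ ∫⁻ t in Icc (0 : ℝ) 1, (1 + (Icc (-1 : ℝ) 1).indicator g (a + t)) :=
        lintegral_mono fun t => hle _
    _ = 1 + ∫⁻ t in Icc (0 : ℝ) 1, (Icc (-1 : ℝ) 1).indicator g (a + t) := by
        rw [lintegral_add_left measurable_const]; simp
    _ ≤ 1 + ∫⁻ t, (Icc (-1 : ℝ) 1).indicator g (a + t) := by
        gcongr; exact Measure.restrict_le_self
    _ = _ := by
        rw [lintegral_add_left_eq_self (fun t => (Icc (-1 : ℝ) 1).indicator g t) a,
          lintegral_indicator measurableSet_Icc]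

/-- Negative powers `> -1` of the distance to a hyperplane are locally integrable. -/
theorem lintegral_affine_rpow_lt_top (hs₀ : 0 < s) (hs₁ : s < 1 / 2) (p : E d →ᵃ[ℝ] ℝ)
    (hp : p.linear ≠ 0) {A : Set (E d)} (hA : Bornology.IsBounded A) :
    ∫⁻ x in A, ENNReal.ofReal (|p x| ^ (-(2 * s))) < ∞ := by
  obtain ⟨C, hC, hbound⟩ := exists_bound_lintegral_translate hs₀ hs₁
  obtain ⟨e, he⟩ : ∃ e, p.linear e = 1 := by
    obtain ⟨e, he⟩ : ∃ e, p.linear e ≠ 0 := by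
      by_contra! h
      exact hp (LinearMap.ext h)
    exact ⟨(p.linear e)⁻¹ • e, by rw [map_smul, smul_eq_mul, inv_mul_cancel₀ he]⟩
  have hpe : ∀ x t, p (x + t • e) = p x + t := fun x t => by
    rw [add_comm x, ← vadd_eq_add, p.map_vadd, vadd_eq_add, add_comm, map_smul, he, smul_eq_mul,
      mul_one]
  have hpc : Continuous p := p.continuous_of_finiteDimensional
  set f : E d → ℝ≥0∞ := fun x => ENNReal.ofReal (|p x| ^ (-(2 * s))) with hf
  have hfm : Measurable f := by
    refine Measurable.ennreal_ofReal (Measurable.pow_const ?_ _)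
    exact (continuous_abs.comp hpc).measurable
  obtain ⟨R, hR⟩ := hA.subset_closedBall 0
  set B := Metric.closedBall (0 : E d) R
  set B' := Metric.closedBall (0 : E d) (R + ‖e‖)
  -- Translating by te, where the linear part of p takes the value 1 at e, costs only an enlargement
  -- of the ball. Averaging over t and exchanging the integrals leaves the one-dimensional bound on
  -- each line.
  have h1 : ∀ t ∈ Icc (0 : ℝ) 1, ∫⁻ x in B, f x ≤ ∫⁻ x in B', f (x + t • e) := by
    intro t ht
    rw [← lintegral_indicator Metric.isClosed_closedBall.measurableSet,
      ← lintegral_add_right_eq_self _ (t • e),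
      ← lintegral_indicator Metric.isClosed_closedBall.measurableSet]
    refine lintegral_mono fun x => ?_
    by_cases hx : x + t • e ∈ B
    · have hx' : x ∈ B' := by
        rw [mem_closedBall_zero_iff] at hx ⊢
        calc ‖x‖ = ‖x + t • e - t • e‖ := by rw [add_sub_cancel_right]
          _ ≤ ‖x + t • e‖ + ‖t • e‖ := norm_sub_le _ _
          _ ≤ R + 1 * ‖e‖ := by
            rw [norm_smul, Real.norm_of_nonneg ht.1]
            gcongr
            exact ht.2
          _ = _ := by rw [one_mul]
      rw [indicator_of_mem hx, indicator_of_mem hx']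
    · rw [indicator_of_notMem hx]; exact bot_le
  refine (lintegral_mono_set hR).trans_lt ?_
  calc ∫⁻ x in B, f x = ∫⁻ _t in Icc (0 : ℝ) 1, ∫⁻ x in B, f x := by simp
    _ ≤ ∫⁻ t in Icc (0 : ℝ) 1, ∫⁻ x in B', f (x + t • e) := setLIntegral_mono' measurableSet_Icc h1
    _ = ∫⁻ x in B', ∫⁻ t in Icc (0 : ℝ) 1, f (x + t • e) := by
        refine lintegral_lintegral_swap (Measurable.aemeasurable ?_)
        exact hfm.comp (by fun_prop)
    _ ≤ ∫⁻ _x in B', C := by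
        refine lintegral_mono fun x => ?_
        simp only [hf, hpe]
        exact hbound (p x)
    _ = C * volume B' := by simp
    _ < ∞ := ENNReal.mul_lt_top hC measure_closedBall_lt_top

theorem affine_abs_sub_le_norm (p : E d →ᵃ[ℝ] ℝ) :
    ∃ L, 0 < L ∧ ∀ x y, |p x - p y| ≤ L * ‖x - y‖ := by
  refine ⟨‖LinearMap.toContinuousLinearMap p.linear‖ + 1, by positivity, fun x y => ?_⟩
  have h : p x - p y = LinearMap.toContinuousLinearMap p.linear (x - y) := by
    have := p.linearMap_vsub x y
    simpa using this.symm
  rw [h, ← Real.norm_eq_abs]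
  refine ((LinearMap.toContinuousLinearMap p.linear).le_opNorm _).trans ?_
  gcongr
  linarith

/-- For x inside the element, the nearest point of Ωᶜ is outside its interior and so has a
nonpositive barycentric coordinate. That coordinate at x is then at most a constant times the depth,
and the weight is bounded by a sum of negative powers of nonconstant affine functions. -/
theorem lintegral_interior_depth_lt_top (hd : 1 ≤ d) (hs₀ : 0 < s) (hs₁ : s < 1 / 2)
    (ho : IsOpen Ω) (hb : Bornology.IsBounded Ω)
    (hreg : interior (closure Ω) ⊆ Ω) {t : Finset (E d)} (ht : t ∈ elements K)
    (htΩ : simplex t ⊆ closure Ω) :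
    ∫⁻ x in simplex t, ENNReal.ofReal (depth Ω x ^ (-(2 * s))) < ∞ := by
  obtain ⟨b, hbt⟩ := exists_affineBasis ht
  have hint : interior (simplex t) = {x | ∀ i, 0 < b.coord i x} := by
    rw [hbt, b.interior_convexHull]
  choose L hL0 hL using fun i => affine_abs_sub_le_norm (b.coord i)
  have hlin : ∀ i, (b.coord i).linear ≠ 0 := by
    intro i h0
    have hcard : 1 < Fintype.card t := by rw [Fintype.card_coe, ht.2]; omega
    obtain ⟨j, hj⟩ := Fintype.exists_ne_of_one_lt_card hcard i
    have h1 := (b.coord i).linearMap_vsub (b i) (b j)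
    rw [h0, b.coord_apply_eq, b.coord_apply_ne hj.symm] at h1
    simp at h1
  have key : ∀ x ∈ interior (simplex t), ENNReal.ofReal (depth Ω x ^ (-(2 * s))) ≤
      ∑ i, ENNReal.ofReal (L i ^ (2 * s)) * ENNReal.ofReal (|b.coord i x| ^ (-(2 * s))) := by
    intro x hx
    have hxΩ : x ∈ Ω := hreg (interior_mono htΩ hx)
    have hpos := depth_pos hd hb ho hxΩ
    obtain ⟨y, hy, hyx⟩ := ho.isClosed_compl.exists_infDist_eq_dist (compl_nonempty hd hb) x
    have hyt : y ∉ interior (simplex t) := fun h => hy (hreg (interior_mono htΩ h))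
    rw [hint] at hx hyt
    simp only [mem_ofPred_eq, not_forall, not_lt] at hyt
    obtain ⟨i, hi⟩ := hyt
    have hxi := hx i
    have h1 : b.coord i x ≤ L i * depth Ω x := by
      have h2 := (le_abs_self _).trans (hL i x y)
      rw [depth, hyx, dist_eq_norm]
      linarith
    refine le_trans ?_ (Finset.single_le_sum
      (f := fun i => ENNReal.ofReal (L i ^ (2 * s)) * ENNReal.ofReal (|b.coord i x| ^ (-(2 * s))))
      (fun _ _ => bot_le) (Finset.mem_univ i))
    rw [← ENNReal.ofReal_mul (by have := hL0 i; positivity)]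
    refine ENNReal.ofReal_le_ofReal ?_
    rw [abs_of_pos hxi]
    calc depth Ω x ^ (-(2 * s)) ≤ (b.coord i x / L i) ^ (-(2 * s)) := by
          refine Real.rpow_le_rpow_of_nonpos (div_pos hxi (hL0 i)) ?_ (by linarith)
          rw [div_le_iff₀ (hL0 i), mul_comm]
          exact h1
      _ = _ := by
          rw [Real.div_rpow hxi.le (hL0 i).le, Real.rpow_neg (hL0 i).le, div_inv_eq_mul, mul_comm]
  have hae : (simplex t : Set (E d)) =ᵐ[volume] interior (simplex t) :=
    (interior_ae_eq_of_null_frontier (volume_frontier_simplex t)).symm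
  rw [setLIntegral_congr hae]
  refine (setLIntegral_mono' isOpen_interior.measurableSet key).trans_lt ?_
  rw [lintegral_finsetSum' _ fun i _ => ?_]
  · refine ENNReal.sum_lt_top.2 fun i _ => ?_
    rw [lintegral_const_mul' _ _ (by simp)]
    exact ENNReal.mul_lt_top (by simp) (lintegral_affine_rpow_lt_top hs₀ hs₁ _ (hlin i)
      ((isCompact_simplex t).isBounded.subset interior_subset))
  · refine Measurable.aemeasurable (Measurable.const_mul (Measurable.ennreal_ofReal
      (Measurable.pow_const ?_ _)) _)
    exact (continuous_abs.comp (b.coord i).continuous_of_finiteDimensional).measurable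

theorem IsMesh.lintegral_depth_lt_top (hK : IsMesh K Λ) (hKΩ : MeshesExactly K Ω) (hd : 1 ≤ d)
    (hs₀ : 0 < s) (hs₁ : s < 1 / 2) (ho : IsOpen Ω) (hb : Bornology.IsBounded Ω)
    (hreg : interior (closure Ω) ⊆ Ω) :
    ∫⁻ x in Ω, ENNReal.ofReal (depth Ω x ^ (-(2 * s))) < ∞ := by
  obtain ⟨S, hS, hSΩ⟩ := hKΩ
  have : Countable S := (hK.finite_elements.subset hS).countable
  have : Fintype S := (hK.finite_elements.subset hS).fintype
  have hsub : Ω ⊆ ⋃ t : S, simplex t.1 := by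
    refine subset_closure.trans (hSΩ.trans_subset ?_)
    rw [biUnion_eq_iUnion]
  refine (lintegral_mono_set hsub).trans_lt ?_
  refine (lintegral_iUnion_le _ _).trans_lt ?_
  rw [tsum_fintype]
  refine ENNReal.sum_lt_top.2 fun ⟨t, htS⟩ _ => ?_
  refine lintegral_interior_depth_lt_top hd hs₀ hs₁ ho hb hreg (hS htS) ?_
  rw [hSΩ]
  exact subset_biUnion_of_mem (u := fun t => simplex t) htS

/-- The complement of `Ω` has a uniformly large part close to each point of `Ω`. -/
theorem IsMesh.exists_le_lintegral_compl (hK : IsMesh K Λ) (hKΩ : MeshesExactly K Ω) (hd : 1 ≤ d)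
    (hs₀ : 0 < s) (ho : IsOpen Ω) (hb : Bornology.IsBounded Ω)
    (hreg : interior (closure Ω) ⊆ Ω) (hΩΛ : closure Ω ⊆ interior Λ) :
    ∃ c, 0 < c ∧ ∀ x ∈ Ω, ENNReal.ofReal (c * depth Ω x ^ (-(2 * s))) ≤
      ∫⁻ y in Ωᶜ, ENNReal.ofReal (1 / ‖x - y‖ ^ ((d : ℝ) + 2 * s)) := by
  obtain ⟨D₁, hD₁, hD₁Ω⟩ := exists_depth_le hd hb
  obtain ⟨D₂, hD₂, hD₂t⟩ := exists_ge_one_forall_le_of_finite hK.finite_elements elementSize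
  obtain ⟨m, hm, hmt⟩ := exists_pos_forall_le_of_finite hK.finite_elements
    (f := fun t => (volume (simplex t)).toReal) fun t ht =>
      ENNReal.toReal_pos (volume_simplex_pos ht).ne' (isCompact_simplex t).measure_lt_top.ne
  -- D dominates both the depths in Ω and the element diameters. The first makes the homothety ratio
  -- δ/D at most 1, the second keeps the shrunken element within δ of x'.
  set D := max D₁ D₂ with hD
  have hD0 : 0 < D := by positivity
  refine ⟨2 ^ (-((d : ℝ) + 2 * s)) * D⁻¹ ^ d * m, by positivity, fun x hx => ?_⟩
  have hδ := depth_pos hd hb ho hx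
  set δ := depth Ω x with hδdef
  obtain ⟨x', hx', hxx'⟩ := ho.isClosed_compl.exists_infDist_eq_dist (compl_nonempty hd hb) x
  have hxx' : δ = ‖x - x'‖ := by rw [hδdef, depth, hxx', dist_eq_norm]
  have hcl : x' ∈ closure Ω := by
    have h1 : Metric.ball x δ ⊆ Ω := fun y hy => by
      rw [Metric.mem_ball, dist_comm, dist_eq_norm] at hy
      exact mem_of_norm_lt_depth hy
    have h2 : x' ∈ closure (Metric.ball x δ) := by
      rw [closure_ball _ hδ.ne', Metric.mem_closedBall, dist_comm, dist_eq_norm, hxx']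
    exact closure_mono h1 h2
  obtain ⟨t, ht, hx't, htΩ⟩ := hK.exists_exterior_element hKΩ ho hreg hΩΛ
    (interior_subset (hΩΛ hcl)) hx'
  set lam := δ / D with hlam
  have hlam0 : 0 ≤ lam := by positivity
  have hlam1 : lam ≤ 1 := by
    rw [hlam, div_le_one hD0]
    exact (hD₁Ω x hx).trans (le_max_left _ _)
  -- An exterior element at the nearest point x', shrunk towards x': it stays in Ωᶜ, lies within 2δ
  -- of x, and has volume at least a fixed multiple of δ^d.
  set A := AffineMap.homothety x' lam '' simplex t with hA
  have hAprop : ∀ y ∈ A, y ∈ simplex t ∧ ‖x - y‖ ≤ 2 * δ := by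
    rintro _ ⟨z, hz, rfl⟩
    rw [AffineMap.homothety_eq_lineMap]
    refine ⟨(convex_simplex t).lineMap_mem hx't hz ⟨hlam0, hlam1⟩, ?_⟩
    have h1 : ‖x' - AffineMap.lineMap x' z lam‖ ≤ δ := by
      rw [← dist_eq_norm, dist_left_lineMap, Real.norm_of_nonneg hlam0, dist_eq_norm]
      calc lam * ‖x' - z‖ ≤ lam * D := by
            gcongr
            exact (norm_sub_le_elementSize hx't hz).trans ((hD₂t t ht).trans (le_max_right _ _))
        _ = δ := div_mul_cancel₀ _ hD0.ne'
    calc ‖x - AffineMap.lineMap x' z lam‖ = ‖(x - x') + (x' - AffineMap.lineMap x' z lam)‖ := by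
          congr 1; abel
      _ ≤ ‖x - x'‖ + ‖x' - AffineMap.lineMap x' z lam‖ := norm_add_le _ _
      _ ≤ 2 * δ := by rw [← hxx']; linarith
  have hAm : MeasurableSet A := by
    refine ((isCompact_simplex t).image ?_).measurableSet
    exact AffineMap.continuous_of_finiteDimensional _
  have hvol : ENNReal.ofReal (lam ^ d * m) ≤ volume A := by
    rw [hA, Measure.addHaar_image_homothety, finrank_euclideanSpace_fin,
      abs_of_nonneg (by positivity), ENNReal.ofReal_mul (by positivity)]
    gcongr
    exact ENNReal.ofReal_le_of_le_toReal (hmt t ht)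
  calc ENNReal.ofReal (2 ^ (-((d : ℝ) + 2 * s)) * D⁻¹ ^ d * m * δ ^ (-(2 * s)))
      = ENNReal.ofReal (1 / (2 * δ) ^ ((d : ℝ) + 2 * s)) * ENNReal.ofReal (lam ^ d * m) := by
        rw [← ENNReal.ofReal_mul (by positivity)]
        congr 1
        rw [Real.mul_rpow (by norm_num) hδ.le, Real.rpow_add hδ, Real.rpow_natCast,
          Real.rpow_neg (by norm_num), Real.rpow_neg hδ.le, hlam]
        field_simp
        rw [div_pow, div_pow, one_pow]
        ring
    _ ≤ ENNReal.ofReal (1 / (2 * δ) ^ ((d : ℝ) + 2 * s)) * volume A := by gcongr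
    _ = ∫⁻ _y in A, ENNReal.ofReal (1 / (2 * δ) ^ ((d : ℝ) + 2 * s)) := by simp
    _ ≤ ∫⁻ y in A, ENNReal.ofReal (1 / ‖x - y‖ ^ ((d : ℝ) + 2 * s)) := by
        refine setLIntegral_mono' hAm fun y hy => ENNReal.ofReal_le_ofReal ?_
        obtain ⟨hyt, hyd⟩ := hAprop y hy
        have hpos : 0 < ‖x - y‖ := hδ.trans_le (depth_le_norm_sub x (htΩ hyt))
        refine one_div_le_one_div_of_le (by positivity) ?_
        exact Real.rpow_le_rpow hpos.le hyd (by positivity)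
    _ ≤ _ := lintegral_mono_set fun y hy => htΩ (hAprop y hy).1

end depth


/-! ### The `L²`-projection onto affine functions -/

section projection
variable {d : ℕ}

/-- Inverse inequality: shrink the ball by the factor 1/4 towards a maximum point x₀ of |p|. There p
is 3/4 p(x₀) plus a quarter of another value of p on the ball, so |p| is at least half its maximum.
-/
theorem exists_bound_le_integral_sq (p : E d →ᵃ[ℝ] ℝ) (c : E d) {r : ℝ} (hr : 0 < r) :
    ∃ m, 0 ≤ m ∧ (∀ x ∈ Metric.closedBall c r, |p x| ≤ m) ∧
      m ^ 2 / 4 * volume.real (Metric.closedBall c (r / 4)) ≤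
        ∫ x in Metric.closedBall c r, p x ^ 2 := by
  have hpc : Continuous p := p.continuous_of_finiteDimensional
  obtain ⟨x₀, hx₀, hmax⟩ := (isCompact_closedBall c r).exists_isMaxOn
    (Metric.nonempty_closedBall.2 hr.le) hpc.abs.continuousOn
  have hmax' : ∀ x ∈ Metric.closedBall c r, |p x| ≤ |p x₀| := fun x hx => hmax hx
  refine ⟨|p x₀|, abs_nonneg _, hmax', ?_⟩
  set c' : E d := AffineMap.lineMap x₀ c (1 / 4 : ℝ) with hc'
  have hball : ∀ x ∈ Metric.closedBall c' (r / 4), x ∈ Metric.closedBall c r ∧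
      |p x₀| ^ 2 / 4 ≤ p x ^ 2 := by
    intro x hx
    set y : E d := AffineMap.lineMap x₀ x (4 : ℝ) with hy
    have hyc : y ∈ Metric.closedBall c r := by
      rw [mem_closedBall_iff_norm] at hx ⊢
      have : y - c = (4 : ℝ) • (x - c') := by
        simp only [hy, hc', AffineMap.lineMap_apply_module]
        module
      rw [this, norm_smul, Real.norm_of_nonneg (by norm_num)]
      linarith
    have hxy : x = AffineMap.lineMap x₀ y (1 / 4 : ℝ) := by
      simp only [hy, AffineMap.lineMap_apply_module]
      module
    refine ⟨?_, ?_⟩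
    · rw [hxy]
      exact (convex_closedBall c r).lineMap_mem hx₀ hyc ⟨by norm_num, by norm_num⟩
    · have hpx : p x = p x₀ + 1 / 4 * (p y - p x₀) := by
        conv_lhs => rw [hxy]
        rw [AffineMap.apply_lineMap, AffineMap.lineMap_apply_ring']
        ring
      have h1 := abs_le.1 (hmax' y hyc)
      rw [hpx]
      rcases abs_cases (p x₀) with ⟨h, h'⟩ | ⟨h, h'⟩ <;> rw [h] at h1 ⊢ <;> nlinarith
  have hvol : volume.real (Metric.closedBall c (r / 4)) =
      volume.real (Metric.closedBall c' (r / 4)) := by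
    simp [measureReal_def, Measure.addHaar_closedBall_center]
  have hint : IntegrableOn (fun x => p x ^ 2) (Metric.closedBall c r) :=
    (hpc.pow 2).continuousOn.integrableOn_compact (isCompact_closedBall c r)
  calc |p x₀| ^ 2 / 4 * volume.real (Metric.closedBall c (r / 4))
      = ∫ _x in Metric.closedBall c' (r / 4), |p x₀| ^ 2 / 4 := by
        rw [setIntegral_const, smul_eq_mul, hvol, mul_comm]
    _ ≤ ∫ x in Metric.closedBall c' (r / 4), p x ^ 2 := by
        refine setIntegral_mono_on (integrableOn_const measure_closedBall_lt_top.ne) (hint.mono_set fun x hx => (hball x hx).1)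
          Metric.isClosed_closedBall.measurableSet fun x hx => (hball x hx).2
    _ ≤ _ := setIntegral_mono_set hint (Eventually.of_forall fun x => sq_nonneg _)
        (LE.le.eventuallyLE fun x hx => (hball x hx).1)

instance : FiniteDimensional ℝ (E d →ᵃ[ℝ] ℝ) :=
  Module.Finite.equiv (AffineMap.toConstProdLinearMap ℝ).symm

variable {S : Set (E d)}

theorem integrableOn_affine_mul (hS : IsCompact S) (p q : E d →ᵃ[ℝ] ℝ) :
    IntegrableOn (fun x => p x * q x) S :=
  (p.continuous_of_finiteDimensional.mul
    q.continuous_of_finiteDimensional).continuousOn.integrableOn_compact hS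

theorem integrableOn_mul_affine (hS : IsCompact S) {f : E d → ℝ} (hf : IntegrableOn f S)
    (q : E d →ᵃ[ℝ] ℝ) : IntegrableOn (fun x => f x * q x) S :=
  hf.mul_continuousOn q.continuous_of_finiteDimensional.continuousOn hS

/-- The L²(S) form on affine functions is definite because S contains a ball, hence onto the dual in
finite dimension. This covers data that are only integrable, and ensures that the choice in `l2Proj`
is a projection. -/
theorem exists_isL2Proj (hS : IsCompact S) {f : E d → ℝ} (hf : IntegrableOn f S) {c : E d} {r : ℝ}
    (hr : 0 < r) (hball : Metric.closedBall c r ⊆ S) : ∃ p, IsL2Proj S f p := by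
  let Φ : (E d →ᵃ[ℝ] ℝ) →ₗ[ℝ] (E d →ᵃ[ℝ] ℝ) →ₗ[ℝ] ℝ :=
    LinearMap.mk₂ ℝ (fun p q => ∫ x in S, p x * q x)
      (fun p p' q => by
        rw [← integral_add (integrableOn_affine_mul hS p q) (integrableOn_affine_mul hS p' q)]
        congr 1; ext x; simp [add_mul])
      (fun a p q => by
        rw [smul_eq_mul, ← integral_const_mul]
        congr 1; ext x; simp [mul_assoc])
      (fun p q q' => by
        rw [← integral_add (integrableOn_affine_mul hS p q) (integrableOn_affine_mul hS p q')]
        congr 1; ext x; simp [mul_add])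
      (fun a p q => by
        rw [smul_eq_mul, ← integral_const_mul]
        congr 1; ext x; simp [mul_left_comm])
  have hinj : Function.Injective Φ := by
    rw [← LinearMap.ker_eq_bot, LinearMap.ker_eq_bot']
    intro p hp
    have h0 : ∫ x in S, p x * p x = 0 := LinearMap.congr_fun hp p
    obtain ⟨m, hm0, hm, hint⟩ := exists_bound_le_integral_sq p c hr
    have h1 : ∫ x in Metric.closedBall c r, p x ^ 2 ≤ 0 := by
      rw [← h0]
      simp_rw [pow_two]
      exact setIntegral_mono_set (integrableOn_affine_mul hS p p)
        (Eventually.of_forall fun x => mul_self_nonneg _) (LE.le.eventuallyLE hball)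
    have hV : 0 < volume.real (Metric.closedBall c (r / 4)) :=
      ENNReal.toReal_pos (Metric.measure_closedBall_pos _ _ (by positivity)).ne'
        measure_closedBall_lt_top.ne
    have hm' : m = 0 := by
      have : m ^ 2 / 4 ≤ 0 := nonpos_of_mul_nonpos_left (hint.trans h1) hV
      nlinarith
    ext x
    have h2 := abs_affine_sub_le p (c := c) (a := 0) hr (by simpa using hm) x c
    rw [hm', zero_div, zero_mul] at h2
    have h3 := hm c (Metric.mem_closedBall_self hr.le)
    rw [hm'] at h3
    have h4 := abs_nonpos_iff.1 h2
    have h5 := abs_nonpos_iff.1 h3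
    simp only [AffineMap.coe_zero, Pi.zero_apply]
    linarith
  have hsurj : Function.Surjective Φ :=
    (LinearMap.injective_iff_surjective_of_finrank_eq_finrank
      (Subspace.dual_finrank_eq (K := ℝ) (V := E d →ᵃ[ℝ] ℝ)).symm).1 hinj
  let F : (E d →ᵃ[ℝ] ℝ) →ₗ[ℝ] ℝ :=
    { toFun := fun q => ∫ x in S, f x * q x
      map_add' := fun q q' => by
        rw [← integral_add (integrableOn_mul_affine hS hf q) (integrableOn_mul_affine hS hf q')]
        congr 1; ext x; simp [mul_add]
      map_smul' := fun a q => by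
        rw [RingHom.id_apply, smul_eq_mul, ← integral_const_mul]
        congr 1; ext x; simp [mul_left_comm] }
  obtain ⟨p, hp⟩ := hsurj F
  refine ⟨p, fun q => ?_⟩
  have h1 : ∫ x in S, p x * q x = ∫ x in S, f x * q x := LinearMap.congr_fun hp q
  simp_rw [sub_mul]
  rw [integral_sub (integrableOn_mul_affine hS hf q) (integrableOn_affine_mul hS p q), h1, sub_self]

theorem volume_real_closedBall (c : E d) {r : ℝ} (hr : 0 ≤ r) :
    volume.real (Metric.closedBall c r) = r ^ d * volume.real (Metric.ball (0 : E d) 1) := by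
  rw [measureReal_def, Measure.addHaar_closedBall _ _ hr, ENNReal.toReal_mul,
    ENNReal.toReal_ofReal (by positivity), finrank_euclideanSpace_fin, measureReal_def]

theorem volume_real_closedBall_pos (c : E d) {r : ℝ} (hr : 0 < r) :
    0 < volume.real (Metric.closedBall c r) :=
  ENNReal.toReal_pos (Metric.measure_closedBall_pos _ _ hr).ne' measure_closedBall_lt_top.ne

/-- The constant in the `L¹`-`L^∞` stability of the projection. -/
noncomputable def stabilityConst (d : ℕ) (κ : ℝ) : ℝ := 4 * (1 + 2 * κ) ^ 2 * (4 * κ) ^ d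

theorem stabilityConst_pos {κ : ℝ} (hκ : 1 ≤ κ) : 0 < stabilityConst d κ := by
  unfold stabilityConst
  positivity

/-- Testing orthogonality with q = p - a gives ∫ q² = ∫ (f - a) q ≤ sup |q| ∫ |f - a|. The inverse
inequality bounds the left side below by a multiple of m² r^d, m being a bound for |q| on the
inscribed ball. One factor m cancels, and R ≤ κr makes the constant scale invariant. -/
theorem IsL2Proj.abs_sub_le {f : E d → ℝ} {p : E d →ᵃ[ℝ] ℝ} (hp : IsL2Proj S f p)
    (hS : IsCompact S) {c z : E d} {r R κ : ℝ} (hκ : 1 ≤ κ)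
    (hf : LocallyIntegrable f) (hr : 0 < r) (hball : Metric.closedBall c r ⊆ S)
    (hSR : ∀ᵐ x, x ∈ S → x ∈ Metric.closedBall z R) (hcR : ‖z - c‖ ≤ R) (hR : 0 < R)
    (hRr : R ≤ κ * r) (a : ℝ) :
    |p z - a| ≤ stabilityConst d κ * ⨍ x in Metric.closedBall z R, |f x - a| := by
  set q : E d →ᵃ[ℝ] ℝ := p - AffineMap.const ℝ (E d) a with hq
  have hqx : ∀ x, q x = p x - a := fun x => by simp [hq]
  have hfa : ∀ {A : Set (E d)}, IsCompact A → IntegrableOn (fun x => f x - a) A := fun hA =>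
    (hf.integrableOn_isCompact hA).sub (continuousOn_const.integrableOn_compact hA)
  obtain ⟨m, hm0, hm, hint⟩ := exists_bound_le_integral_sq q c hr
  have hlip : ∀ x, |q x| ≤ m + m / r * ‖x - c‖ := fun x => by
    have h1 := abs_affine_sub_le q (c := c) (a := 0) hr (by simpa using hm) x c
    have h2 := hm c (Metric.mem_closedBall_self hr.le)
    have h3 := abs_add_le (q x - q c) (q c)
    rw [sub_add_cancel] at h3
    linarith
  have hqR : ∀ x, ‖x - c‖ ≤ 2 * R → |q x| ≤ m * (1 + 2 * κ) := fun x hx => by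
    refine (hlip x).trans ?_
    have : m / r * ‖x - c‖ ≤ m / r * (2 * (κ * r)) := by
      gcongr
      linarith
    have e : m / r * (2 * (κ * r)) = 2 * m * κ := by field_simp
    linarith
  have hsq : ∫ x in S, q x * q x = ∫ x in S, (f x - a) * q x := by
    have h1 := hp q
    have h2 : ∀ x, (f x - p x) * q x = (f x - a) * q x - q x * q x := fun x => by
      rw [hqx]; ring
    simp_rw [h2] at h1
    rw [integral_sub (integrableOn_mul_affine hS (hfa hS) q) (integrableOn_affine_mul hS q q)] at h1
    linarith
  set J := ∫ x in Metric.closedBall z R, |f x - a| with hJ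
  have hJ0 : 0 ≤ J := integral_nonneg fun x => abs_nonneg _
  have hle : ∫ x in S, (f x - a) * q x ≤ m * (1 + 2 * κ) * J := by
    calc ∫ x in S, (f x - a) * q x ≤ ∫ x in S, m * (1 + 2 * κ) * |f x - a| := by
          refine setIntegral_mono_ae_restrict (integrableOn_mul_affine hS (hfa hS) q)
            ((hfa hS).abs.const_mul _) ?_
          refine (ae_restrict_iff' hS.measurableSet).2 ?_
          filter_upwards [hSR] with x hx hxS
          have hxR := hx hxS
          rw [mem_closedBall_iff_norm] at hxR
          have hxc : ‖x - c‖ ≤ 2 * R := by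
            calc ‖x - c‖ = ‖(x - z) + (z - c)‖ := by congr 1; abel
              _ ≤ ‖x - z‖ + ‖z - c‖ := norm_add_le _ _
              _ ≤ 2 * R := by linarith
          calc (f x - a) * q x ≤ |f x - a| * |q x| := by rw [← abs_mul]; exact le_abs_self _
            _ ≤ |f x - a| * (m * (1 + 2 * κ)) := by gcongr; exact hqR x hxc
            _ = _ := mul_comm _ _
      _ = m * (1 + 2 * κ) * ∫ x in S, |f x - a| := integral_const_mul _ _
      _ ≤ _ := by
          gcongr
          refine setIntegral_mono_set (hfa (isCompact_closedBall z R)).abs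
            (Eventually.of_forall fun x => abs_nonneg _) hSR
  have hball2 : ∫ x in Metric.closedBall c r, q x ^ 2 ≤ ∫ x in S, q x * q x := by
    simp_rw [pow_two]
    exact setIntegral_mono_set (integrableOn_affine_mul hS q q)
      (Eventually.of_forall fun x => mul_self_nonneg _) (LE.le.eventuallyLE hball)
  set V := volume.real (Metric.closedBall c (r / 4)) with hV
  set VR := volume.real (Metric.closedBall z R) with hVR
  have hVRpos : 0 < VR := volume_real_closedBall_pos z hR
  have hVV : VR ≤ (4 * κ) ^ d * V := by
    rw [hV, hVR, volume_real_closedBall z hR.le, volume_real_closedBall c (by positivity),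
      ← mul_assoc, ← mul_pow]
    gcongr
    linarith
  have hmV : m * V ≤ 4 * (1 + 2 * κ) * J := by
    rcases hm0.eq_or_lt with h | h
    · rw [← h, zero_mul]; positivity
    · have h1 : m ^ 2 / 4 * V ≤ m * (1 + 2 * κ) * J :=
        hint.trans (hball2.trans (hsq.le.trans hle))
      have h2 : m * (m * V) ≤ m * (4 * (1 + 2 * κ) * J) := by linarith
      exact le_of_mul_le_mul_left h2 h
  have hmVR : m * VR ≤ (4 * κ) ^ d * (4 * (1 + 2 * κ) * J) := by
    calc m * VR ≤ m * ((4 * κ) ^ d * V) := by gcongr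
      _ = (4 * κ) ^ d * (m * V) := by ring
      _ ≤ _ := by gcongr
  rw [← hqx, setAverage_eq, smul_eq_mul]
  refine (hqR z (by linarith)).trans ?_
  have : m ≤ (4 * κ) ^ d * (4 * (1 + 2 * κ) * J) / VR := by rwa [le_div_iff₀ hVRpos]
  calc m * (1 + 2 * κ) ≤ (4 * κ) ^ d * (4 * (1 + 2 * κ) * J) / VR * (1 + 2 * κ) := by gcongr
    _ = _ := by rw [stabilityConst, ← hVR, ← hJ]; field_simp

end projection

/-! ### The exterior interpolant -/

section clement
variable {d : ℕ} {K : Complex d} {Ω Λ : Set (E d)} {κ : ℝ} {g : E d → ℝ}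

theorem hat_mem (hK : IsMesh K Λ) (z : E d) : hat K z ∈ Vh K :=
  (Classical.epsilon_spec (exists_hat hK z)).1

open Classical in
theorem hat_apply (hK : IsMesh K Λ) (z : E d) {z' : E d} (hz' : z' ∈ K.vertices) :
    hat K z z' = if z' = z then 1 else 0 :=
  (Classical.epsilon_spec (exists_hat hK z)).2 z' hz'

theorem Vh_sum {α : Type*} (A : Finset α) {v : α → E d → ℝ} (hv : ∀ z, v z ∈ Vh K) :
    (∑ z ∈ A, v z) ∈ Vh K := by
  classical
  induction A using Finset.induction_on with
  | empty => simpa using Vh_zero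
  | insert z A hz ih => rw [Finset.sum_insert hz]; exact Vh_add (hv z) ih

theorem IsMesh.nodal_sum_mem (hK : IsMesh K Λ) {A : Set (E d)} (hA : A.Finite) (n : E d → ℝ) :
    (fun x => ∑ᶠ z ∈ A, n z * hat K z x) ∈ Vh K := by
  have : (fun x => ∑ᶠ z ∈ A, n z * hat K z x) = ∑ z ∈ hA.toFinset, n z • hat K z := by
    ext x
    rw [finsum_mem_eq_finite_toFinset_sum _ hA]
    simp
  rw [this]
  exact Vh_sum _ fun z => Vh_smul _ (hat_mem hK z)

open Classical in
theorem IsMesh.nodal_sum_apply (hK : IsMesh K Λ) {A : Set (E d)} (hA : A.Finite) (n : E d → ℝ)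
    {z : E d} (hz : z ∈ K.vertices) :
    ∑ᶠ z' ∈ A, n z' * hat K z' z = if z ∈ A then n z else 0 := by
  rw [finsum_mem_eq_finite_toFinset_sum _ hA]
  simp_rw [hat_apply hK _ hz]
  simp

theorem IsMesh.exteriorClement_mem (hK : IsMesh K Λ) (Ω : Set (E d)) (g : E d → ℝ) :
    exteriorClement K Ω g ∈ Vh K :=
  hK.nodal_sum_mem (hK.finite_vertices.subset sdiff_subset) _

theorem IsMesh.exteriorClement_vertex (hK : IsMesh K Λ) {z : E d} (hz : z ∈ K.vertices)
    (hzΩ : z ∉ Ω) : exteriorClement K Ω g z = l2Proj (star K z ∩ Ωᶜ) g z := by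
  have := hK.nodal_sum_apply (hK.finite_vertices.subset (sdiff_subset (t := Ω)))
    (fun z => l2Proj (star K z ∩ Ωᶜ) g z) hz
  rw [if_pos ⟨hz, hzΩ⟩] at this
  exact this

theorem IsMesh.exteriorClement_vertex_eq_zero (hK : IsMesh K Λ) {z : E d} (hz : z ∈ K.vertices)
    (hzΩ : z ∈ Ω) : exteriorClement K Ω g z = 0 := by
  have := hK.nodal_sum_apply (hK.finite_vertices.subset (sdiff_subset (t := Ω)))
    (fun z => l2Proj (star K z ∩ Ωᶜ) g z) hz
  rw [if_neg fun h => h.2 hzΩ] at this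
  exact this

variable (hK : IsMesh K Λ) (hKΩ : MeshesExactly K Ω) (hd : 1 ≤ d) (ho : IsOpen Ω)
  (hreg : interior (closure Ω) ⊆ Ω) (hΩΛ : closure Ω ⊆ interior Λ) (hκ : 1 ≤ κ)
  (hsh : IsShapeRegular κ K) (hg : LocallyIntegrable g)

theorem IsMesh.isCompact_star (hK : IsMesh K Λ) (z : E d) : IsCompact (star K z) :=
  (hK.finite_elements.subset fun _ h => h.1).isCompact_biUnion fun t _ => isCompact_simplex t

include hK hKΩ hd ho hreg hΩΛ hκ hsh hg in
-- R is the diameter of the largest exterior element at z. Up to the null set ∂Ω, the exterior part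
-- of the star consists of such elements, so it lies within R of z, and the largest of them supplies
-- an inscribed ball comparable to R. No comparison between neighbouring elements is required.
theorem exists_radius_abs_l2Proj_sub_le {z : E d} (hz : z ∈ K.vertices) (hzΩ : z ∉ Ω) :
    ∃ R, 0 < R ∧ R ≤ meshSize K ∧
      (∀ t ∈ elements K, z ∈ t → simplex t ⊆ Ωᶜ → elementSize t ≤ R) ∧
      ∀ a, |l2Proj (star K z ∩ Ωᶜ) g z - a| ≤
        stabilityConst d κ * ⨍ x in Metric.closedBall z R, |g x - a| := by
  have hzΛ : z ∈ Λ := by rw [← hK.space_eq]; exact K.vertices_subset_space hz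
  have hmem : ∀ t ∈ elements K, z ∈ simplex t → z ∈ t := fun t ht h =>
    (K.vertex_mem_convexHull_iff hz ht.1).1 h
  obtain ⟨t₀, ht₀, hzt₀, ht₀Ω⟩ := hK.exists_exterior_element hKΩ ho hreg hΩΛ hzΛ hzΩ
  obtain ⟨T, ⟨hT, hzT, hTΩ⟩, hmax⟩ := ({t ∈ elements K | z ∈ t ∧ simplex t ⊆ Ωᶜ}).exists_max_image
    elementSize (hK.finite_elements.subset fun _ h => h.1) ⟨t₀, ht₀, hmem t₀ ht₀ hzt₀, ht₀Ω⟩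
  obtain ⟨c, r, hr, hball, hTr⟩ := hsh T hT
  have hS : IsCompact (star K z ∩ Ωᶜ) := (hK.isCompact_star z).inter_right ho.isClosed_compl
  have hballS : Metric.closedBall c r ⊆ star K z ∩ Ωᶜ := hball.trans
    (subset_inter (subset_biUnion_of_mem (u := fun t => simplex t) ⟨hT, hzT⟩) hTΩ)
  have hp : IsL2Proj (star K z ∩ Ωᶜ) g (l2Proj (star K z ∩ Ωᶜ) g) :=
    Classical.epsilon_spec (exists_isL2Proj hS (hg.integrableOn_isCompact hS) hr hballS)
  refine ⟨elementSize T, elementSize_pos hd hT, hK.elementSize_le_meshSize hT,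
    fun t ht hzt htΩ => hmax t ⟨ht, hzt, htΩ⟩, fun a => ?_⟩
  refine hp.abs_sub_le hS hκ hg hr hballS ?_ ?_ (elementSize_pos hd hT) hTr a
  · have hfr : ∀ᵐ x, x ∉ frontier Ω :=
      measure_eq_zero_iff_ae_notMem.1 (hK.volume_frontier hKΩ ho hreg hΩΛ)
    filter_upwards [hfr] with x hx hxS
    obtain ⟨hxs, hxΩ⟩ := hxS
    obtain ⟨t, ⟨ht, hzt⟩, hxt⟩ := mem_iUnion₂.1 hxs
    have htΩ := (hK.element_inside_or_outside hKΩ ho ht).resolve_left fun h => hx (by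
      rw [ho.frontier_eq]
      exact ⟨h hxt, hxΩ⟩)
    rw [mem_closedBall_iff_norm]
    exact (norm_sub_le_elementSize hxt (subset_simplex t hzt)).trans (hmax t ⟨ht, hzt, htΩ⟩)
  · exact norm_sub_le_elementSize (subset_simplex T hzT) (hball (Metric.mem_closedBall_self hr.le))

theorem average_le_of_ae_le {f : E d → ℝ} {M : ℝ} (hM : ∀ᵐ x, |f x| ≤ M) (hf : LocallyIntegrable f)
    (z : E d) {R : ℝ} (hR : 0 < R) : ⨍ x in Metric.closedBall z R, |f x - 0| ≤ M := by
  have hV := volume_real_closedBall_pos z hR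
  rw [setAverage_eq, smul_eq_mul, inv_mul_le_iff₀ hV]
  have hi : IntegrableOn (fun x => |f x - 0|) (Metric.closedBall z R) := by
    simp only [sub_zero]
    exact (hf.integrableOn_isCompact (isCompact_closedBall z R)).abs
  calc ∫ x in Metric.closedBall z R, |f x - 0| ≤ ∫ _x in Metric.closedBall z R, M := by
        refine setIntegral_mono_ae hi (integrableOn_const measure_closedBall_lt_top.ne) ?_
        filter_upwards [hM] with x hx
        rwa [sub_zero]
    _ = _ := by rw [setIntegral_const, smul_eq_mul]

include hK hKΩ hd ho hreg hΩΛ hκ hsh hg in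
theorem abs_exteriorClement_vertex_le {M : ℝ} (hM0 : 0 ≤ M) (hM : ∀ᵐ x, |g x| ≤ M) {z : E d}
    (hz : z ∈ K.vertices) : |exteriorClement K Ω g z| ≤ stabilityConst d κ * M := by
  have hC := stabilityConst_pos (d := d) hκ
  by_cases hzΩ : z ∈ Ω
  · rw [hK.exteriorClement_vertex_eq_zero hz hzΩ, abs_zero]
    positivity
  · rw [hK.exteriorClement_vertex hz hzΩ]
    obtain ⟨R, hR, -, -, h⟩ :=
      exists_radius_abs_l2Proj_sub_le hK hKΩ hd ho hreg hΩΛ hκ hsh hg hz hzΩ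
    have h0 := h 0
    rw [sub_zero] at h0
    exact h0.trans (mul_le_mul_of_nonneg_left (average_le_of_ae_le hM hg z hR) hC.le)

include hK hKΩ hd ho hreg hΩΛ hκ hsh hg in
theorem abs_exteriorClement_le {M : ℝ} (hM0 : 0 ≤ M) (hM : ∀ᵐ x, |g x| ≤ M) (x : E d) :
    |exteriorClement K Ω g x| ≤ stabilityConst d κ * M := by
  have hC := stabilityConst_pos (d := d) hκ
  have hv := hK.exteriorClement_mem Ω g
  by_cases hx : x ∈ Λ
  · obtain ⟨t, ht, hxt⟩ := hK.exists_element hx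
    have := Vh_abs_sub_le hv ht (a := 0) (M := stabilityConst d κ * M)
      (fun z hz => by
        rw [sub_zero]
        exact abs_exteriorClement_vertex_le hK hKΩ hd ho hreg hΩΛ hκ hsh hg hM0 hM
          (mem_vertices_of_mem ht hz)) hxt
    rwa [sub_zero] at this
  · rw [hv.2.2 x (by rwa [hK.space_eq]), abs_zero]
    positivity

/-- An element that contains a point deeper than h has all its vertices in Ω, where the nodal values
vanish. -/
theorem IsMesh.exteriorClement_eq_zero (hK : IsMesh K Λ) {x : E d}
    (hx : meshSize K < depth Ω x) : exteriorClement K Ω g x = 0 := by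
  have hv := hK.exteriorClement_mem Ω g
  by_cases hxΛ : x ∈ Λ
  · obtain ⟨t, ht, hxt⟩ := hK.exists_element hxΛ
    have := Vh_abs_sub_le hv ht (a := 0) (M := 0) (fun z hz => by
      rw [hK.exteriorClement_vertex_eq_zero (mem_vertices_of_mem ht hz)
        (mem_of_norm_lt_depth (x := x) (lt_of_le_of_lt ?_ hx)), sub_zero, abs_zero]
      exact (norm_sub_le_elementSize hxt (subset_simplex t hz)).trans
        (hK.elementSize_le_meshSize ht)) hxt
    simpa using this
  · exact hv.2.2 x (by rwa [hK.space_eq])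

theorem le_mul_min_one {a c q : ℝ} (hc : 0 ≤ c) (h1 : a ≤ c) (h2 : a ≤ c * q) :
    a ≤ c * min 1 q := by
  rw [mul_min_of_nonneg _ _ hc, mul_one]
  exact le_min h1 h2

include hK hKΩ hd ho hreg hΩΛ hκ hsh hg in
-- On an element the slope is at most N/r. If the interpolant is not zero there, some vertex is
-- outside Ω, so the diameter, and with it r up to κ, is at least the depth. The bound is therefore
-- uniform in the mesh although the slopes blow up at ∂Ω.
theorem abs_exteriorClement_sub_le (hb : Bornology.IsBounded Ω) {M : ℝ} (hM0 : 0 ≤ M)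
    (hM : ∀ᵐ x, |g x| ≤ M) {x : E d} (hx : x ∈ Ω) (y : E d) :
    |exteriorClement K Ω g x - exteriorClement K Ω g y| ≤
      4 * κ * (stabilityConst d κ * M) * min 1 (‖x - y‖ / depth Ω x) := by
  have hC := stabilityConst_pos (d := d) hκ
  set N := stabilityConst d κ * M with hN
  have hN0 : 0 ≤ N := by positivity
  set G := exteriorClement K Ω g with hG
  have hGV : G ∈ Vh K := hK.exteriorClement_mem Ω g
  have hbd : ∀ x, |G x| ≤ N := abs_exteriorClement_le hK hKΩ hd ho hreg hΩΛ hκ hsh hg hM0 hM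
  have hδ := depth_pos hd hb ho hx
  set δ := depth Ω x with hδdef
  have h2N : |G x - G y| ≤ 2 * N := by
    have h1 := abs_sub (G x) (G y)
    linarith [hbd x, hbd y]
  have h4 : 2 * N ≤ 4 * κ * N := by nlinarith
  refine le_mul_min_one (by positivity) (h2N.trans h4) ?_
  -- Along a shorter segment the depth stays above δ/2, so the slope bound 2κN/δ holds throughout.
  -- Otherwise the sup bound suffices.
  by_cases hxy : ‖x - y‖ < δ / 2
  · rw [abs_sub_comm]
    have hloc : ∀ z ∈ segment ℝ x y, ∀ᶠ y' in 𝓝 z, |G y' - G z| ≤ 2 * κ * N / δ * ‖y' - z‖ := by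
      intro z hz
      have hzx : ‖x - z‖ < δ / 2 := by
        have := segment_subset_ball hxy hz
        rwa [Metric.mem_ball, dist_comm, dist_eq_norm] at this
      have hzΩ : z ∈ Ω := mem_of_norm_lt_depth (x := x) (by rw [← hδdef]; linarith)
      have hzδ : δ / 2 ≤ depth Ω z := by
        have := (abs_le.1 (abs_depth_sub_le (Ω := Ω) x z)).2
        rw [← hδdef] at this
        linarith
      refine hK.eventually_Vh_lipschitz (hΩΛ (subset_closure hzΩ)) fun t ht hzt y' hy' => ?_
      by_cases hvert : ∃ z' ∈ t, z' ∉ Ω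
      · obtain ⟨z', hz't, hz'Ω⟩ := hvert
        obtain ⟨c, r, hr, hball, hTr⟩ := hsh t ht
        have h1 : |G y' - G z| ≤ N / r * ‖y' - z‖ :=
          Vh_lipschitz hGV ht hr hball (a := 0) (fun w _ => by rw [sub_zero]; exact hbd w) hy' hzt
        refine h1.trans (mul_le_mul_of_nonneg_right ?_ (norm_nonneg _))
        have h2 : δ ≤ 2 * κ * r := by
          have := (depth_le_norm_sub z hz'Ω).trans
            (norm_sub_le_elementSize hzt (subset_simplex t hz't))
          linarith
        rw [div_le_div_iff₀ hr hδ]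
        nlinarith
      · push Not at hvert
        have h0 : ∀ w ∈ simplex t, G w = 0 := fun w hw => by
          have := Vh_abs_sub_le hGV ht (a := 0) (M := 0) (fun z hz => by
            rw [hG, hK.exteriorClement_vertex_eq_zero (mem_vertices_of_mem ht hz) (hvert z hz)]
            simp) hw
          simpa using this
        rw [h0 y' hy', h0 z hzt, sub_zero, abs_zero]
        positivity
    refine (abs_sub_le_of_locally hloc).trans ?_
    rw [norm_sub_rev y x, div_mul_eq_mul_div, mul_div_assoc]
    have : 0 ≤ ‖x - y‖ / δ := by positivity
    have : 0 ≤ κ * N * (‖x - y‖ / δ) := by positivity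
    nlinarith
  · refine h2N.trans ?_
    have h5 : 1 / 2 ≤ ‖x - y‖ / δ := by rw [le_div_iff₀ hδ]; linarith
    have h6 : 0 ≤ κ * N := by positivity
    nlinarith

include hK hKΩ hd ho hreg hΩΛ hκ hsh hg in
-- All vertices z of an exterior element at y use a ball of radius R ≥ |z - y|, contained in the
-- ball of radius 2R about y. The volume ratio is the factor 2^d.
theorem abs_exteriorClement_sub_le_of_average {y : E d} (hy : y ∈ Λ) (hyΩ : y ∉ Ω) {ε η : ℝ}
    (hη : ∀ ρ, 0 < ρ → ρ < η → ⨍ x in Metric.closedBall y ρ, |g x - g y| ≤ ε)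
    (hmesh : 2 * meshSize K < η) :
    |exteriorClement K Ω g y - g y| ≤ stabilityConst d κ * (2 ^ d * ε) := by
  have hC := stabilityConst_pos (d := d) hκ
  obtain ⟨t, ht, hyt, htΩ⟩ := hK.exists_exterior_element hKΩ ho hreg hΩΛ hy hyΩ
  refine Vh_abs_sub_le (hK.exteriorClement_mem Ω g) ht (fun z hz => ?_) hyt
  have hzΩ : z ∉ Ω := htΩ (subset_simplex t hz)
  have hzK := mem_vertices_of_mem ht hz
  rw [hK.exteriorClement_vertex hzK hzΩ]
  obtain ⟨R, hR, hRK, hRt, h⟩ :=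
    exists_radius_abs_l2Proj_sub_le hK hKΩ hd ho hreg hΩΛ hκ hsh hg hzK hzΩ
  refine (h (g y)).trans (mul_le_mul_of_nonneg_left ?_ hC.le)
  have hav := hη (2 * R) (by positivity) (by linarith)
  have hyz : ‖z - y‖ ≤ R :=
    (norm_sub_le_elementSize (subset_simplex t hz) hyt).trans (hRt t ht hz htΩ)
  have hV := volume_real_closedBall_pos z hR
  have hV2 : volume.real (Metric.closedBall y (2 * R)) =
      2 ^ d * volume.real (Metric.closedBall z R) := by
    rw [volume_real_closedBall _ (by positivity), volume_real_closedBall _ hR.le, mul_pow, mul_assoc]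
  rw [setAverage_eq, smul_eq_mul, inv_mul_le_iff₀ (volume_real_closedBall_pos _ (by positivity)),
    hV2] at hav
  rw [setAverage_eq, smul_eq_mul, inv_mul_le_iff₀ hV]
  refine le_trans ?_ (hav.trans (le_of_eq (by ring)))
  refine setIntegral_mono_set ?_ (Eventually.of_forall fun x => abs_nonneg _)
    (LE.le.eventuallyLE ?_)
  · exact ((hg.integrableOn_isCompact (isCompact_closedBall _ _)).sub
      (continuousOn_const.integrableOn_compact (isCompact_closedBall _ _))).abs
  · refine Metric.closedBall_subset_closedBall' ?_
    rw [dist_eq_norm]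
    linarith

end clement


/-! ### Density of Lipschitz functions that vanish close to the complement -/

section cutoff
variable {d : ℕ} {s : ℝ} {Ω : Set (E d)} {u : E d → ℝ}

/-- A cut-off function, `0` where `k · dist(x, Ωᶜ) ≤ 1` and `1` where `k · dist(x, Ωᶜ) ≥ 2`. -/
noncomputable def cutoff (Ω : Set (E d)) (k : ℕ) (x : E d) : ℝ :=
  max 0 (min 1 (k * depth Ω x - 1))

theorem continuous_cutoff (k : ℕ) : Continuous (cutoff Ω k) := by
  unfold cutoff
  fun_prop

theorem cutoff_nonneg (k : ℕ) (x : E d) : 0 ≤ cutoff Ω k x := le_max_left _ _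

theorem cutoff_le_one (k : ℕ) (x : E d) : cutoff Ω k x ≤ 1 :=
  max_le zero_le_one (min_le_left _ _)

theorem cutoff_eq_zero {k : ℕ} {x : E d} (h : k * depth Ω x ≤ 1) : cutoff Ω k x = 0 :=
  max_eq_left ((min_le_right _ _).trans (by linarith))

theorem cutoff_eq_one {k : ℕ} {x : E d} (h : 2 ≤ k * depth Ω x) : cutoff Ω k x = 1 := by
  rw [cutoff, min_eq_left (by linarith), max_eq_right zero_le_one]

theorem abs_cutoff_sub_le (k : ℕ) (x y : E d) :
    |cutoff Ω k x - cutoff Ω k y| ≤ k * ‖x - y‖ := by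
  unfold cutoff
  have h1 : ∀ a b : ℝ, |max 0 (min 1 a) - max 0 (min 1 b)| ≤ |a - b| := fun a b => by
    refine (abs_max_sub_max_le_max _ _ _ _).trans ?_
    rw [sub_self, abs_zero]
    refine max_le (abs_nonneg _) ((abs_min_sub_min_le_max _ _ _ _).trans ?_)
    rw [sub_self, abs_zero]
    exact max_le (abs_nonneg _) le_rfl
  refine (h1 _ _).trans ?_
  rw [sub_sub_sub_cancel_right, ← mul_sub, abs_mul, Nat.abs_cast]
  gcongr
  exact abs_depth_sub_le x y

/-- The slope k is harmless where k · depth < 4. Where k · depth ≥ 4, a point closer than half the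
depth still has cut-off 1, so the difference vanishes. The bound does not depend on k. -/
theorem abs_cutoff_sub_le_min (hd : 1 ≤ d) (hb : Bornology.IsBounded Ω) (ho : IsOpen Ω) (k : ℕ)
    {x : E d} (hx : x ∈ Ω) (y : E d) :
    |cutoff Ω k x - cutoff Ω k y| ≤ 4 * min 1 (‖x - y‖ / depth Ω x) := by
  have hδ := depth_pos hd hb ho hx
  have h1 : |cutoff Ω k x - cutoff Ω k y| ≤ 1 := by
    rw [abs_le]
    constructor <;> linarith [cutoff_nonneg (Ω := Ω) k x, cutoff_nonneg (Ω := Ω) k y,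
      cutoff_le_one (Ω := Ω) k x, cutoff_le_one (Ω := Ω) k y]
  refine le_mul_min_one (by norm_num) (h1.trans (by norm_num)) ?_
  rw [← mul_div_assoc, le_div_iff₀ hδ]
  rcases lt_or_ge ((k : ℝ) * depth Ω x) 4 with hk | hk
  · calc |cutoff Ω k x - cutoff Ω k y| * depth Ω x ≤ k * ‖x - y‖ * depth Ω x := by
          gcongr; exact abs_cutoff_sub_le k x y
      _ = (k * depth Ω x) * ‖x - y‖ := by ring
      _ ≤ 4 * ‖x - y‖ := by gcongr
  · by_cases hxy : ‖x - y‖ < depth Ω x / 2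
    · have h2 := (abs_le.1 (abs_depth_sub_le (Ω := Ω) x y)).2
      have h3 : 2 ≤ (k : ℝ) * depth Ω y := by
        have : (k : ℝ) * (depth Ω x / 2) ≤ k * depth Ω y := by gcongr; linarith
        linarith
      rw [cutoff_eq_one (by linarith : 2 ≤ (k : ℝ) * depth Ω x), cutoff_eq_one h3]
      simp
    · calc |cutoff Ω k x - cutoff Ω k y| * depth Ω x ≤ 1 * depth Ω x := by gcongr
        _ ≤ 4 * ‖x - y‖ := by linarith

/-- By the product rule the error is dominated by the differences of u itself plus |u| times those
of the cut-off; the second part is what requires the weighted integrability of u. -/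
theorem tendsto_seminorm_cutoff (hd : 1 ≤ d) (hs₀ : 0 < s) (hs₁ : s < 1 / 2)
    (hb : Bornology.IsBounded Ω) (ho : IsOpen Ω) (hum : Measurable u) (hu0 : ∀ x ∉ Ω, u x = 0)
    (hu : seminorm s (Ω ×ˢ univ) u < ∞)
    (hui : ∫⁻ x in Ω, ENNReal.ofReal (|u x| * depth Ω x ^ (-(2 * s))) < ∞) :
    Tendsto (fun k : ℕ => seminorm s (Q Ω) (fun x => u x * cutoff Ω k x - u x)) atTop (𝓝 0) := by
  refine tendsto_seminorm_zero_of_dominated hd hs₀ hs₁ hb ho hum.aemeasurable hu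
    (w := fun x => 4 * |u x|) ?_ (fun x => by positivity) ?_ ?_ ?_ ?_
  · exact (measurable_const.mul hum.abs).aemeasurable
  · have : ∀ x, ENNReal.ofReal (4 * |u x| * depth Ω x ^ (-(2 * s))) =
        4 * ENNReal.ofReal (|u x| * depth Ω x ^ (-(2 * s))) := fun x => by
      rw [mul_assoc, ENNReal.ofReal_mul (by norm_num)]
      simp
    simp_rw [this]
    rw [lintegral_const_mul' _ _ (by simp)]
    exact ENNReal.mul_lt_top (by simp) hui
  · refine Eventually.of_forall fun k => Measurable.aemeasurable ?_
    exact (hum.mul (continuous_cutoff k).measurable).sub hum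
  · refine Eventually.of_forall fun k => Eventually.of_forall fun ⟨x, y⟩ hx => ?_
    simp only at hx ⊢
    have e : u x * cutoff Ω k x - u x - (u y * cutoff Ω k y - u y) =
        -((u x - u y) * (1 - cutoff Ω k y)) + u x * (cutoff Ω k x - cutoff Ω k y) := by ring
    rw [e]
    refine (abs_add_le _ _).trans (add_le_add ?_ ?_)
    · rw [abs_neg, abs_mul]
      refine mul_le_of_le_one_right (abs_nonneg _) ?_
      rw [abs_le]
      constructor <;> linarith [cutoff_nonneg (Ω := Ω) k y, cutoff_le_one (Ω := Ω) k y]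
    · rw [abs_mul, mul_comm (4 : ℝ), mul_assoc]
      gcongr
      exact abs_cutoff_sub_le_min hd hb ho k hx y
  · refine Eventually.of_forall fun x => ?_
    by_cases hx : x ∈ Ω
    · have hδ := depth_pos hd hb ho hx
      refine tendsto_const_nhds.congr' ?_
      have h1 : Tendsto (fun k : ℕ => (k : ℝ) * depth Ω x) atTop atTop :=
        tendsto_natCast_atTop_atTop.atTop_mul_const hδ
      filter_upwards [h1.eventually_ge_atTop 2] with k hk
      rw [cutoff_eq_one hk, mul_one, sub_self]
    · simp [hu0 x hx]

end cutoff

/-! ### Mollification by continuity of diagonal translations in L¹ -/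

section mollify
variable {d : ℕ} {s : ℝ} {f : E d → ℝ}

theorem tendsto_lintegral_translate_sub {H : E d × E d → ℝ} (hH : MemLp H 1) :
    Tendsto (fun z : E d => ∫⁻ p, ‖H (p - (z, z)) - H p‖ₑ) (𝓝 0) (𝓝 0) := by
  let T : E d → C(E d × E d, E d × E d) := fun z => ⟨fun p => p - (z, z), by fun_prop⟩
  have : (volume : Measure (E d × E d)).IsAddRightInvariant := by
    rw [Measure.volume_eq_prod]; infer_instance
  have hT : ∀ z, MeasurePreserving (T z) (volume : Measure (E d × E d)) volume := fun z =>
    measurePreserving_sub_right volume (z, z)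
  have hTc : Continuous T := by
    refine ContinuousMap.continuous_of_continuous_uncurry _ ?_
    simp only [T, Function.uncurry_def, ContinuousMap.coe_mk]
    fun_prop
  have h := ((continuous_const (y := hH.toLp H)).compMeasurePreservingLp hTc hT
    ENNReal.one_ne_top).tendsto 0
  rw [tendsto_iff_edist_tendsto_0] at h
  have e : ∀ z, edist (Lp.compMeasurePreserving (T z) (hT z) (hH.toLp H))
      (Lp.compMeasurePreserving (T 0) (hT 0) (hH.toLp H)) =
      ∫⁻ p, ‖H (p - (z, z)) - H p‖ₑ := fun z => by
    rw [Lp.toLp_compMeasurePreserving, Lp.toLp_compMeasurePreserving, Lp.edist_toLp_toLp,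
      eLpNorm_one_eq_lintegral_enorm]
    refine lintegral_congr fun p => ?_
    simp only [T, ContinuousMap.coe_mk, Pi.sub_apply, Function.comp_apply]
    congr 3
    exact sub_zero p
  simpa only [e] using h

/-- The convolution of `f` with the kernel `ψ`. -/
noncomputable def mollify (ψ f : E d → ℝ) (x : E d) : ℝ := ∫ z, ψ z * f (x - z)

theorem mollify_eq (ψ f : E d → ℝ) (x : E d) : mollify ψ f x = ∫ z, ψ (x - z) * f z := by
  rw [mollify, ← integral_sub_left_eq_self _ volume x]
  simp

/-- Since |x - y| is invariant under diagonal shifts, the weighted difference quotient of the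
mollification is the ψ-average of diagonal translates of that of f. The seminorm of the error is
then at most the average L¹ translation error. -/
theorem seminorm_mollify_sub_le {ψ : E d → ℝ} (hψm : Continuous ψ) (hψ0 : ∀ x, 0 ≤ ψ x)
    (hψi : Integrable ψ) (hψ1 : ∫ x, ψ x = 1) (hψb : ∃ M, ∀ x, |ψ x| ≤ M) (hfm : Measurable f)
    (hfi : Integrable f) {ε : ℝ≥0∞}
    (hε : ∀ z, ψ z ≠ 0 → ∫⁻ p : E d × E d, ‖(f (p - (z, z)).1 - f (p - (z, z)).2) /
      ‖(p - (z, z)).1 - (p - (z, z)).2‖ ^ ((d : ℝ) + 2 * s) -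
        (f p.1 - f p.2) / ‖p.1 - p.2‖ ^ ((d : ℝ) + 2 * s)‖ₑ ≤ ε) (A : Set (E d × E d)) :
    seminorm s A (mollify ψ f - f) ≤ ε := by
  obtain ⟨M, hM⟩ := hψb
  set H : E d × E d → ℝ := fun p => (f p.1 - f p.2) / ‖p.1 - p.2‖ ^ ((d : ℝ) + 2 * s) with hH
  have hHm : Measurable H := by
    refine Measurable.div ?_ (measurable_norm_sub_rpow _)
    exact (hfm.comp measurable_fst).sub (hfm.comp measurable_snd)
  have hint : ∀ x, Integrable fun z => ψ z * f (x - z) := fun x =>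
    (hfi.comp_sub_left x).bdd_mul hψm.aestronglyMeasurable (Eventually.of_forall hM)
  have hx : ∀ x, mollify ψ f x - f x = ∫ z, ψ z * (f (x - z) - f x) := fun x => by
    simp_rw [mul_sub]
    rw [integral_sub (hint x) (hψi.mul_const _), integral_mul_const, hψ1, one_mul, mollify]
  have hint' : ∀ x, Integrable fun z => ψ z * (f (x - z) - f x) := fun x => by
    simp_rw [mul_sub]
    exact (hint x).sub (hψi.mul_const _)
  have hpt : ∀ p : E d × E d, ENNReal.ofReal (|(mollify ψ f - f) p.1 - (mollify ψ f - f) p.2| /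
      ‖p.1 - p.2‖ ^ ((d : ℝ) + 2 * s)) ≤
      ∫⁻ z, ENNReal.ofReal (ψ z) * ‖H (p - (z, z)) - H p‖ₑ := by
    rintro ⟨x, y⟩
    simp only [Pi.sub_apply]
    have e1 : |mollify ψ f x - f x - (mollify ψ f y - f y)| / ‖x - y‖ ^ ((d : ℝ) + 2 * s) =
        ‖∫ z, ψ z * (H ((x, y) - (z, z)) - H (x, y))‖ := by
      rw [hx, hx, ← integral_sub (hint' x) (hint' y), ← Real.norm_eq_abs,
        ← Real.norm_of_nonneg (Real.rpow_nonneg (norm_nonneg (x - y)) _), ← norm_div,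
        ← integral_div]
      congr 2
      ext z
      simp only [hH, Prod.mk_sub_mk, sub_sub_sub_cancel_right]
      ring
    rw [e1, ofReal_norm]
    refine (enorm_integral_le_lintegral_enorm _).trans (lintegral_mono fun z => ?_)
    rw [enorm_mul, Real.enorm_of_nonneg (hψ0 z)]
  calc seminorm s A (mollify ψ f - f)
      ≤ ∫⁻ p : E d × E d, ∫⁻ z, ENNReal.ofReal (ψ z) * ‖H (p - (z, z)) - H p‖ₑ :=
        (setLIntegral_le_lintegral _ _).trans (lintegral_mono hpt)
    _ = ∫⁻ z, ∫⁻ p : E d × E d, ENNReal.ofReal (ψ z) * ‖H (p - (z, z)) - H p‖ₑ := by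
        refine lintegral_lintegral_swap (Measurable.aemeasurable ?_)
        refine ((hψm.measurable.comp measurable_snd).ennreal_ofReal).mul (Measurable.enorm ?_)
        refine (hHm.comp ?_).sub (hHm.comp measurable_fst)
        fun_prop
    _ = ∫⁻ z, ENNReal.ofReal (ψ z) * ∫⁻ p : E d × E d, ‖H (p - (z, z)) - H p‖ₑ := by
        refine lintegral_congr fun z => lintegral_const_mul' _ _ (by simp)
    _ ≤ ∫⁻ z, ENNReal.ofReal (ψ z) * ε := by
        refine lintegral_mono fun z => ?_
        by_cases hz : ψ z = 0
        · simp [hz]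
        · exact mul_le_mul_right (hε z hz) _
    _ = ε := by
        rw [lintegral_mul_const _ hψm.measurable.ennreal_ofReal,
          ← ofReal_integral_eq_lintegral_ofReal hψi (Eventually.of_forall hψ0), hψ1,
          ENNReal.ofReal_one, one_mul]

theorem exists_lipschitz_mollify (hfm : Measurable f) (hfi : Integrable f)
    (hf : seminorm s univ f < ∞) {ρ : ℝ} (hρ : 0 < ρ) {ε : ℝ≥0∞} (hε : 0 < ε) :
    ∃ φ : E d → ℝ, (∃ L, 0 ≤ L ∧ ∀ x y, |φ x - φ y| ≤ L * ‖x - y‖) ∧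
      (∀ x, (∀ z, ‖x - z‖ < ρ → f z = 0) → φ x = 0) ∧
      ∀ A, seminorm s A (φ - f) ≤ ε := by
  set H : E d × E d → ℝ := fun p => (f p.1 - f p.2) / ‖p.1 - p.2‖ ^ ((d : ℝ) + 2 * s) with hH
  have hHL : MemLp H 1 := by
    rw [memLp_one_iff_integrable]
    refine ⟨(aemeasurable_quotient hfm.aemeasurable _).aestronglyMeasurable, ?_⟩
    rw [hasFiniteIntegral_iff_norm]
    rw [seminorm, setLIntegral_univ] at hf
    refine lt_of_eq_of_lt (lintegral_congr fun p => ?_) hf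
    rw [Real.norm_eq_abs, hH, abs_div, abs_of_nonneg (Real.rpow_nonneg (norm_nonneg _) _)]
  have hev := (tendsto_lintegral_translate_sub hHL).eventually (ge_mem_nhds hε)
  obtain ⟨r, hr, hball⟩ := Metric.eventually_nhds_iff.1 hev
  -- The radius r controls the translation error, and ρ controls the spread of the support.
  set r' := min r ρ with hr'
  have hr'0 : 0 < r' := lt_min hr hρ
  let b : ContDiffBump (0 : E d) := ⟨r' / 2, r', by positivity, by linarith⟩
  set ψ : E d → ℝ := b.normed volume with hψ
  have hψc : Continuous ψ := b.continuous_normed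
  have hcs : HasCompactSupport ψ := b.hasCompactSupport_normed
  have hsupp : ∀ z, ψ z ≠ 0 → ‖z‖ < r' := fun z hz => by
    have : z ∈ Function.support ψ := hz
    rw [hψ, b.support_normed_eq] at this
    simpa using this
  obtain ⟨M, hM⟩ := hcs.exists_bound_of_continuous hψc
  obtain ⟨C, hC⟩ := ContDiff.lipschitzWith_of_hasCompactSupport (𝕂 := ℝ) (n := 1) hcs
    (b.contDiff_normed (n := 1)) one_ne_zero
  refine ⟨mollify ψ f, ⟨C * ∫ z, |f z|, by positivity, fun x y => ?_⟩, fun x hx => ?_, fun A => ?_⟩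
  · have hint : ∀ x, Integrable fun z => ψ (x - z) * f z := fun x =>
      hfi.bdd_mul (by fun_prop) (Eventually.of_forall fun z => hM _)
    rw [mollify_eq, mollify_eq, ← integral_sub (hint x) (hint y), ← Real.norm_eq_abs]
    have hle : ∀ z, ‖ψ (x - z) * f z - ψ (y - z) * f z‖ ≤ C * ‖x - y‖ * |f z| := fun z => by
      rw [← sub_mul, norm_mul]
      have := hC.dist_le_mul (x - z) (y - z)
      rw [dist_sub_right, dist_eq_norm, dist_eq_norm] at this
      exact mul_le_mul_of_nonneg_right this (abs_nonneg _)
    refine (norm_integral_le_of_norm_le (hfi.abs.const_mul _) (Eventually.of_forall hle)).trans ?_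
    rw [integral_const_mul]
    exact le_of_eq (by ring)
  · rw [mollify]
    refine integral_eq_zero_of_ae (Eventually.of_forall fun z => ?_)
    by_cases hz : ψ z = 0
    · simp [hz]
    · have := hx (x - z) (by
        rw [sub_sub_cancel]
        exact (hsupp z hz).trans_le (min_le_right _ _))
      simp [this]
  · refine seminorm_mollify_sub_le hψc b.nonneg_normed b.integrable_normed b.integral_normed
      ⟨M, hM⟩ hfm hfi (fun z hz => ?_) A
    exact hball (by
      rw [dist_zero_right]
      exact (hsupp z hz).trans_le (min_le_left _ _))

end mollify

/-! ### Cut-off followed by mollification -/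

section density
variable {d : ℕ} {s : ℝ} {Ω : Set (E d)} {u : E d → ℝ}

theorem seminorm_univ_le (hu0 : ∀ x ∉ Ω, u x = 0) (ho : IsOpen Ω) :
    seminorm s univ u ≤ seminorm s (Q Ω) u := by
  have hQ : MeasurableSet (Q Ω) :=
    (ho.measurableSet.compl.prod ho.measurableSet.compl).compl
  unfold seminorm
  rw [setLIntegral_univ, ← lintegral_add_compl _ hQ]
  refine le_of_eq ?_
  rw [setLIntegral_congr_fun (g := fun _ => 0) hQ.compl fun p hp => ?_]
  · simp
  · rw [Q, compl_compl] at hp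
    simp [hu0 p.1 hp.1, hu0 p.2 hp.2]

/-- Functions in the energy space that vanish outside `Ω` are limits of Lipschitz functions
with support in the interior of `Ω`. -/
theorem exists_lipschitz_approx (hd : 1 ≤ d) (hs₀ : 0 < s) (hs₁ : s < 1 / 2)
    (hb : Bornology.IsBounded Ω) (ho : IsOpen Ω) (hum : Measurable u) (hu0 : ∀ x ∉ Ω, u x = 0)
    (hui : Integrable u) (hu : seminorm s (Ω ×ˢ univ) u < ∞)
    (huw : ∫⁻ x in Ω, ENNReal.ofReal (|u x| * depth Ω x ^ (-(2 * s))) < ∞) {ε : ℝ≥0∞}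
    (hε : 0 < ε) :
    ∃ φ : E d → ℝ, (∃ L, 0 ≤ L ∧ ∀ x y, |φ x - φ y| ≤ L * ‖x - y‖) ∧
      (∃ ρ > 0, ∀ x, depth Ω x ≤ ρ → φ x = 0) ∧ seminorm s (Q Ω) (φ - u) ≤ ε := by
  have hε2 : 0 < ε / 2 := ENNReal.half_pos hε.ne'
  have hcut := tendsto_seminorm_cutoff hd hs₀ hs₁ hb ho hum hu0 hu huw
  -- The bound 1 keeps the seminorm of the cut-off function finite even when ε = ∞.
  have hε' : 0 < min (ε / 2) 1 := lt_min hε2 one_pos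
  obtain ⟨k, hk, hk0⟩ := ((hcut.eventually (ge_mem_nhds hε')).and (eventually_gt_atTop 0)).exists
  have hk0' : (0 : ℝ) < k := by exact_mod_cast hk0
  set f : E d → ℝ := fun x => u x * cutoff Ω k x with hf
  have hfm : Measurable f := hum.mul (continuous_cutoff k).measurable
  have hfi : Integrable f := by
    refine hui.mono hfm.aestronglyMeasurable (Eventually.of_forall fun x => ?_)
    rw [hf, norm_mul]
    refine mul_le_of_le_one_right (norm_nonneg _) ?_
    rw [Real.norm_of_nonneg (cutoff_nonneg _ _)]
    exact cutoff_le_one _ _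
  have hfu : seminorm s (Q Ω) (f - u) ≤ min (ε / 2) 1 := hk
  have hfQ : seminorm s (Q Ω) f < ∞ := by
    have : f = u + (f - u) := by abel
    rw [this]
    refine (seminorm_add_le hum.aemeasurable).trans_lt (ENNReal.add_lt_top.2 ⟨?_, ?_⟩)
    · exact (seminorm_Q_le u).trans_lt (ENNReal.mul_lt_top (by simp) hu)
    · exact (hfu.trans (min_le_right _ _)).trans_lt ENNReal.one_lt_top
  have hfuniv : seminorm s univ f < ∞ :=
    (seminorm_univ_le (fun x hx => by rw [hf]; simp [hu0 x hx]) ho).trans_lt hfQ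
  obtain ⟨φ, hL, hφ0, hφ⟩ := exists_lipschitz_mollify hfm hfi hfuniv
    -- The cut-off function vanishes up to depth 1/k, so mollifying at half that scale preserves a
    -- layer of zeros of width 1/(2k).
    (ρ := 1 / (2 * k)) (by positivity) hε2
  refine ⟨φ, hL, ⟨1 / (2 * k), by positivity, fun x hx => hφ0 x fun z hz => ?_⟩, ?_⟩
  · have h1 := (abs_le.1 (abs_depth_sub_le (Ω := Ω) x z)).1
    have h2 : depth Ω z ≤ 1 / (2 * k) + 1 / (2 * k) := by linarith
    have h3 : (k : ℝ) * depth Ω z ≤ 1 := by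
      calc (k : ℝ) * depth Ω z ≤ k * (1 / (2 * k) + 1 / (2 * k)) := by gcongr
        _ = 1 := by field_simp; norm_num
    rw [hf]
    simp [cutoff_eq_zero h3]
  · have e : φ - u = (f - u) + (φ - f) := by abel
    rw [e]
    refine (seminorm_add_le (hfm.sub hum).aemeasurable).trans ?_
    calc _ ≤ ε / 2 + ε / 2 := add_le_add (hfu.trans (min_le_left _ _)) (hφ _)
      _ = ε := ENNReal.add_halves ε

end density


/-! ### Functions with a uniform bound on difference quotients -/

section uniform
variable {d : ℕ} {s : ℝ} {Ω : Set (E d)}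

theorem seminorm_zero {A : Set (E d × E d)} : seminorm s A (0 : E d → ℝ) = 0 := by
  simp [seminorm]

theorem lintegral_const_mul_depth_lt_top
    (hdep : ∫⁻ x in Ω, ENNReal.ofReal (depth Ω x ^ (-(2 * s))) < ∞) {N : ℝ} (hN : 0 ≤ N) :
    ∫⁻ x in Ω, ENNReal.ofReal (N * depth Ω x ^ (-(2 * s))) < ∞ := by
  simp_rw [ENNReal.ofReal_mul hN]
  rw [lintegral_const_mul' _ _ (by simp)]
  exact ENNReal.mul_lt_top (by simp) hdep

theorem seminorm_lt_top_of_le_min (hd : 1 ≤ d) (hs₀ : 0 < s) (hs₁ : s < 1 / 2)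
    (hb : Bornology.IsBounded Ω) (ho : IsOpen Ω)
    (hdep : ∫⁻ x in Ω, ENNReal.ofReal (depth Ω x ^ (-(2 * s))) < ∞) {N : ℝ} (hN : 0 ≤ N)
    {v : E d → ℝ} (hv : ∀ᵐ p : E d × E d, p.1 ∈ Ω → |v p.1 - v p.2| ≤
      N * min 1 (‖p.1 - p.2‖ / depth Ω p.1)) : seminorm s (Q Ω) v < ∞ := by
  refine seminorm_lt_top_of_dominated hd hs₀ hs₁ hb ho (U := 0) (w := fun _ => N)
    aemeasurable_const (by rw [seminorm_zero]; simp) aemeasurable_const (fun _ => hN)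
    (lintegral_const_mul_depth_lt_top hdep hN) ?_
  simpa using hv

theorem tendsto_seminorm_zero_of_le_min (hd : 1 ≤ d) (hs₀ : 0 < s) (hs₁ : s < 1 / 2)
    (hb : Bornology.IsBounded Ω) (ho : IsOpen Ω)
    (hdep : ∫⁻ x in Ω, ENNReal.ofReal (depth Ω x ^ (-(2 * s))) < ∞) {N : ℝ} (hN : 0 ≤ N)
    {ι : Type*} {l : Filter ι} [l.IsCountablyGenerated] {v : ι → E d → ℝ}
    (hvm : ∀ᶠ i in l, AEMeasurable (v i))
    (hv : ∀ᶠ i in l, ∀ᵐ p : E d × E d, p.1 ∈ Ω → |v i p.1 - v i p.2| ≤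
      N * min 1 (‖p.1 - p.2‖ / depth Ω p.1))
    (hlim : ∀ᵐ x, Tendsto (fun i => v i x) l (𝓝 0)) :
    Tendsto (fun i => seminorm s (Q Ω) (v i)) l (𝓝 0) := by
  refine tendsto_seminorm_zero_of_dominated hd hs₀ hs₁ hb ho (U := 0) (w := fun _ => N)
    aemeasurable_const (by rw [seminorm_zero]; simp) aemeasurable_const (fun _ => hN)
    (lintegral_const_mul_depth_lt_top hdep hN) hvm ?_ hlim
  simpa using hv

theorem min_one_eq_of_notMem (hd : 1 ≤ d) (hb : Bornology.IsBounded Ω) (ho : IsOpen Ω) {x y : E d}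
    (hx : x ∈ Ω) (hy : y ∉ Ω) : min 1 (‖x - y‖ / depth Ω x) = 1 := by
  have hδ := depth_pos hd hb ho hx
  rw [min_eq_left_iff, le_div_iff₀ hδ, one_mul]
  exact depth_le_norm_sub x hy

/-- The Lipschitz bound is needed only for y closer than the depth, where the segment stays in Ω; a
jump across ∂Ω is absorbed by the sup bound. -/
theorem abs_sub_le_min_of_lipschitz (hd : 1 ≤ d) (hb : Bornology.IsBounded Ω) (ho : IsOpen Ω)
    {v : E d → ℝ} {M L D : ℝ} (hL : 0 ≤ L) (hD : ∀ x ∈ Ω, depth Ω x ≤ D)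
    (hM : ∀ x, |v x| ≤ M) {x y : E d} (hx : x ∈ Ω)
    (hv : ‖x - y‖ < depth Ω x → |v x - v y| ≤ L * ‖x - y‖) :
    |v x - v y| ≤ (2 * M + L * D) * min 1 (‖x - y‖ / depth Ω x) := by
  have hδ := depth_pos hd hb ho hx
  have hD0 : 0 ≤ D := hδ.le.trans (hD x hx)
  have hM0 : 0 ≤ M := (abs_nonneg _).trans (hM x)
  have h2 : |v x - v y| ≤ 2 * M := by linarith [abs_sub (v x) (v y), hM x, hM y]
  refine le_mul_min_one (by positivity) (h2.trans (by linarith [mul_nonneg hL hD0])) ?_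
  have hq : 0 ≤ ‖x - y‖ / depth Ω x := by positivity
  by_cases hxy : ‖x - y‖ < depth Ω x
  · refine (hv hxy).trans ?_
    have h3 : ‖x - y‖ ≤ D * (‖x - y‖ / depth Ω x) := by
      rw [mul_div_assoc', le_div_iff₀ hδ, mul_comm]
      exact mul_le_mul_of_nonneg_right (hD x hx) (norm_nonneg _)
    calc L * ‖x - y‖ ≤ L * (D * (‖x - y‖ / depth Ω x)) := by gcongr
      _ ≤ _ := by nlinarith [mul_nonneg hM0 hq]
  · have h3 : 1 ≤ ‖x - y‖ / depth Ω x := by rw [le_div_iff₀ hδ]; linarith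
    nlinarith [mul_nonneg hL hD0]

end uniform

/-! ### Discrete functions -/

section discrete
variable {d : ℕ} {s : ℝ} {K : Complex d} {Ω Λ : Set (E d)} {κ : ℝ} {g v : E d → ℝ}

theorem segment_subset_of_norm_lt_depth {x y : E d} (hxy : ‖x - y‖ < depth Ω x) :
    segment ℝ x y ⊆ Ω := fun z hz => by
  have := segment_subset_ball hxy hz
  rw [Metric.mem_ball, dist_comm, dist_eq_norm] at this
  exact mem_of_norm_lt_depth this

theorem IsMesh.exists_lipschitz_Vh (hK : IsMesh K Λ) (hsh : IsShapeRegular κ K) (hv : v ∈ Vh K) :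
    ∃ L, 0 ≤ L ∧ ∀ t ∈ elements K, ∀ x ∈ simplex t, ∀ y ∈ simplex t,
      |v x - v y| ≤ L * ‖x - y‖ := by
  obtain ⟨M, hM0, hM⟩ := hK.exists_bound_Vh hv
  have hsh' : ∀ t ∈ elements K, ∃ r : ℝ, ∃ c : E d, 0 < r ∧ Metric.closedBall c r ⊆ simplex t :=
    fun t ht => by
      obtain ⟨c, r, hr, hball, -⟩ := hsh t ht
      exact ⟨r, c, hr, hball⟩
  choose! r c hr hball using hsh'
  obtain ⟨L, hL1, hL⟩ := exists_ge_one_forall_le_of_finite hK.finite_elements fun t => M / r t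
  refine ⟨L, by linarith, fun t ht x hx y hy => ?_⟩
  refine (Vh_lipschitz hv ht (hr t ht) (hball t ht) (a := 0)
    (fun z _ => by rw [sub_zero]; exact hM z) hx hy).trans ?_
  exact mul_le_mul_of_nonneg_right (hL t ht) (norm_nonneg _)

theorem IsMesh.seminorm_Vh_lt_top (hK : IsMesh K Λ) (hd : 1 ≤ d) (hs₀ : 0 < s) (hs₁ : s < 1 / 2)
    (hb : Bornology.IsBounded Ω) (ho : IsOpen Ω) (hΩΛ : closure Ω ⊆ interior Λ)
    (hsh : IsShapeRegular κ K)
    (hdep : ∫⁻ x in Ω, ENNReal.ofReal (depth Ω x ^ (-(2 * s))) < ∞) (hv : v ∈ Vh K) :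
    seminorm s (Q Ω) v < ∞ := by
  obtain ⟨L, hL0, hL⟩ := hK.exists_lipschitz_Vh hsh hv
  obtain ⟨M, hM0, hM⟩ := hK.exists_bound_Vh hv
  obtain ⟨D, hD1, hD⟩ := exists_depth_le hd hb
  refine seminorm_lt_top_of_le_min hd hs₀ hs₁ hb ho hdep (N := 2 * M + L * D) (by positivity)
    (Eventually.of_forall fun ⟨x, y⟩ hx => ?_)
  refine abs_sub_le_min_of_lipschitz hd hb ho hL0 hD hM hx fun hxy => ?_
  simp only at hxy ⊢
  rw [abs_sub_comm, norm_sub_rev]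
  refine abs_sub_le_of_locally fun z hz => ?_
  exact hK.eventually_Vh_lipschitz
    (hΩΛ (subset_closure (segment_subset_of_norm_lt_depth hxy hz)))
    fun t ht hzt y hy => hL t ht y hy z hzt

/-- The Lagrange interpolant of `φ`. -/
noncomputable def lagrange (K : Complex d) (φ : E d → ℝ) (x : E d) : ℝ :=
  ∑ᶠ z ∈ K.vertices, φ z * hat K z x

theorem IsMesh.lagrange_mem (hK : IsMesh K Λ) (φ : E d → ℝ) : lagrange K φ ∈ Vh K :=
  hK.nodal_sum_mem hK.finite_vertices _

theorem IsMesh.lagrange_vertex (hK : IsMesh K Λ) (φ : E d → ℝ) {z : E d} (hz : z ∈ K.vertices) :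
    lagrange K φ z = φ z := by
  have := hK.nodal_sum_apply hK.finite_vertices φ hz
  rwa [if_pos hz] at this

variable {φ : E d → ℝ} {L ρ : ℝ}

theorem IsMesh.abs_lagrange_sub_le (hK : IsMesh K Λ) (hL : 0 ≤ L)
    (hφ : ∀ x y, |φ x - φ y| ≤ L * ‖x - y‖) (hφΛ : ∀ x ∉ Λ, φ x = 0)
    (hh : 0 ≤ meshSize K) (x : E d) : |lagrange K φ x - φ x| ≤ L * meshSize K := by
  have hv := hK.lagrange_mem φ
  by_cases hx : x ∈ Λ
  · obtain ⟨t, ht, hxt⟩ := hK.exists_element hx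
    refine Vh_abs_sub_le hv ht (fun z hz => ?_) hxt
    rw [hK.lagrange_vertex φ (mem_vertices_of_mem ht hz)]
    refine (hφ z x).trans ?_
    gcongr
    exact (norm_sub_le_elementSize (subset_simplex t hz) hxt).trans
      (hK.elementSize_le_meshSize ht)
  · rw [hv.2.2 x (by rwa [hK.space_eq]), hφΛ x hx, sub_zero, abs_zero]
    positivity

theorem IsMesh.lagrange_eq_zero (hK : IsMesh K Λ) (hφ : ∀ x, depth Ω x ≤ ρ → φ x = 0)
    (hh : meshSize K ≤ ρ) {x : E d} (hx : x ∉ Ω) : lagrange K φ x = 0 := by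
  have hv := hK.lagrange_mem φ
  by_cases hxΛ : x ∈ Λ
  · obtain ⟨t, ht, hxt⟩ := hK.exists_element hxΛ
    have := Vh_abs_sub_le hv ht (a := 0) (M := 0) (fun z hz => by
      rw [hK.lagrange_vertex φ (mem_vertices_of_mem ht hz), hφ z, sub_zero, abs_zero]
      exact (depth_le_norm_sub z hx).trans ((norm_sub_le_elementSize (subset_simplex t hz) hxt).trans
        ((hK.elementSize_le_meshSize ht).trans hh))) hxt
    simpa using this
  · exact hv.2.2 x (by rwa [hK.space_eq])

/-- On an element, nodal values of φ differ from a value of φ there by at most L times the diameter,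
so shape regularity bounds the slope by Lκ, uniformly in the mesh. -/
theorem IsMesh.abs_lagrange_sub_lagrange_le (hK : IsMesh K Λ) (hΩΛ : closure Ω ⊆ interior Λ)
    (hsh : IsShapeRegular κ K) (hL : 0 ≤ L) (hφ : ∀ x y, |φ x - φ y| ≤ L * ‖x - y‖) {x y : E d}
    (hxy : ‖x - y‖ < depth Ω x) :
    |lagrange K φ x - lagrange K φ y| ≤ L * κ * ‖x - y‖ := by
  have hv := hK.lagrange_mem φ
  rw [abs_sub_comm, norm_sub_rev]
  refine abs_sub_le_of_locally fun z hz => ?_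
  refine hK.eventually_Vh_lipschitz
    (hΩΛ (subset_closure (segment_subset_of_norm_lt_depth hxy hz))) fun t ht hzt y hy => ?_
  obtain ⟨c, r, hr, hball, hTr⟩ := hsh t ht
  refine (Vh_lipschitz hv ht hr hball (a := φ z) (M := L * elementSize t) (fun w hw => ?_)
    hy hzt).trans (mul_le_mul_of_nonneg_right ?_ (norm_nonneg _))
  · rw [hK.lagrange_vertex φ (mem_vertices_of_mem ht hw)]
    refine (hφ w z).trans ?_
    gcongr
    exact norm_sub_le_elementSize (subset_simplex t hw) hzt
  · rw [div_le_iff₀ hr, mul_assoc]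
    gcongr

theorem meshSize_nonneg (K : Complex d) : 0 ≤ meshSize K := by
  refine Real.sSup_nonneg ?_
  rintro _ ⟨t, -, rfl⟩
  exact Metric.diam_nonneg

/-! ### Convergence of interpolants as the mesh size tends to zero -/

variable {ι : Type*} {mesh : ι → Complex d}

theorem eventually_meshSize_lt (mesh : ι → Complex d) {ε : ℝ} (hε : 0 < ε) :
    ∀ᶠ i in comap (fun i => meshSize (mesh i)) (𝓝 0), meshSize (mesh i) < ε :=
  tendsto_comap.eventually (gt_mem_nhds hε)

theorem tendsto_seminorm_lagrange_sub (hmesh : ∀ i, IsMesh (mesh i) Λ) (hd : 1 ≤ d) (hs₀ : 0 < s)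
    (hs₁ : s < 1 / 2) (hb : Bornology.IsBounded Ω) (ho : IsOpen Ω)
    (hΩΛ : closure Ω ⊆ interior Λ) (hκ : 1 ≤ κ) (hsh : ∀ i, IsShapeRegular κ (mesh i))
    (hdep : ∫⁻ x in Ω, ENNReal.ofReal (depth Ω x ^ (-(2 * s))) < ∞)
    (hL : 0 ≤ L) (hφ : ∀ x y, |φ x - φ y| ≤ L * ‖x - y‖) (hρ : 0 < ρ)
    (hφρ : ∀ x, depth Ω x ≤ ρ → φ x = 0) :
    Tendsto (fun i => seminorm s (Q Ω) (lagrange (mesh i) φ - φ))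
      (comap (fun i => meshSize (mesh i)) (𝓝 0)) (𝓝 0) := by
  have hφΛ : ∀ x ∉ Λ, φ x = 0 := fun x hx => hφρ x (by
    rw [depth_eq_zero fun h => hx (interior_subset (hΩΛ (subset_closure h)))]
    exact hρ.le)
  have hφc : Continuous φ := by
    refine LipschitzWith.continuous (K := ⟨L, hL⟩) (LipschitzWith.of_dist_le_mul fun x y => ?_)
    rw [Real.dist_eq, dist_eq_norm]
    exact hφ x y
  have herr := fun i => (hmesh i).abs_lagrange_sub_le hL hφ hφΛ (meshSize_nonneg _)
  obtain ⟨D, hD1, hD⟩ := exists_depth_le hd hb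
  refine tendsto_seminorm_zero_of_le_min hd hs₀ hs₁ hb ho hdep
    (N := 2 * (L * ρ) + (L * κ + L) * D) (by positivity)
    (Eventually.of_forall fun i => ?_) ?_ (Eventually.of_forall fun x => ?_)
  · exact (((hmesh i).measurable_Vh ((hmesh i).lagrange_mem φ)).sub hφc.measurable).aemeasurable
  · filter_upwards [eventually_meshSize_lt mesh hρ] with i hi
    refine Eventually.of_forall fun ⟨x, y⟩ hx => ?_
    refine abs_sub_le_min_of_lipschitz hd hb ho (by positivity) hD (fun x => ?_) hx fun hxy => ?_
    · exact (herr i x).trans (by gcongr)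
    · simp only at hxy ⊢
      have h1 := (hmesh i).abs_lagrange_sub_lagrange_le hΩΛ (hsh i) hL hφ hxy
      have h2 := hφ x y
      calc |(lagrange (mesh i) φ - φ) x - (lagrange (mesh i) φ - φ) y|
          = |(lagrange (mesh i) φ x - lagrange (mesh i) φ y) - (φ x - φ y)| := by
            simp only [Pi.sub_apply]; congr 1; ring
        _ ≤ _ := abs_sub _ _
        _ ≤ (L * κ + L) * ‖x - y‖ := by linarith
  · refine squeeze_zero_norm (fun i => herr i x) ?_
    simpa using (tendsto_comap (f := fun i => meshSize (mesh i)) (x := 𝓝 0)).const_mul L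

/-- Convergence almost everywhere of the exterior interpolants. -/
theorem ae_tendsto_exteriorClement (hmesh : ∀ i, IsMesh (mesh i) Λ)
    (hmeshΩ : ∀ i, MeshesExactly (mesh i) Ω) (hd : 1 ≤ d)
    (hb : Bornology.IsBounded Ω) (ho : IsOpen Ω) (hreg : interior (closure Ω) ⊆ Ω)
    (hΩΛ : closure Ω ⊆ interior Λ) (hκ : 1 ≤ κ) (hsh : ∀ i, IsShapeRegular κ (mesh i))
    (hg : LocallyIntegrable g) (hgΛ : ∀ᵐ x ∂(volume : Measure (E d)), x ∉ Λ → g x = 0) :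
    ∀ᵐ x, Tendsto (fun i => exteriorClement (mesh i) Ω g x - Ωᶜ.indicator g x)
      (comap (fun i => meshSize (mesh i)) (𝓝 0)) (𝓝 0) := by
  have hC := stabilityConst_pos (d := d) hκ
  filter_upwards [hgΛ, IsUnifLocDoublingMeasure.ae_tendsto_average_norm_sub volume hg 1]
    with x hxΛ hleb
  by_cases hx : x ∈ Ω
  · rw [indicator_of_notMem (by simpa using hx)]
    refine tendsto_const_nhds.congr' ?_
    filter_upwards [eventually_meshSize_lt mesh (depth_pos hd hb ho hx)] with i hi
    rw [(hmesh i).exteriorClement_eq_zero hi, sub_zero]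
  rw [indicator_of_mem hx]
  by_cases hxL : x ∈ Λ
  -- Lebesgue differentiation with balls centred at x itself.
  · have hl := hleb (l := 𝓝[>] (0 : ℝ)) (fun _ => x) id tendsto_id (by
      filter_upwards [self_mem_nhdsWithin] with ρ hρ
      exact Metric.mem_closedBall_self (by rw [one_mul]; exact le_of_lt hρ))
    rw [Metric.tendsto_nhds]
    intro ε hε
    set C := stabilityConst d κ * 2 ^ d with hCdef
    have hCpos : 0 < C := by positivity
    have hev := hl.eventually (ge_mem_nhds (show 0 < ε / (2 * C) by positivity))
    obtain ⟨η, hη, hsub⟩ := mem_nhdsGT_iff_exists_Ioo_subset.1 hev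
    have hη : 0 < η := hη
    filter_upwards [eventually_meshSize_lt mesh (show 0 < η / 2 by positivity)] with i hi
    have := abs_exteriorClement_sub_le_of_average (hmesh i) (hmeshΩ i) hd ho hreg hΩΛ hκ (hsh i) hg
      hxL hx (ε := ε / (2 * C)) (η := η) (fun ρ h0 h1 => hsub ⟨h0, h1⟩) (by linarith)
    rw [dist_zero_right, Real.norm_eq_abs]
    refine this.trans_lt ?_
    have e : stabilityConst d κ * (2 ^ d * (ε / (2 * C))) = ε / 2 := by
      rw [← mul_assoc, ← hCdef]; field_simp
    rw [e]
    exact half_lt_self hε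
  · refine tendsto_const_nhds.congr fun i => ?_
    rw [((hmesh i).exteriorClement_mem Ω g).2.2 x (by rwa [(hmesh i).space_eq]), hxΛ hxL, sub_zero]

theorem tendsto_seminorm_exteriorClement_sub (hmesh : ∀ i, IsMesh (mesh i) Λ)
    (hmeshΩ : ∀ i, MeshesExactly (mesh i) Ω) (hd : 1 ≤ d) (hs₀ : 0 < s)
    (hs₁ : s < 1 / 2) (hb : Bornology.IsBounded Ω) (ho : IsOpen Ω)
    (hreg : interior (closure Ω) ⊆ Ω)
    (hΩΛ : closure Ω ⊆ interior Λ) (hκ : 1 ≤ κ) (hsh : ∀ i, IsShapeRegular κ (mesh i))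
    (hdep : ∫⁻ x in Ω, ENNReal.ofReal (depth Ω x ^ (-(2 * s))) < ∞)
    (hgm : AEMeasurable g) {M : ℝ} (hM0 : 0 ≤ M) (hM : ∀ᵐ x, |g x| ≤ M)
    (hg : LocallyIntegrable g) (hgΛ : ∀ᵐ x ∂(volume : Measure (E d)), x ∉ Λ → g x = 0) :
    Tendsto (fun i => seminorm s (Q Ω) (exteriorClement (mesh i) Ω g - Ωᶜ.indicator g))
      (comap (fun i => meshSize (mesh i)) (𝓝 0)) (𝓝 0) := by
  have hC := stabilityConst_pos (d := d) hκ
  set N := stabilityConst d κ * M with hN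
  have hN0 : 0 ≤ N := by positivity
  refine tendsto_seminorm_zero_of_le_min hd hs₀ hs₁ hb ho hdep (N := 4 * κ * N + M) (by positivity)
    (Eventually.of_forall fun i => ?_) (Eventually.of_forall fun i => ?_)
    (ae_tendsto_exteriorClement hmesh hmeshΩ hd hb ho hreg hΩΛ hκ hsh hg hgΛ)
  · exact ((hmesh i).measurable_Vh ((hmesh i).exteriorClement_mem Ω g)).aemeasurable.sub
      (hgm.indicator ho.measurableSet.compl)
  · filter_upwards [ae_snd hM] with ⟨x, y⟩ hgy hx
    simp only at hx hgy ⊢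
    simp only [Pi.sub_apply]
    rw [indicator_of_notMem (by simpa using hx : x ∉ Ωᶜ), sub_zero]
    have h0 : 0 ≤ min 1 (‖x - y‖ / depth Ω x) :=
      le_min zero_le_one (div_nonneg (norm_nonneg _) (depth_nonneg _))
    by_cases hy : y ∈ Ω
    · rw [indicator_of_notMem (by simpa using hy : y ∉ Ωᶜ), sub_zero]
      refine (abs_exteriorClement_sub_le (hmesh i) (hmeshΩ i) hd ho hreg hΩΛ hκ (hsh i) hg hb hM0
        hM hx y).trans ?_
      gcongr
      linarith
    · rw [indicator_of_mem hy, min_one_eq_of_notMem hd hb ho hx hy, mul_one]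
      have hbd := abs_exteriorClement_le (hmesh i) (hmeshΩ i) hd ho hreg hΩΛ hκ (hsh i) hg hM0 hM
      have h1 := hbd x
      have h2 := hbd y
      rw [← hN] at h1 h2
      rw [abs_le] at *
      constructor <;> nlinarith

theorem abs_indicator_compl_sub_le (hd : 1 ≤ d) (hb : Bornology.IsBounded Ω) (ho : IsOpen Ω)
    {N : ℝ} (hN0 : 0 ≤ N) {x y : E d} (hN : |v y| ≤ N) (hx : x ∈ Ω) :
    |Ωᶜ.indicator v x - Ωᶜ.indicator v y| ≤ N * min 1 (‖x - y‖ / depth Ω x) := by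
  rw [indicator_of_notMem (by simpa using hx : x ∉ Ωᶜ), zero_sub, abs_neg]
  by_cases hy : y ∈ Ω
  · rw [indicator_of_notMem (by simpa using hy : y ∉ Ωᶜ), abs_zero]
    exact mul_nonneg hN0 (le_min zero_le_one (div_nonneg (norm_nonneg _) (depth_nonneg _)))
  · rw [indicator_of_mem hy, min_one_eq_of_notMem hd hb ho hx hy, mul_one]
    exact hN

theorem seminorm_indicator_compl_lt_top (hd : 1 ≤ d) (hs₀ : 0 < s)
    (hs₁ : s < 1 / 2) (hb : Bornology.IsBounded Ω) (ho : IsOpen Ω)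
    (hdep : ∫⁻ x in Ω, ENNReal.ofReal (depth Ω x ^ (-(2 * s))) < ∞)
    {N : ℝ} (hN0 : 0 ≤ N) (hN : ∀ᵐ x, |v x| ≤ N) :
    seminorm s (Q Ω) (Ωᶜ.indicator v) < ∞ := by
  refine seminorm_lt_top_of_le_min hd hs₀ hs₁ hb ho hdep hN0 ?_
  filter_upwards [ae_snd hN] with p hp hx
  exact abs_indicator_compl_sub_le hd hb ho hN0 hp hx

/-- The error in the exterior data, extended by zero into Ω, is the correction that makes a discrete
function admissible for the continuous problem. -/
theorem tendsto_seminorm_indicator_sub_exteriorClement (hmesh : ∀ i, IsMesh (mesh i) Λ)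
    (hmeshΩ : ∀ i, MeshesExactly (mesh i) Ω) (hd : 1 ≤ d) (hs₀ : 0 < s)
    (hs₁ : s < 1 / 2) (hb : Bornology.IsBounded Ω) (ho : IsOpen Ω)
    (hreg : interior (closure Ω) ⊆ Ω)
    (hΩΛ : closure Ω ⊆ interior Λ) (hκ : 1 ≤ κ) (hsh : ∀ i, IsShapeRegular κ (mesh i))
    (hdep : ∫⁻ x in Ω, ENNReal.ofReal (depth Ω x ^ (-(2 * s))) < ∞)
    (hgm : AEMeasurable g) {M : ℝ} (hM0 : 0 ≤ M) (hM : ∀ᵐ x, |g x| ≤ M)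
    (hg : LocallyIntegrable g) (hgΛ : ∀ᵐ x ∂(volume : Measure (E d)), x ∉ Λ → g x = 0) :
    Tendsto (fun i => seminorm s (Q Ω) (Ωᶜ.indicator (g - exteriorClement (mesh i) Ω g)))
      (comap (fun i => meshSize (mesh i)) (𝓝 0)) (𝓝 0) := by
  have hC := stabilityConst_pos (d := d) hκ
  refine tendsto_seminorm_zero_of_le_min hd hs₀ hs₁ hb ho hdep
    (N := M + stabilityConst d κ * M) (by positivity)
    (Eventually.of_forall fun i => ?_) (Eventually.of_forall fun i => ?_) ?_
  · exact (hgm.sub ((hmesh i).measurable_Vh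
      ((hmesh i).exteriorClement_mem Ω g)).aemeasurable).indicator ho.measurableSet.compl
  · filter_upwards [ae_snd hM] with p hp hx
    refine abs_indicator_compl_sub_le hd hb ho (by positivity) ?_ hx
    exact (abs_sub _ _).trans (add_le_add hp
      (abs_exteriorClement_le (hmesh i) (hmeshΩ i) hd ho hreg hΩΛ hκ (hsh i) hg hM0 hM _))
  · filter_upwards [ae_tendsto_exteriorClement hmesh hmeshΩ hd hb ho hreg hΩΛ hκ hsh hg hgΛ]
      with x hx
    by_cases hxΩ : x ∈ Ω
    · simpa [hxΩ] using tendsto_const_nhds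
    · have hxc : x ∈ Ωᶜ := hxΩ
      simp only [indicator_of_mem hxc, Pi.sub_apply] at hx ⊢
      simpa using hx.neg

end discrete

/-! ### The solutions -/

section solutions
variable {d : ℕ} {s : ℝ} {K : Complex d} {Ω Λ : Set (E d)} {κ : ℝ} {g u v w : E d → ℝ}

theorem aemeasurable_of_mem_V (ho : IsOpen Ω) (hgm : AEMeasurable g) (hv : v ∈ V s Ω g) :
    AEMeasurable v := by
  obtain ⟨h1, -, h2, -⟩ := hv
  have h3 : AEMeasurable v (volume.restrict Ω) := h1.aemeasurable
  have h4 : AEMeasurable v (volume.restrict Ωᶜ) := by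
    refine hgm.restrict.congr ?_
    filter_upwards [ae_restrict_of_ae h2, ae_restrict_mem ho.measurableSet.compl] with x hx hxΩ
    exact (hx hxΩ).symm
  have := aemeasurable_union_iff.2 ⟨h3, h4⟩
  rwa [union_compl_self, Measure.restrict_univ] at this

theorem sub_mem_V (ho : IsOpen Ω) (hgm : AEMeasurable g) (hv : v ∈ V s Ω g) (hw : w ∈ V s Ω g) :
    v - w ∈ V s Ω 0 := by
  have hvm := aemeasurable_of_mem_V ho hgm hv
  refine ⟨hv.1.sub hw.1, ?_, ?_, ?_⟩
  · exact (seminorm_sub_le hvm).trans_lt (ENNReal.add_lt_top.2 ⟨hv.2.1, hw.2.1⟩)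
  · filter_upwards [hv.2.2.1, hw.2.2.1] with x h1 h2 hx
    rw [Pi.sub_apply, h1 hx, h2 hx, sub_self, Pi.zero_apply]
  · exact (seminorm_sub_le hvm).trans_lt (ENNReal.add_lt_top.2 ⟨hv.2.2.2, hw.2.2.2⟩)

theorem IsWeakSolution.energy_le (hd : 1 ≤ d) (hs₀ : 0 < s) (ho : IsOpen Ω) (hgm : AEMeasurable g)
    (hu : IsWeakSolution s Ω g u) (hv : v ∈ V s Ω g) : energy s Ω u ≤ energy s Ω v :=
  energy_le_of_a_eq_zero hd hs₀ (aemeasurable_of_mem_V ho hgm hu.1)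
    (aemeasurable_of_mem_V ho hgm hv) hu.1.2.2.2 (sub_mem_V ho hgm hv hu.1).2.2.2
    (hu.2 _ (sub_mem_V ho hgm hv hu.1))

/-- The projection is only a chosen object, so this follows from its stability with bound 0. It
identifies the discrete test space with mesh functions vanishing on Λ \ Ω. -/
theorem IsMesh.exteriorClement_zero (hK : IsMesh K Λ) (hKΩ : MeshesExactly K Ω) (hd : 1 ≤ d)
    (ho : IsOpen Ω) (hreg : interior (closure Ω) ⊆ Ω) (hΩΛ : closure Ω ⊆ interior Λ) (hκ : 1 ≤ κ)
    (hsh : IsShapeRegular κ K) (x : E d) : exteriorClement K Ω 0 x = 0 := by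
  have := abs_exteriorClement_le (g := 0) hK hKΩ hd ho hreg hΩΛ hκ hsh
    (locallyIntegrable_const 0) le_rfl (by simp) x
  simpa using this

theorem IsDiscreteSolution.energy_le (hK : IsMesh K Λ) (hKΩ : MeshesExactly K Ω) (hd : 1 ≤ d)
    (hs₀ : 0 < s) (hs₁ : s < 1 / 2) (hb : Bornology.IsBounded Ω)
    (ho : IsOpen Ω) (hreg : interior (closure Ω) ⊆ Ω) (hΩΛ : closure Ω ⊆ interior Λ) (hκ : 1 ≤ κ)
    (hsh : IsShapeRegular κ K)
    (hdep : ∫⁻ x in Ω, ENNReal.ofReal (depth Ω x ^ (-(2 * s))) < ∞)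
    (hu : IsDiscreteSolution s K Ω g u) (hv : v ∈ Vhg K Ω g) : energy s Ω u ≤ energy s Ω v := by
  have hfin := fun {w : E d → ℝ} (hw : w ∈ Vh K) =>
    hK.seminorm_Vh_lt_top hd hs₀ hs₁ hb ho hΩΛ hsh hdep hw
  refine energy_le_of_a_eq_zero hd hs₀ (hK.measurable_Vh hu.1.1).aemeasurable
    (hK.measurable_Vh hv.1).aemeasurable (hfin hu.1.1) (hfin (Vh_sub hv.1 hu.1.1))
    (hu.2 _ ⟨Vh_sub hv.1 hu.1.1, fun x hx => ?_⟩)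
  rw [hK.exteriorClement_zero hKΩ hd ho hreg hΩΛ hκ hsh, Pi.sub_apply, hv.2 x hx, hu.1.2 x hx,
    sub_self]

/-- A function that vanishes outside `Ω` inherits integrability against `dist(·, Ωᶜ)^{-2s}` from
its seminorm. -/
theorem lintegral_mul_depth_lt_top (ho : IsOpen Ω) (hum : Measurable u)
    (hu0 : ∀ x ∉ Ω, u x = 0) (hu : seminorm s (Ω ×ˢ univ) u < ∞) {c : ℝ} (hc : 0 < c)
    (hΩc : ∀ x ∈ Ω, ENNReal.ofReal (c * depth Ω x ^ (-(2 * s))) ≤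
      ∫⁻ y in Ωᶜ, ENNReal.ofReal (1 / ‖x - y‖ ^ ((d : ℝ) + 2 * s))) :
    ∫⁻ x in Ω, ENNReal.ofReal (|u x| * depth Ω x ^ (-(2 * s))) < ∞ := by
  have h1 : ∀ x ∈ Ω, ENNReal.ofReal (|u x| * depth Ω x ^ (-(2 * s))) ≤
      ENNReal.ofReal c⁻¹ * ∫⁻ y in Ωᶜ,
        ENNReal.ofReal (|u x - u y| / ‖x - y‖ ^ ((d : ℝ) + 2 * s)) := by
    intro x hx
    have e : |u x| * depth Ω x ^ (-(2 * s)) = c⁻¹ * (|u x| * (c * depth Ω x ^ (-(2 * s)))) := by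
      field_simp
    rw [e, ENNReal.ofReal_mul (by positivity), ENNReal.ofReal_mul (abs_nonneg _)]
    gcongr
    -- For y outside Ω, |u(x) - u(y)| = |u(x)|, so the exterior part of the seminorm bounds the
    -- weighted integral: a Hardy inequality without a differential term.
    refine (mul_le_mul_right (hΩc x hx) _).trans ?_
    rw [← lintegral_const_mul' _ _ (by simp)]
    refine setLIntegral_mono' ho.measurableSet.compl fun y hy => ?_
    rw [← ENNReal.ofReal_mul (abs_nonneg _), hu0 y hy, sub_zero, mul_one_div]
  refine (setLIntegral_mono' ho.measurableSet h1).trans_lt ?_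
  rw [lintegral_const_mul' _ _ (by simp)]
  refine ENNReal.mul_lt_top (by simp) ?_
  have h2 := setLIntegral_prod (μ := (volume : Measure (E d))) (ν := (volume : Measure (E d)))
    (s := Ω) (t := Ωᶜ)
    (fun p : E d × E d => ENNReal.ofReal (|u p.1 - u p.2| / ‖p.1 - p.2‖ ^ ((d : ℝ) + 2 * s)))
    (by
      rw [← Measure.volume_eq_prod]
      exact (aemeasurable_seminorm_integrand hum.aemeasurable).restrict)
  rw [← h2, ← Measure.volume_eq_prod]
  exact (seminorm_mono (prod_mono_right (subset_univ _))).trans_lt hu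

theorem exists_ae_abs_le (hg : MemLp g ∞ volume) : ∃ M, 0 ≤ M ∧ ∀ᵐ x, |g x| ≤ M := by
  refine ⟨(eLpNorm g ∞ volume).toReal, ENNReal.toReal_nonneg, ?_⟩
  filter_upwards [ae_le_eLpNormEssSup (f := g) (μ := volume)] with x hx
  rw [← eLpNorm_exponent_top, enorm_eq_nnnorm] at hx
  have := ENNReal.toReal_mono hg.2.ne hx
  simpa using this

/-- A Borel representative of u, set to zero outside Ω. Subtracting the exterior data keeps the
seminorm finite because bounded jumps across ∂Ω do. -/
theorem exists_interior_part (hd : 1 ≤ d) (hs₀ : 0 < s) (hs₁ : s < 1 / 2)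
    (hb : Bornology.IsBounded Ω) (ho : IsOpen Ω)
    (hdep : ∫⁻ x in Ω, ENNReal.ofReal (depth Ω x ^ (-(2 * s))) < ∞)
    (hgm : AEMeasurable g) {M : ℝ} (hM0 : 0 ≤ M) (hM : ∀ᵐ x, |g x| ≤ M) (hu : u ∈ V s Ω g) :
    ∃ u₀ : E d → ℝ, Measurable u₀ ∧ (∀ x ∉ Ω, u₀ x = 0) ∧ Integrable u₀ ∧
      u =ᵐ[volume] u₀ + Ωᶜ.indicator g ∧ seminorm s (Ω ×ˢ univ) u₀ < ∞ := by
  have hum := aemeasurable_of_mem_V ho hgm hu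
  have hmk : hum.mk u =ᵐ[volume] u := hum.ae_eq_mk.symm
  set u₀ := Ω.indicator (hum.mk u) with hu₀
  have he : u =ᵐ[volume] u₀ + Ωᶜ.indicator g := by
    filter_upwards [hmk, hu.2.2.1] with x h1 h2
    by_cases hx : x ∈ Ω
    · simp [hu₀, hx, h1]
    · simp [hu₀, hx, h2 hx]
  refine ⟨u₀, hum.measurable_mk.indicator ho.measurableSet, fun x hx => indicator_of_notMem hx _,
    ?_, he, ?_⟩
  · refine (integrable_indicator_iff ho.measurableSet).2 (hu.1.congr ?_)
    exact ae_restrict_of_ae hmk.symm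
  · have h1 : u₀ =ᵐ[volume] u - Ωᶜ.indicator g := by
      filter_upwards [he] with x hx
      simp [hx]
    refine (seminorm_mono prod_univ_subset_Q).trans_lt ?_
    rw [seminorm_congr_ae h1]
    exact (seminorm_sub_le hum).trans_lt (ENNReal.add_lt_top.2 ⟨hu.2.2.2,
      seminorm_indicator_compl_lt_top hd hs₀ hs₁ hb ho hdep hM0 hM⟩)

variable {ι : Type*} {mesh : ι → Complex d} {uh : ι → E d → ℝ}

/-- The upper half: the competitor is the interpolant of φ plus Π_h^c g. The three ε are the
interpolation error, the approximation error of φ and the exterior data error. -/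
theorem eventually_energy_discrete_le [Nonempty ι] (hmesh : ∀ i, IsMesh (mesh i) Λ)
    (hmeshΩ : ∀ i, MeshesExactly (mesh i) Ω) (hd : 1 ≤ d) (hs₀ : 0 < s)
    (hs₁ : s < 1 / 2) (hb : Bornology.IsBounded Ω) (ho : IsOpen Ω)
    (hreg : interior (closure Ω) ⊆ Ω)
    (hΩΛ : closure Ω ⊆ interior Λ) (hκ : 1 ≤ κ) (hsh : ∀ i, IsShapeRegular κ (mesh i))
    (hg : MemLp g ∞ volume) (hgΛ : ∀ᵐ x ∂(volume : Measure (E d)), x ∉ Λ → g x = 0)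
    (hu : u ∈ V s Ω g) (huh : ∀ i, IsDiscreteSolution s (mesh i) Ω g (uh i)) {ε : ℝ≥0∞}
    (hε : 0 < ε) :
    ∀ᶠ i in comap (fun i => meshSize (mesh i)) (𝓝 0),
      energy s Ω (uh i) ≤ energy s Ω u + 2 * (ε + (ε + ε)) := by
  obtain ⟨i₀⟩ := ‹Nonempty ι›
  have hdep := (hmesh i₀).lintegral_depth_lt_top (hmeshΩ i₀) hd hs₀ hs₁ ho hb hreg
  obtain ⟨M, hM0, hM⟩ := exists_ae_abs_le hg
  have hgm := hg.1.aemeasurable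
  have hgi : LocallyIntegrable g := hg.locallyIntegrable le_top
  have hum := aemeasurable_of_mem_V ho hgm hu
  obtain ⟨u₀, hu₀m, hu₀0, hu₀i, hu₀e, hu₀s⟩ :=
    exists_interior_part hd hs₀ hs₁ hb ho hdep hgm hM0 hM hu
  obtain ⟨c, hc, hΩc⟩ := (hmesh i₀).exists_le_lintegral_compl (hmeshΩ i₀) hd hs₀ ho hb hreg hΩΛ
  have hu₀w := lintegral_mul_depth_lt_top ho hu₀m hu₀0 hu₀s hc hΩc
  obtain ⟨φ, ⟨L, hL0, hL⟩, ⟨ρ, hρ, hφρ⟩, hφu⟩ :=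
    exists_lipschitz_approx hd hs₀ hs₁ hb ho hu₀m hu₀0 hu₀i hu₀s hu₀w hε
  have hT1 := tendsto_seminorm_lagrange_sub hmesh hd hs₀ hs₁ hb ho hΩΛ hκ hsh hdep hL0 hL hρ hφρ
  have hT2 := tendsto_seminorm_exteriorClement_sub hmesh hmeshΩ hd hs₀ hs₁ hb ho hreg hΩΛ hκ hsh
    hdep hgm hM0 hM hgi hgΛ
  have hφc : Continuous φ := by
    refine LipschitzWith.continuous (K := ⟨L, hL0⟩) (LipschitzWith.of_dist_le_mul fun x y => ?_)
    rw [Real.dist_eq, dist_eq_norm]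
    exact hL x y
  filter_upwards [hT1.eventually (ge_mem_nhds hε), hT2.eventually (ge_mem_nhds hε),
    eventually_meshSize_lt mesh hρ] with i h1 h2 hi
  have hvm : lagrange (mesh i) φ + exteriorClement (mesh i) Ω g ∈ Vhg (mesh i) Ω g := by
    refine ⟨Vh_add ((hmesh i).lagrange_mem φ) ((hmesh i).exteriorClement_mem Ω g), fun x hx => ?_⟩
    -- Once h ≤ ρ, the interpolant of φ vanishes outside Ω, so the sum has the prescribed exterior
    -- values.
    rw [Pi.add_apply, (hmesh i).lagrange_eq_zero hφρ hi.le hx.2, zero_add]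
  refine ((huh i).energy_le (hmesh i) (hmeshΩ i) hd hs₀ hs₁ hb ho hreg hΩΛ hκ (hsh i) hdep
    hvm).trans ((energy_le_add hd hs₀ hum).trans ?_)
  gcongr
  have he : lagrange (mesh i) φ + exteriorClement (mesh i) Ω g - u =ᵐ[volume]
      (lagrange (mesh i) φ - φ) +
        ((φ - u₀) + (exteriorClement (mesh i) Ω g - Ωᶜ.indicator g)) := by
    filter_upwards [hu₀e] with x hx
    simp only [Pi.add_apply, Pi.sub_apply] at hx ⊢
    rw [hx]
    ring
  rw [seminorm_congr_ae he]
  refine (seminorm_add_le (((hmesh i).measurable_Vh ((hmesh i).lagrange_mem φ)).sub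
    hφc.measurable).aemeasurable).trans (add_le_add h1 ?_)
  exact (seminorm_add_le (hφc.measurable.sub hu₀m).aemeasurable).trans (add_le_add hφu h2)

/-- The lower half: replacing the exterior values of u_h by g gives a competitor for u, so only the
exterior data error enters and u_h itself needs no uniform bound. -/
theorem eventually_le_energy_discrete [Nonempty ι] (hmesh : ∀ i, IsMesh (mesh i) Λ)
    (hmeshΩ : ∀ i, MeshesExactly (mesh i) Ω) (hd : 1 ≤ d) (hs₀ : 0 < s)
    (hs₁ : s < 1 / 2) (hb : Bornology.IsBounded Ω) (ho : IsOpen Ω)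
    (hreg : interior (closure Ω) ⊆ Ω)
    (hΩΛ : closure Ω ⊆ interior Λ) (hκ : 1 ≤ κ) (hsh : ∀ i, IsShapeRegular κ (mesh i))
    (hg : MemLp g ∞ volume) (hgΛ : ∀ᵐ x ∂(volume : Measure (E d)), x ∉ Λ → g x = 0)
    (hu : IsWeakSolution s Ω g u) (huh : ∀ i, uh i ∈ Vhg (mesh i) Ω g) {ε : ℝ≥0∞}
    (hε : 0 < ε) :
    ∀ᶠ i in comap (fun i => meshSize (mesh i)) (𝓝 0),
      energy s Ω u ≤ energy s Ω (uh i) + 2 * ε := by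
  obtain ⟨i₀⟩ := ‹Nonempty ι›
  have hdep := (hmesh i₀).lintegral_depth_lt_top (hmeshΩ i₀) hd hs₀ hs₁ ho hb hreg
  obtain ⟨M, hM0, hM⟩ := exists_ae_abs_le hg
  have hgm := hg.1.aemeasurable
  have hgi : LocallyIntegrable g := hg.locallyIntegrable le_top
  have hT := tendsto_seminorm_indicator_sub_exteriorClement hmesh hmeshΩ hd hs₀ hs₁ hb ho hreg hΩΛ
    hκ hsh hdep hgm hM0 hM hgi hgΛ
  filter_upwards [hT.eventually (ge_mem_nhds (lt_min hε one_pos))] with i hi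
  set r := Ωᶜ.indicator (g - exteriorClement (mesh i) Ω g) with hr
  have huhm := (hmesh i).measurable_Vh (huh i).1
  have hfin : seminorm s (Q Ω) (uh i + r) < ∞ :=
    (seminorm_add_le huhm.aemeasurable).trans_lt (ENNReal.add_lt_top.2
      ⟨(hmesh i).seminorm_Vh_lt_top hd hs₀ hs₁ hb ho hΩΛ (hsh i) hdep (huh i).1,
        (hi.trans (min_le_right _ _)).trans_lt ENNReal.one_lt_top⟩)
  have hmem : uh i + r ∈ V s Ω g := by
    refine ⟨?_, ?_, Eventually.of_forall fun x hx => ?_, hfin⟩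
    · obtain ⟨N, hN0, hN⟩ := (hmesh i).exists_bound_Vh (huh i).1
      have h1 : IntegrableOn (uh i) Ω :=
        Measure.integrableOn_of_bounded (M := N) hb.measure_lt_top.ne huhm.aestronglyMeasurable
          (Eventually.of_forall hN)
      refine h1.congr_fun (fun x hx => ?_) ho.measurableSet
      simp [hr, hx]
    · refine (seminorm_mono fun p hp => ?_).trans_lt hfin
      simp only [Q, mem_compl_iff, mem_prod] at hp ⊢
      tauto
    · have hxG : uh i x = exteriorClement (mesh i) Ω g x := by
        by_cases hxΛ : x ∈ (mesh i).space
        · exact (huh i).2 x ⟨hxΛ, hx⟩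
        · rw [(huh i).1.2.2 x hxΛ, ((hmesh i).exteriorClement_mem Ω g).2.2 x hxΛ]
      rw [Pi.add_apply, hr, indicator_of_mem (show x ∈ Ωᶜ from hx), Pi.sub_apply, hxG]
      ring
  refine (hu.energy_le hd hs₀ ho hgm hmem).trans
    ((energy_le_add hd hs₀ huhm.aemeasurable).trans ?_)
  rw [add_sub_cancel_left]
  gcongr
  exact hi.trans (min_le_left _ _)

end solutions

end NonlocalMinimalGraph

theorem theorem4p1 {d : ℕ} (hd : 1 ≤ d) {s : ℝ} (hs₀ : 0 < s) (hs₁ : s < 1 / 2)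
    {Ω Λ : Set (NonlocalMinimalGraph.E d)}
    (hΩ : NonlocalMinimalGraph.IsBoundedLipschitzDomain Ω)
    (hΩΛ : closure Ω ⊆ interior Λ)
    {g : NonlocalMinimalGraph.E d → ℝ} (hg : MemLp g ∞ volume)
    (hgΛ : ∀ᵐ x ∂(volume : Measure (NonlocalMinimalGraph.E d)), x ∉ Λ → g x = 0)
    {ι : Type*} (mesh : ι → NonlocalMinimalGraph.Complex d)
    (hmesh : ∀ i, NonlocalMinimalGraph.IsMesh (mesh i) Λ)
    (hmeshΩ : ∀ i, NonlocalMinimalGraph.MeshesExactly (mesh i) Ω)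
    (hshape : ∃ σ : ℝ, ∀ i, ∀ t ∈ NonlocalMinimalGraph.elements (mesh i),
      NonlocalMinimalGraph.elementSize t ≤ σ * NonlocalMinimalGraph.inball t)
    {u : NonlocalMinimalGraph.E d → ℝ} (hu : NonlocalMinimalGraph.IsWeakSolution s Ω g u)
    {uh : ι → NonlocalMinimalGraph.E d → ℝ}
    (huh : ∀ i, NonlocalMinimalGraph.IsDiscreteSolution s (mesh i) Ω g (uh i)) :
    NonlocalMinimalGraph.energy s Ω u < ∞ ∧
    (∀ i, NonlocalMinimalGraph.energy s Ω (uh i) < ∞) ∧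
    Tendsto (fun i => NonlocalMinimalGraph.energy s Ω (uh i))
      (comap (fun i => NonlocalMinimalGraph.meshSize (mesh i)) (𝓝 0))
      (𝓝 (NonlocalMinimalGraph.energy s Ω u)) := by
  have ho := hΩ.isOpen
  have hb := hΩ.isBounded
  have hreg := hΩ.interior_closure_subset
  obtain ⟨κ, hκ, hsh⟩ := NonlocalMinimalGraph.exists_isShapeRegular hd hshape
  have hfin : NonlocalMinimalGraph.energy s Ω u < ∞ :=
    NonlocalMinimalGraph.energy_lt_top hd hs₀ hu.1.2.2.2
  refine ⟨hfin, fun i => ?_, ?_⟩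
  · exact NonlocalMinimalGraph.energy_lt_top hd hs₀
      ((hmesh i).seminorm_Vh_lt_top hd hs₀ hs₁ hb ho hΩΛ (hsh i)
        ((hmesh i).lintegral_depth_lt_top (hmeshΩ i) hd hs₀ hs₁ ho hb hreg) (huh i).1.1)
  · rcases isEmpty_or_nonempty ι with hι | hι
    -- Without any mesh the limit is vacuous; otherwise one mesh supplies the geometric facts about
    -- Ω.
    · exact tendsto_of_isEmpty
    rw [ENNReal.tendsto_nhds hfin.ne]
    intro ε hε
    have hε6 : 0 < ε / 6 := ENNReal.div_pos hε.ne' (by simp)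
    have e6 : 2 * (ε / 6 + (ε / 6 + ε / 6)) = ε := by
      have : 2 * (ε / 6 + (ε / 6 + ε / 6)) = 6 * (ε / 6) := by ring
      rw [this, ENNReal.mul_div_cancel (by simp) (by simp)]
    have e2 : 2 * (ε / 2) = ε := ENNReal.mul_div_cancel (by simp) (by simp)
    filter_upwards [NonlocalMinimalGraph.eventually_energy_discrete_le hmesh hmeshΩ hd hs₀ hs₁ hb ho
        hreg hΩΛ hκ hsh hg hgΛ hu.1 huh hε6,
      NonlocalMinimalGraph.eventually_le_energy_discrete hmesh hmeshΩ hd hs₀ hs₁ hb ho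
        hreg hΩΛ hκ hsh hg hgΛ hu (fun i => (huh i).1) (ENNReal.half_pos hε.ne')] with i h1 h2
    rw [e6] at h1
    rw [e2] at h2
    exact ⟨tsub_le_iff_right.2 h2, h1⟩
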